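/- **Setting.** An operator-valued $C^*$-probability space $(\mathcal A,E,\mathcal B)$ consists of a unital $C^*$-algebra $\mathcal A$, a unital $C^*$-subalgebra $\mathcal B$ and a completely positive conditional expectation $E:\mathcal A\to\mathcal B$ (so $E(b)=b$ and $E(b_1ab_2)=b_1E(a)b_2$). The $\mathcal B$-distribution of $x\in\mathcal A$ is the collection of its moments $E[xb_1x\cdots b_{m-1}x]$ ($m\ge1$, $b_i\in\mathcal B$), and convergence in distribution over $\mathcal B$ is norm convergence of each of these moments. Subalgebras $\mathcal A_1,\dots,\mathcal A_n$ (non-unital, closed under multiplication by $\mathcal B$) are monotone independent over $\mathcal B$ if $E[x_1\cdots x_m]=E[x_1\cdots x_{j-1}E[x_j]x_{j+1}\cdots x_m]$ whenever $x_l\in\mathcal A_{i_l}$ for all $l$ and $i_{j-1}<i_j>i_{j+1}$ (an inequality being dropped if $j=1$ or $j=m$); elements are monotone independent if the non-unital $\mathcal B$-bimodule algebras they generate are. A self-adjoint $Y$ is *monotone $n$-divisible over $\mathcal B$* if it has the same $\mathcal B$-distribution as $y_1+\dots+y_n$ for some identically distributed self-adjoint elements $y_1,\dots,y_n$ that are monotone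 independent over $\mathcal B$, in some operator-valued $C^*$-probability space over $\mathcal B$. For a non-crossing partition $\pi$ of $\{1,\dots,n\}$ put $\tau(\pi)!=\prod_{V\in\pi}\#\{W\in\pi: W\subseteq\{\min V,\dots,\max V\}\}$, and for a family $f=(f_n)$ of maps $f_n:\mathcal A^n\to\mathcal B$ let $f_\pi(x_1,\dots,x_n)$ be the nested evaluation of $f$ along the blocks of $\pi$. The operator-valued monotone cumulants $h_n^{\mathcal B}:\mathcal A^n\to\mathcal B$ are determined by $E[x_1\cdots x_n]=\sum_{\pi\in NC(n)}\frac1{\tau(\pi)!}h^{\mathcal B}_\pi(x_1,\dots,x_n)$. A self-adjoint $A$ in some operator-valued $C^*$-probability space over $\mathcal B$, with expectation again written $E$, is a (centered) *$\mathcal B$-valued arcsine element with variance $\eta$* if $E[AbA]=\eta(b)$ for all $b\in\mathcal B$ and, for all $m\ge1$, $E[Ab_1A\cdots b_{m-1}A]=\sum_{\pi\in NC_2(m)}\frac1{\tau(\pi)!}E_\pi[Ab_1,\dots,Ab_{m-1},A]$, where $NC_2(m)$ is the set of non-crossing pair partitions (empty for odd $m$) and $E_\pi$ is the nested evaluation of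 $(x_1,\dots,x_n)\mapsto E[x_1\cdots x_n]$. For $x=x^*$, $k\in\mathbb N$ and $\mathfrak b\in\mathbb H^+(M_k(\mathcal B))$, i.e. $\Im(\mathfrak b)=\frac1{2i}(\mathfrak b-\mathfrak b^*)$ positive and invertible, let $\mathcal G_{1_k\otimes x}(\mathfrak b)=(\mathrm{id}_k\otimes E)\big[(\mathfrak b-1_k\otimes x)^{-1}\big]\in M_k(\mathcal B)$. Write $$H_4(Y)=\sup\big\{\|h_4^{\mathcal B}(Yb,Y,Yb',Y)\| : b,b'\in\mathcal B,\ \|b\|=\|b'\|=1\big\}.$$ **Theorem 4.5.** Let $Y=Y^*\in\mathcal A$ be monotone $n$-divisible over $\mathcal B$ for all $n\ge1$, with $E[Y]=0$ and $E[YbY]=\eta(b)$ for all $b\in\mathcal B$. Then $H_4(Y)<\infty$, and for every $\mathcal B$-valued arcsine element $A$ with variance $\eta$, every $k\in\mathbb N$ and every $\mathfrak b\in\mathbb H^+(M_k(\mathcal B))$, the elements $\mathfrak b-1_k\otimes Y$ and $\mathfrak b-1_k\otimes A$ are invertible and $$\big\|\mathcal G_{1_k\otimes Y}(\mathfrak b)-\mathcal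 G_{1_k\otimes A}(\mathfrak b)\big\|\le k\,\|\Im(\mathfrak b)^{-1}\|^4\sqrt{\|\eta(1)\|}\,\sqrt{H_4(Y)}.$$ **Corollary.** Let $(Y_N)_{N\in\mathbb N}$ be self-adjoint elements of $\mathcal A$, each monotone $n$-divisible over $\mathcal B$ for all $n\ge1$, with $E[Y_N]=0$, $E[Y_NbY_N]=\eta(b)$ for all $N$ and all $b\in\mathcal B$, and $\sup_N\|Y_N\|<\infty$. If $H_4(Y_N)\to0$ as $N\to\infty$, then a $\mathcal B$-valued arcsine element with variance $\eta$ exists, in some operator-valued $C^*$-probability space over $\mathcal B$, and $Y_N$ converges in distribution over $\mathcal B$ to every such element $A$. If, in addition, $\varphi$ is a state on $\mathcal A$ with $\varphi=\varphi\circ E$, then the distribution of $Y_N$ with respect to $\varphi$ converges to that of $A$ (with respect to $\varphi\circ E$, where $E$ is now the conditional expectation of the space of $A$): $\varphi(f(Y_N))\to\varphi(E[f(A)])$ for every continuous $f:\mathbb R\to\mathbb R$. -/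

import Mathlib

open Filter Topology
open scoped ComplexOrder

universe u v w z

/-! ### Noncrossing partitions -/

/-- A partition is noncrossing if there are no `a < c < b < d` with `a, b` in one block and
`c, d` in another one. -/
def IsNoncrossing {s : Finset ℕ} (π : Finpartition s) : Prop :=
  ∀ V ∈ π.parts, ∀ W ∈ π.parts, V ≠ W →
    ∀ a ∈ V, ∀ b ∈ V, ∀ c ∈ W, ∀ d ∈ W, ¬ (a < c ∧ c < b ∧ b < d)

instance {s : Finset ℕ} (π : Finpartition s) : Decidable (IsNoncrossing π) := by
  unfold IsNoncrossing
  infer_instance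

/-- `NC(n)`: the noncrossing partitions of an `n`-element linearly ordered set, which is taken to
be `{0, …, n - 1}`. -/
def NC (n : ℕ) : Finset (Finpartition (Finset.range n)) :=
  Finset.univ.filter fun π => IsNoncrossing π

/-- `NC₂(n)`: the noncrossing pair partitions. -/
def NC₂ (n : ℕ) : Finset (Finpartition (Finset.range n)) :=
  (NC n).filter fun π => ∀ V ∈ π.parts, V.card = 2

/-- The tree factorial `τ(π)! = ∏_{V ∈ π} #{W ∈ π | W ⊆ {min V, …, max V}}`. -/
def treeFactorial {s : Finset ℕ} (π : Finpartition s) : ℕ :=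
  ∏ V ∈ π.parts,
    (π.parts.filter fun W => ∀ w ∈ W, (∃ a ∈ V, a ≤ w) ∧ (∃ b ∈ V, w ≤ b)).card

/-- The elements of `S` lying strictly between `v ∈ V` and the next element of `V`
(none, if `v` is the last element of `V`). -/
def gapAfter (S V : Finset ℕ) (v : ℕ) : Finset ℕ :=
  S.filter fun s => v < s ∧ (∃ w ∈ V, s < w) ∧ ∀ w ∈ V, v < w → s < w

/-- The nested evaluation of a family `f = (f_n)` of multilinear maps `f_n : A^n → B`, given on
words (a list of length `n` stands for an element of `A^n`), along the blocks of a noncrossing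
partition of `S`. Here `x` gives the entries and `blk i` is the block of `i`; `ι` embeds `B`
in `A`.

If `V = {v₁ < ⋯ < v_r}` is the block of the least element of `S`, the value is
`f_r (x_{v₁} g₁, …, x_{v_r} g_r) * ρ`, where `g_j` is the value on the elements of `S` between
`v_j` and `v_{j+1}` (`g_r = 1`), and `ρ` is the value on the elements of `S` beyond `v_r`. For a
`B`-multilinear family this is what one obtains by successively replacing interval blocks by the
values of `f` on them. -/
def nestedEval {A B : Type*} [Mul A] [Mul B] [One B] (ι : B → A) (f : List A → B)
    (blk : ℕ → Finset ℕ) (x : ℕ → A) (S : Finset ℕ) : B :=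
  if h : S.Nonempty then
    let V := blk (S.min' h)
    f ((V.sort (· ≤ ·)).map fun v =>
        x v * ι (nestedEval ι f blk x (gapAfter (S.erase (S.min' h)) V v))) *
      nestedEval ι f blk x ((S.erase (S.min' h)).filter fun s => ∀ w ∈ V, w < s)
  else 1
termination_by S.card
decreasing_by
  · exact (Finset.card_filter_le _ _).trans_lt (Finset.card_erase_lt_of_mem (S.min'_mem h))
  · exact (Finset.card_filter_le _ _).trans_lt (Finset.card_erase_lt_of_mem (S.min'_mem h))

/-- `f_π (x₁, …, x_n)` for a noncrossing partition `π` of an `n`-element set and the word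
`l = [x₁, …, x_n]`. -/
def evalPartition {A B : Type*} [Mul A] [Zero A] [Mul B] [One B] (ι : B → A) (f : List A → B)
    {n : ℕ} (π : Finpartition (Finset.range n)) (l : List A) : B :=
  nestedEval ι f (fun i => π.part i) (fun i => l.getD i 0) (Finset.range n)

/-! ### Operator-valued probability spaces -/

/-- An operator-valued C⋆-probability space `(A, E, B)`: a unital C⋆-algebra `A`, a unital copy
`ι(B)` of the C⋆-algebra `B` in `A` (`ι` is injective because of `E_ι`), and a completely positive
conditional expectation `E : A → B`. -/
structure OVProbSpace (B : Type u) (A : Type v) [CStarAlgebra B] [PartialOrder B]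
    [StarOrderedRing B] [CStarAlgebra A] [PartialOrder A] [StarOrderedRing A] where
  ι : B →⋆ₐ[ℂ] A
  E : CompletelyPositiveMap A B
  E_ι : ∀ b, E (ι b) = b
  E_bimodule : ∀ b₁ a b₂, E (ι b₁ * a * ι b₂) = b₁ * E a * b₂

namespace OVProbSpace

variable {B : Type u} [CStarAlgebra B] [PartialOrder B] [StarOrderedRing B]
  {A : Type v} [CStarAlgebra A] [PartialOrder A] [StarOrderedRing A]
  {A' : Type w} [CStarAlgebra A'] [PartialOrder A'] [StarOrderedRing A']

/-- The word `[x b₁, x b₂, …, x b_{k-1}, x]` for the list `[b₁, …, b_{k-1}]`. -/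
noncomputable def word (P : OVProbSpace B A) (x : A) (l : List B) : List A :=
  (l.map fun b => x * P.ι b) ++ [x]

/-- The `B`-valued moments `E[x b₁ x b₂ ⋯ b_{k-1} x]`, where `l = [b₁, …, b_{k-1}]`. -/
noncomputable def moment (P : OVProbSpace B A) (x : A) (l : List B) : B :=
  P.E (P.word x l).prod

/-- Equality of `B`-distributions, possibly of elements of different spaces over `B`. -/
def SameDistribution (P : OVProbSpace B A) (x : A) (Q : OVProbSpace B A') (y : A') : Prop :=
  ∀ l : List B, P.moment x l = Q.moment y l

/-- Convergence in distribution over `B`: norm convergence of all `B`-valued moments. -/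
def ConvergesInDistribution (P : OVProbSpace B A) (x : ℕ → A) (Q : OVProbSpace B A') (y : A') :
    Prop :=
  ∀ l : List B, Tendsto (fun N => P.moment (x N) l) atTop (𝓝 (Q.moment y l))

/-- The operator-valued monotone cumulants `h_n`, determined recursively by
`E[x₁ ⋯ x_n] = ∑_{π ∈ NC(n)} (1 / τ(π)!) h_π(x₁, …, x_n)`. The partition with a single block
contributes `h_n(x₁, …, x_n)`; the other ones only involve words shorter than `n`. -/
noncomputable def monotoneCumulant (P : OVProbSpace B A) (l : List A) : B :=
  P.E l.prod -
    ∑ π ∈ (NC l.length).filter (fun π => Finset.range l.length ∉ π.parts),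
      (1 / (treeFactorial π : ℂ)) •
        evalPartition P.ι
          (fun l' => if _h : l'.length < l.length then P.monotoneCumulant l' else 0) π l
termination_by l.length

/-- The set of all `‖h₄(Yb, Y, Yb', Y)‖` with `‖b‖ = ‖b'‖ = 1`. -/
def fourthCumulantNorms (P : OVProbSpace B A) (Y : A) : Set ℝ :=
  {r | ∃ b b' : B, ‖b‖ = 1 ∧ ‖b'‖ = 1 ∧
    r = ‖P.monotoneCumulant [Y * P.ι b, Y, Y * P.ι b', Y]‖}

/-- The (not necessarily unital) `B`-bimodule subalgebra of `A` generated by `x`: the finite sums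
of products `b₁ x b₂ x ⋯ x b_{n+1}` with `n ≥ 1`. -/
noncomputable def bimoduleAlgebra (P : OVProbSpace B A) (x : A) : NonUnitalSubalgebra ℂ A :=
  NonUnitalAlgebra.adjoin ℂ {a | ∃ b b' : B, a = P.ι b * x * P.ι b'}

/-- Monotone independence over `B` of a family of subalgebras indexed by a linear order:
`E[x₁ ⋯ x_j ⋯ x_n] = E[x₁ ⋯ x_{j-1} E[x_j] x_{j+1} ⋯ x_n]` whenever `x_m ∈ S (i_m)` for all `m` and
`i_{j-1} < i_j > i_{j+1}`, where an inequality is dropped if `j = 1` or `j = n`. The lists `l₁`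
and `l₂` hold the pairs `(i_m, x_m)` for `m < j` and for `m > j`. -/
def MonotoneIndependent (P : OVProbSpace B A) {Λ : Type*} [LinearOrder Λ]
    (S : Λ → NonUnitalSubalgebra ℂ A) : Prop :=
  ∀ (l₁ l₂ : List (Λ × A)) (i : Λ) (x : A),
    (∀ p ∈ l₁, p.2 ∈ S p.1) → (∀ p ∈ l₂, p.2 ∈ S p.1) → x ∈ S i →
    (∀ p ∈ l₁.getLast?, p.1 < i) → (∀ p ∈ l₂.head?, p.1 < i) →
    P.E ((l₁.map Prod.snd).prod * x * (l₂.map Prod.snd).prod) =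
      P.E ((l₁.map Prod.snd).prod * P.ι (P.E x) * (l₂.map Prod.snd).prod)

/-- `Y` is monotone `n`-divisible over `B`: it has the `B`-distribution of a sum `y₁ + ⋯ + y_n`
of identically distributed self-adjoint elements, monotone independent over `B`, of some
operator-valued C⋆-probability space over `B` (such as the space of `Y` itself). -/
def IsMonotoneDivisible (P : OVProbSpace B A) (Y : A) (n : ℕ) : Prop :=
  ∃ (C : Type z) (_ : CStarAlgebra C) (_ : PartialOrder C) (_ : StarOrderedRing C)
    (Q : OVProbSpace B C) (y : Fin n → C),
    (∀ i, IsSelfAdjoint (y i)) ∧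
    Q.MonotoneIndependent (fun i => Q.bimoduleAlgebra (y i)) ∧
    (∀ i j, Q.SameDistribution (y i) Q (y j)) ∧
    P.SameDistribution Y Q (∑ i, y i)

/-- `X` is a self-adjoint `B`-valued arcsine element with variance `η`:
`E[X b X] = η(b)` and `E[X b₁ X ⋯ b_{k-1} X] = ∑_{π ∈ NC₂(k)} (1 / τ(π)!) η_π(b₁, …, b_{k-1})`, with
`η_π(b₁, …, b_{k-1}) = E_π[X b₁, …, X b_{k-1}, X]`. For odd `k`, in particular for `k = 1`, the sum
is empty and the moment is `0`. -/
structure IsArcsine (P : OVProbSpace B A) (η : B → B) (X : A) : Prop where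
  isSelfAdjoint : IsSelfAdjoint X
  variance : ∀ b, P.E (X * P.ι b * X) = η b
  moment_eq : ∀ l : List B, P.moment X l =
    ∑ π ∈ NC₂ (l.length + 1),
      (1 / (treeFactorial π : ℂ)) • evalPartition P.ι (fun l' => P.E l'.prod) π (P.word X l)

/-- `b - 1_k ⊗ x` in `M_k(A)`, for `b ∈ M_k(B)`. -/
noncomputable def matrixShift (P : OVProbSpace B A) {k : ℕ} (x : A)
    (b : CStarMatrix (Fin k) (Fin k) B) : CStarMatrix (Fin k) (Fin k) A :=
  b.map P.ι - CStarMatrix.ofMatrix (Matrix.diagonal fun _ => x)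

/-- The `M_k(B)`-valued Cauchy transform `(id_k ⊗ E)[(b - 1_k ⊗ x)⁻¹]` of `1_k ⊗ x`. -/
noncomputable def cauchyTransform (P : OVProbSpace B A) {k : ℕ} (x : A)
    (b : CStarMatrix (Fin k) (Fin k) B) : CStarMatrix (Fin k) (Fin k) B :=
  (Ring.inverse (P.matrixShift x b)).map P.E

end OVProbSpace

/-- The upper half plane `ℍ⁺(D)` of a C⋆-algebra: the `b` whose imaginary part
`(b - b⋆) / 2i` is positive and invertible. -/
def upperHalfPlane (D : Type*) [CStarAlgebra D] [PartialOrder D] [StarOrderedRing D] : Set D :=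
  {b | IsStrictlyPositive (imaginaryPart b : D)}

/-! Fix b with Im b ≥ δ and write Y, in distribution, as y₁ + ⋯ + y_n. For monotone independent
elements Cauchy transforms compose: with F_y = G_y⁻¹ one has G_{x+y} = G_x ∘ F_y
(`MonotoneIndependent.cauchy_add`). Hence G_Y(b) is the inverse of the n-th iterate of one map F,
the reciprocal transform of a single summand. Since F does not lower the bound Im ≥ δ
(`imGE_recip`), all resolvents along the iteration are bounded by δ⁻¹.

A summand is centered with variance η/n, so F(w) = w - η(w⁻¹)/n + error: the iteration is an Euler
scheme for w' = -η(w⁻¹). Cauchy-Schwarz bounds the error by the square roots of a fourth and a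
second moment of the summand (`norm_recip_sub_le`). Expanding the moments of the sum
(`summand_moments`) and computing h₄ as the fourth moment minus the fourth arcsine moment
(`monotoneCumulant_four`) shows that the fourth moment of a summand is (h₄ + O(1/n))/n. So n times
the local error is at most a quantity tending to k δ⁻² √H₄ √‖η(1)‖; the factor k is the price of
passing to matrices.

The arcsine element A follows the same flow exactly. Its moments satisfy a recursion which, after
differentiation in a suitable direction, summation of the Neumann series and analytic continuation,
becomes E[R A R] = 2 E[R η(w⁻¹) R] for the resolvent R at w
(`HasArcsineMoments.resolvent_identity`). Therefore G_{√(1-t) A}(w_t) is constant along solutions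
w_t. Along the Euler points W_j the quantities G_{√(1-j/n) A}(W_j) lead from G_A(b) to W_n⁻¹ =
G_Y(b), and each step costs δ⁻² times the local error plus O(n⁻²). Telescoping
(`norm_cauchy_sub_inverse_le`) and n → ∞ give the estimate, with no exponential loss because no
errors are propagated through the scheme.

For the corollary no arcsine element is available yet, so G_Y is compared with a formal power series
solving the same differential equation, for arguments with small inverse; here a Gronwall bound is
good enough. Comparing coefficients gives convergence of the moments of all matrix amplifications,
and a superdiagonal matrix whose corner entry is a given word recovers arbitrary B-valued moments
(`tendsto_E_wordProd`). The sequence (Y_N) itself, viewed in the C⋆-algebra of bounded sequences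
with the limit of the expectations, is then an arcsine element. Weierstrass approximation passes
from moments to continuous functions under a state. -/

set_option linter.unusedSectionVars false

/-! ### Elements with strictly positive imaginary part -/

section HalfPlane

variable {M : Type*} [CStarAlgebra M] [PartialOrder M] [StarOrderedRing M]

/-- The imaginary part of `a` is bounded below by `δ`. -/
def ImGE (δ : ℝ) (a : M) : Prop := algebraMap ℝ M δ ≤ (imaginaryPart a : M)

lemma imaginaryPart_conj (c v : M) :
    (imaginaryPart (star c * v * c) : M) = star c * (imaginaryPart v : M) * c := by
  simp only [imaginaryPart_apply_coe, star_mul, star_star, mul_smul_comm, smul_mul_assoc,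
    mul_sub, sub_mul, mul_assoc]

lemma imaginaryPart_star (v : M) : (imaginaryPart (star v) : M) = -(imaginaryPart v : M) := by
  simp only [imaginaryPart_apply_coe, star_star, ← smul_neg, neg_sub]

lemma ImGE.isStrictlyPositive {δ : ℝ} (hδ : 0 < δ) {a : M} (h : ImGE δ a) :
    IsStrictlyPositive (imaginaryPart a : M) :=
  IsStrictlyPositive.of_le (isStrictlyPositive_algebraMap hδ) h

/-- Conjugation by (Im v)^(-1/2) turns the imaginary part into 1, and a self-adjoint element plus i
is invertible because its spectrum is real. -/
lemma IsStrictlyPositive.isUnit_of_imaginaryPart {v : M}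
    (hb : IsStrictlyPositive (imaginaryPart v : M)) : IsUnit v := by
  set b : M := (imaginaryPart v : M) with hb_def
  set c : M := b ^ (-(1 / 2 : ℝ)) with hc_def
  have hcu : IsUnit c := hb.isUnit.cfcRpow _ hb.nonneg
  have hcs : IsSelfAdjoint c := .of_nonneg CFC.rpow_nonneg
  have hone : c * b * c = 1 := CFC.conjugate_rpow_neg_one_half b hb
  have key : c * v * c = c * (realPart v : M) * c + algebraMap ℂ M Complex.I := by
    conv_lhs => rw [← realPart_add_I_smul_imaginaryPart v]
    rw [mul_add, add_mul, mul_smul_comm, smul_mul_assoc, ← hb_def, hone,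
      Algebra.algebraMap_eq_smul_one]
  have hs : IsSelfAdjoint (c * (realPart v : M) * c) := by
    have := (realPart v).2.conjugate c
    rwa [hcs.star_eq] at this
  have hu : IsUnit (c * v * c) := by
    rw [key]
    have hI : -Complex.I ∉ spectrum ℂ (c * (realPart v : M) * c) := fun hmem => by
      simpa using hs.im_eq_zero_of_mem_spectrum hmem
    rw [spectrum.notMem_iff] at hI
    convert hI.neg using 1
    simp
  obtain ⟨d, hd⟩ := hcu
  rwa [← hd, Units.isUnit_mul_units, Units.isUnit_units_mul] at hu

lemma ImGE.isUnit {δ : ℝ} (hδ : 0 < δ) {a : M} (h : ImGE δ a) : IsUnit a :=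
  (h.isStrictlyPositive hδ).isUnit_of_imaginaryPart

/-- The conjugate (v⁻¹)⋆ v v⁻¹ equals (v⁻¹)⋆, whose imaginary part is minus that of v⁻¹. -/
lemma imaginaryPart_inverse {v : M} (hv : IsUnit v) :
    (imaginaryPart (Ring.inverse v) : M) =
      -(star (Ring.inverse v) * (imaginaryPart v : M) * Ring.inverse v) := by
  rw [← imaginaryPart_conj, mul_assoc, Ring.mul_inverse_cancel _ hv, mul_one, imaginaryPart_star,
    neg_neg]

lemma norm_imaginaryPart_le (a : M) : ‖(imaginaryPart a : M)‖ ≤ ‖a‖ := imaginaryPart.norm_le a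

lemma algebraMap_le_conj {δ : ℝ} {b : M} (h : algebraMap ℝ M δ ≤ b) (c : M) :
    δ • (star c * c) ≤ star c * b * c := by
  have := star_left_conjugate_le_conjugate h c
  simpa [Algebra.algebraMap_eq_smul_one] using this

/-- For c = a⁻¹ one has δ c⋆c ≤ c⋆ (Im a) c = -Im c, so δ‖c‖² ≤ ‖c‖. -/
lemma ImGE.norm_inverse_le {δ : ℝ} (hδ : 0 < δ) {a : M} (h : ImGE δ a) :
    ‖Ring.inverse a‖ ≤ δ⁻¹ := by
  set c := Ring.inverse a with hc
  have h1 : δ • (star c * c) ≤ star c * (imaginaryPart a : M) * c := algebraMap_le_conj h c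
  have h2 : ‖δ • (star c * c)‖ ≤ ‖star c * (imaginaryPart a : M) * c‖ :=
    CStarAlgebra.norm_le_norm_of_nonneg_of_le (smul_nonneg hδ.le (star_mul_self_nonneg c)) h1
  have h3 : ‖star c * (imaginaryPart a : M) * c‖ ≤ ‖c‖ := by
    rw [← norm_neg, ← imaginaryPart_inverse (h.isUnit hδ)]
    exact norm_imaginaryPart_le _
  rw [norm_smul, CStarRing.norm_star_mul_self, Real.norm_of_nonneg hδ.le] at h2
  rcases (norm_nonneg c).eq_or_lt with h0 | h0
  · rw [← h0]; positivity
  · rw [← mul_le_mul_iff_right₀ hδ, mul_inv_cancel₀ hδ.ne']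
    refine le_of_mul_le_mul_right ?_ h0
    linarith

lemma ImGE.mono {δ δ' : ℝ} (hδ : δ' ≤ δ) {a : M} (h : ImGE δ a) : ImGE δ' a :=
  le_trans (algebraMap_mono M hδ) h

lemma ImGE.sub_selfAdjoint {δ : ℝ} {a x : M} (h : ImGE δ a) (hx : IsSelfAdjoint x) :
    ImGE δ (a - x) := by
  unfold ImGE
  rw [map_sub, imaginaryPart_eq_zero_iff.2 hx, sub_zero]
  exact h

lemma ImGE.add {δ δ' : ℝ} {a b : M} (h : ImGE δ a) (h' : ImGE δ' b) : ImGE (δ + δ') (a + b) := by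
  unfold ImGE at *
  rw [map_add, map_add]
  exact add_le_add h h'

lemma ImGE.smul {δ : ℝ} {a : M} (h : ImGE δ a) {t : ℝ} (ht : 0 ≤ t) : ImGE (t * δ) (t • a) := by
  unfold ImGE at *
  rw [map_smul, Algebra.algebraMap_eq_smul_one, mul_smul, ← Algebra.algebraMap_eq_smul_one]
  exact smul_le_smul_of_nonneg_left h ht

lemma imGE_algebraMap (z : ℂ) : ImGE z.im (algebraMap ℂ M z) := by
  unfold ImGE
  rw [Algebra.algebraMap_eq_smul_one, Algebra.algebraMap_eq_smul_one, imaginaryPart_smul]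
  have h : (imaginaryPart (1 : M)) = 0 := imaginaryPart_eq_zero_iff.2 (.one M)
  simp [h]

/-- A strictly positive element of a C⋆-algebra is bounded below by the inverse of the norm of its
inverse. -/
lemma IsStrictlyPositive.algebraMap_inv_le {b : M} (hb : IsStrictlyPositive b) {r : ℝ}
    (hr : 0 < r) (h : ‖Ring.inverse b‖ ≤ r) : algebraMap ℝ M r⁻¹ ≤ b := by
  obtain ⟨u, rfl⟩ := hb.isUnit
  rw [Ring.inverse_unit] at h
  have hinv : (0 : M) ≤ (↑u⁻¹ : M) := CFC.inv_nonneg_of_nonneg u hb.nonneg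
  have h1 : (↑u⁻¹ : M) ≤ algebraMap ℝ M r :=
    (IsSelfAdjoint.le_algebraMap_norm_self (.of_nonneg hinv)).trans (algebraMap_mono M h)
  let v : Mˣ := ⟨algebraMap ℝ M r, algebraMap ℝ M r⁻¹,
    by rw [← map_mul, mul_inv_cancel₀ hr.ne', map_one],
    by rw [← map_mul, inv_mul_cancel₀ hr.ne', map_one]⟩
  have hv : (0 : M) ≤ v := (isStrictlyPositive_algebraMap (A := M) hr).nonneg
  exact (CStarAlgebra.inv_le_iff (a := u) (b := v) hb.nonneg hv).1 h1

lemma imGE_map {N : Type*} [CStarAlgebra N] [PartialOrder N] [StarOrderedRing N]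
    (f : N →⋆ₐ[ℂ] M) {δ : ℝ} {d : N} (h : ImGE δ d) : ImGE δ (f d) := by
  unfold ImGE at *
  rw [← map_imaginaryPart f d]
  have := OrderHomClass.mono f h
  rwa [Algebra.algebraMap_eq_smul_one, ← Complex.coe_smul, map_smul, map_one, Complex.coe_smul,
    ← Algebra.algebraMap_eq_smul_one] at this

end HalfPlane

/-! ### Conditional expectations -/

/-- A positive conditional expectation `E` of the C⋆-algebra `M` onto a copy of `D`. -/
structure CondExp (D M : Type*) [CStarAlgebra D] [PartialOrder D] [StarOrderedRing D]
    [CStarAlgebra M] [PartialOrder M] [StarOrderedRing M] where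
  ι : D →⋆ₐ[ℂ] M
  E : M →ₚ[ℂ] D
  E_ι : ∀ d, E (ι d) = d
  E_bimodule : ∀ d₁ a d₂, E (ι d₁ * a * ι d₂) = d₁ * E a * d₂

namespace CondExp

variable {D M : Type*} [CStarAlgebra D] [PartialOrder D] [StarOrderedRing D]
    [CStarAlgebra M] [PartialOrder M] [StarOrderedRing M] (𝔼 : CondExp D M)

lemma E_left (d : D) (a : M) : 𝔼.E (𝔼.ι d * a) = d * 𝔼.E a := by
  simpa using 𝔼.E_bimodule d a 1

lemma E_right (a : M) (d : D) : 𝔼.E (a * 𝔼.ι d) = 𝔼.E a * d := by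
  simpa using 𝔼.E_bimodule 1 a d

lemma E_one : 𝔼.E 1 = 1 := by simpa using 𝔼.E_ι 1

lemma E_star (a : M) : 𝔼.E (star a) = star (𝔼.E a) := map_star 𝔼.E a

lemma imaginaryPart_E (a : M) : (imaginaryPart (𝔼.E a) : D) = 𝔼.E (imaginaryPart a : M) := by
  simp only [imaginaryPart_apply_coe, ← 𝔼.E_star, ← map_sub]
  rw [map_smul, ← Complex.coe_smul, ← Complex.coe_smul, map_smul]

lemma imGE_ι {δ : ℝ} {d : D} (h : ImGE δ d) : ImGE δ (𝔼.ι d) := imGE_map 𝔼.ι h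

lemma norm_ι_le (d : D) : ‖𝔼.ι d‖ ≤ ‖d‖ := NonUnitalStarAlgHom.norm_apply_le 𝔼.ι d

/-- The Kadison-Schwarz inequality for conditional expectations. -/
lemma conj_le_E_conj {d : D} (hd : 0 ≤ d) (a : M) :
    star (𝔼.E a) * d * 𝔼.E a ≤ 𝔼.E (star a * 𝔼.ι d * a) := by
  have hd' : 0 ≤ 𝔼.ι d := map_nonneg 𝔼.ι hd
  -- The conditional variance of a, weighted by d, is positive; expanding it gives the difference of
  -- the two sides.
  have h := map_nonneg 𝔼.E (star_left_conjugate_nonneg hd' (a - 𝔼.ι (𝔼.E a)))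
  have : 𝔼.E (star (a - 𝔼.ι (𝔼.E a)) * 𝔼.ι d * (a - 𝔼.ι (𝔼.E a))) =
      𝔼.E (star a * 𝔼.ι d * a) - star (𝔼.E a) * d * 𝔼.E a := by
    simp only [star_sub, sub_mul, mul_sub, map_sub, ← map_star, ← map_mul]
    simp only [E_right, map_mul, mul_assoc, E_left, E_ι, E_star]
    simp only [← mul_assoc, E_right, E_star]
    noncomm_ring
  rw [this] at h
  exact sub_nonneg.1 h

lemma norm_E_le (a : M) : ‖𝔼.E a‖ ≤ ‖a‖ := by
  have h1 : star (𝔼.E a) * 𝔼.E a ≤ 𝔼.E (star a * a) := by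
    simpa using 𝔼.conj_le_E_conj (d := 1) zero_le_one a
  have h2 : ‖𝔼.E (star a * a)‖ ≤ ‖𝔼.E 1‖ * ‖star a * a‖ :=
    PositiveLinearMap.norm_apply_le_of_nonneg 𝔼.E _ (star_mul_self_nonneg a)
  have h3 := CStarAlgebra.norm_le_norm_of_nonneg_of_le (star_mul_self_nonneg (𝔼.E a)) h1
  rw [CStarRing.norm_star_mul_self] at h2 h3
  rcases subsingleton_or_nontrivial D with hD | hD
  · simp [Subsingleton.elim (𝔼.E a) 0]
  · rw [E_one, norm_one, one_mul] at h2
    exact abs_le_of_sq_le_sq' (by nlinarith) (norm_nonneg a) |>.2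

/-- The conditional expectation as a continuous linear map. -/
noncomputable def toCLM : M →L[ℂ] D :=
  LinearMap.mkContinuous 𝔼.E.toLinearMap 1 fun a => by simpa using 𝔼.norm_E_le a

@[simp] lemma toCLM_apply (a : M) : 𝔼.toCLM a = 𝔼.E a := rfl

lemma continuous_ι : Continuous 𝔼.ι :=
  AddMonoidHomClass.continuous_of_bound 𝔼.ι 1 fun d => by simpa using 𝔼.norm_ι_le d

/-- The Cauchy-Schwarz inequality for the `D`-valued inner product `E (a⋆ b)`. -/
lemma norm_E_star_mul_sq_le (a b : M) :
    ‖𝔼.E (star a * b)‖ ^ 2 ≤ ‖𝔼.E (star a * a)‖ * ‖𝔼.E (star b * b)‖ := by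
  set X := 𝔼.E (star a * a)
  set Z := 𝔼.E (star a * b) with hZ
  set W := 𝔼.E (star b * b)
  have hX : 0 ≤ X := map_nonneg 𝔼.E (star_mul_self_nonneg a)
  have hZs : 𝔼.E (star b * a) = star Z := by rw [hZ, ← E_star]; simp
  -- Positivity for a (Z/t) - b gives the bound as soon as X ≤ t. Taking t strictly larger than ‖X‖
  -- avoids division by zero; t tends to ‖X‖ at the end.
  have key : ∀ t : ℝ, ‖X‖ < t → ‖Z‖ ^ 2 ≤ t * ‖W‖ := by
    intro t ht
    have ht0 : 0 < t := (norm_nonneg _).trans_lt ht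
    have h0 := map_nonneg 𝔼.E (star_mul_self_nonneg (a * 𝔼.ι ((t⁻¹ : ℂ) • Z) - b))
    have hexp : 𝔼.E (star (a * 𝔼.ι ((t⁻¹ : ℂ) • Z) - b) * (a * 𝔼.ι ((t⁻¹ : ℂ) • Z) - b)) =
        star ((t⁻¹ : ℂ) • Z) * X * ((t⁻¹ : ℂ) • Z) - star ((t⁻¹ : ℂ) • Z) * Z
          - star Z * ((t⁻¹ : ℂ) • Z) + W := by
      simp only [star_sub, star_mul, sub_mul, mul_sub, map_sub, ← map_star]
      rw [show 𝔼.ι (star ((t⁻¹ : ℂ) • Z)) * star a * (a * 𝔼.ι ((t⁻¹ : ℂ) • Z)) =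
        𝔼.ι (star ((t⁻¹ : ℂ) • Z)) * (star a * a) * 𝔼.ι ((t⁻¹ : ℂ) • Z) by simp only [mul_assoc],
        E_bimodule, mul_assoc (𝔼.ι _), E_left, ← mul_assoc (star b), E_right, hZs]
      abel
    rw [hexp] at h0
    have h1 : star ((t⁻¹ : ℂ) • Z) * X * ((t⁻¹ : ℂ) • Z) ≤ t⁻¹ • (star Z * Z) := by
      have h2 : star Z * X * Z ≤ t • (star Z * Z) := by
        have hXt : X ≤ algebraMap ℝ D t :=
          (IsSelfAdjoint.le_algebraMap_norm_self (.of_nonneg hX)).trans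
            (algebraMap_mono D ht.le)
        have := star_left_conjugate_le_conjugate hXt Z
        simpa [Algebra.algebraMap_eq_smul_one] using this
      have h3 := smul_le_smul_of_nonneg_left h2 (show 0 ≤ t⁻¹ * t⁻¹ by positivity)
      rw [smul_smul, mul_assoc t⁻¹, inv_mul_cancel₀ ht0.ne', mul_one] at h3
      refine le_trans (le_of_eq ?_) h3
      simp only [star_smul, smul_mul_assoc, mul_smul_comm, smul_smul, ← Complex.coe_smul]
      simp
    have h2 : star ((t⁻¹ : ℂ) • Z) * Z = t⁻¹ • (star Z * Z) := by
      simp only [star_smul, smul_mul_assoc, ← Complex.coe_smul]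
      simp
    have h3 : star Z * ((t⁻¹ : ℂ) • Z) = t⁻¹ • (star Z * Z) := by
      simp only [mul_smul_comm, ← Complex.coe_smul]
      simp
    rw [h2, h3] at h0
    have h4 : t⁻¹ • (star Z * Z) ≤ W := by
      have := h0.trans (add_le_add_left (sub_le_sub_right (sub_le_sub_right h1 _) _) W)
      rw [sub_self, zero_sub, ← sub_eq_neg_add] at this
      exact sub_nonneg.1 this
    have h5 := CStarAlgebra.norm_le_norm_of_nonneg_of_le
      (smul_nonneg (inv_nonneg.2 ht0.le) (star_mul_self_nonneg Z)) h4
    rw [norm_smul, CStarRing.norm_star_mul_self, Real.norm_of_nonneg (inv_nonneg.2 ht0.le),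
      inv_mul_le_iff₀ ht0] at h5
    rwa [sq]
  refine ge_of_tendsto (f := fun t : ℝ => t * ‖W‖) (x := 𝓝[>] ‖X‖) ?_
    (eventually_nhdsWithin_of_forall fun t ht => key t ht)
  exact ((continuous_id.mul continuous_const).tendsto' _ _ rfl).mono_left nhdsWithin_le_nhds

lemma norm_E_mul_le (a b : M) :
    ‖𝔼.E (a * b)‖ ≤ √‖𝔼.E (a * star a)‖ * √‖𝔼.E (star b * b)‖ := by
  have := 𝔼.norm_E_star_mul_sq_le (star a) b
  rw [star_star] at this
  rw [← Real.sqrt_mul (norm_nonneg _)]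
  exact Real.le_sqrt_of_sq_le this

/-- `‖E (y⋆ z y)‖ ≤ ‖z‖ ‖E (y⋆ y)‖`. -/
lemma norm_E_conj_le (y z : M) :
    ‖𝔼.E (star y * z * y)‖ ≤ ‖z‖ * ‖𝔼.E (star y * y)‖ := by
  -- Cauchy-Schwarz for y and z y covers arbitrary z, not only positive ones; (z y)⋆(z y) ≤ ‖z‖² y⋆y
  -- handles the second factor.
  have h1 := 𝔼.norm_E_star_mul_sq_le y (z * y)
  have h2 : ‖𝔼.E (star (z * y) * (z * y))‖ ≤ ‖z‖ ^ 2 * ‖𝔼.E (star y * y)‖ := by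
    have h3 : star (z * y) * (z * y) ≤ ‖z‖ ^ 2 • (star y * y) := by
      have := star_left_conjugate_le_conjugate
        (CStarAlgebra.star_mul_le_algebraMap_norm_sq (a := z)) y
      simpa [Algebra.algebraMap_eq_smul_one, mul_assoc] using this
    have h4 : 𝔼.E (star (z * y) * (z * y)) ≤ ‖z‖ ^ 2 • 𝔼.E (star y * y) := by
      have := OrderHomClass.mono 𝔼.E h3
      rwa [← Complex.coe_smul, map_smul, Complex.coe_smul] at this
    have := CStarAlgebra.norm_le_norm_of_nonneg_of_le
      (map_nonneg 𝔼.E (star_mul_self_nonneg _)) h4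
    rwa [norm_smul, Real.norm_of_nonneg (by positivity)] at this
  rw [mul_assoc]
  refine le_of_sq_le_sq (h1.trans ?_) (by positivity)
  calc _ ≤ ‖𝔼.E (star y * y)‖ * (‖z‖ ^ 2 * ‖𝔼.E (star y * y)‖) := by gcongr
    _ = _ := by ring

/-! ### Cauchy transforms -/

/-- The resolvent `(w - x)⁻¹`. -/
noncomputable def resolvent (x : M) (w : D) : M := Ring.inverse (𝔼.ι w - x)

/-- The Cauchy transform `E[(w - x)⁻¹]`. -/
noncomputable def cauchy (x : M) (w : D) : D := 𝔼.E (𝔼.resolvent x w)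

/-- The reciprocal Cauchy transform `E[(w - x)⁻¹]⁻¹`. -/
noncomputable def recip (x : M) (w : D) : D := Ring.inverse (𝔼.cauchy x w)

variable {𝔼} {δ : ℝ} {x : M} {w : D}

lemma imGE_shift (hw : ImGE δ w) (hx : IsSelfAdjoint x) : ImGE δ (𝔼.ι w - x) :=
  (𝔼.imGE_ι hw).sub_selfAdjoint hx

lemma isUnit_shift (hδ : 0 < δ) (hw : ImGE δ w) (hx : IsSelfAdjoint x) : IsUnit (𝔼.ι w - x) :=
  (imGE_shift hw hx).isUnit hδ

lemma norm_resolvent_le (hδ : 0 < δ) (hw : ImGE δ w) (hx : IsSelfAdjoint x) :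
    ‖𝔼.resolvent x w‖ ≤ δ⁻¹ :=
  (imGE_shift hw hx).norm_inverse_le hδ

lemma resolvent_mul (hδ : 0 < δ) (hw : ImGE δ w) (hx : IsSelfAdjoint x) :
    𝔼.resolvent x w * (𝔼.ι w - x) = 1 :=
  Ring.inverse_mul_cancel _ (isUnit_shift hδ hw hx)

lemma mul_resolvent (hδ : 0 < δ) (hw : ImGE δ w) (hx : IsSelfAdjoint x) :
    (𝔼.ι w - x) * 𝔼.resolvent x w = 1 :=
  Ring.mul_inverse_cancel _ (isUnit_shift hδ hw hx)

/-- `-Im G ≥ G⋆ (Im w) G` and `-Im G` is strictly positive. -/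
lemma imaginaryPart_cauchy (hδ : 0 < δ) (hw : ImGE δ w) (hx : IsSelfAdjoint x) :
    star (𝔼.cauchy x w) * (imaginaryPart w : D) * 𝔼.cauchy x w ≤
        (imaginaryPart (-𝔼.cauchy x w) : D) ∧
      IsStrictlyPositive (imaginaryPart (-𝔼.cauchy x w) : D) := by
  have hu := isUnit_shift (𝔼 := 𝔼) hδ hw hx
  set ρ := 𝔼.resolvent x w with hρ
  have hIm : (imaginaryPart (-𝔼.cauchy x w) : D) =
      𝔼.E (star ρ * 𝔼.ι (imaginaryPart w : D) * ρ) := by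
    rw [map_neg, AddSubgroup.coe_neg, cauchy, imaginaryPart_E, ← hρ, hρ, resolvent,
      imaginaryPart_inverse hu, map_neg, neg_neg, map_sub, imaginaryPart_eq_zero_iff.2 hx, sub_zero,
      map_imaginaryPart 𝔼.ι w]
  have hpos : 0 ≤ (imaginaryPart w : D) := (hw.isStrictlyPositive hδ).nonneg
  refine ⟨?_, ?_⟩
  · rw [hIm]
    exact 𝔼.conj_le_E_conj hpos ρ
  · have hρu : IsUnit ρ := isUnit_ringInverse.2 hu
    -- The resolvent is invertible, so ρ⋆ρ is bounded below by a positive scalar; the added 1 keeps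
    -- this scalar positive even in the zero algebra.
    have hr : 0 < (‖Ring.inverse (star ρ * ρ)‖ + 1)⁻¹ := by positivity
    have hr' := ((hρu.star.mul hρu).isStrictlyPositive
      (star_mul_self_nonneg ρ)).algebraMap_inv_le (inv_pos.1 hr) (le_add_of_nonneg_right zero_le_one)
    set r := (‖Ring.inverse (star ρ * ρ)‖ + 1)⁻¹
    have h1 : algebraMap ℝ M (δ * r) ≤ star ρ * 𝔼.ι (imaginaryPart w : D) * ρ := by
      have h2 := algebraMap_le_conj (𝔼.imGE_ι hw) ρ
      rw [← map_imaginaryPart 𝔼.ι w] at h2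
      refine le_trans ?_ h2
      rw [Algebra.algebraMap_eq_smul_one, mul_smul, ← Algebra.algebraMap_eq_smul_one]
      exact smul_le_smul_of_nonneg_left hr' hδ.le
    have h3 := OrderHomClass.mono 𝔼.E h1
    rw [Algebra.algebraMap_eq_smul_one, ← Complex.coe_smul, map_smul, E_one, Complex.coe_smul,
      ← Algebra.algebraMap_eq_smul_one] at h3
    rw [hIm]
    exact IsStrictlyPositive.of_le (isStrictlyPositive_algebraMap (mul_pos hδ hr)) h3

lemma isUnit_cauchy (hδ : 0 < δ) (hw : ImGE δ w) (hx : IsSelfAdjoint x) :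
    IsUnit (𝔼.cauchy x w) := by
  simpa using (imaginaryPart_cauchy hδ hw hx).2.isUnit_of_imaginaryPart.neg

/-- Conjugating -Im G ≥ G⋆ (Im w) G by G⁻¹ gives Im F ≥ Im w. This keeps every iterate of F in the
same half plane, with the same δ. -/
lemma imGE_recip (hδ : 0 < δ) (hw : ImGE δ w) (hx : IsSelfAdjoint x) :
    ImGE δ (𝔼.recip x w) := by
  have hu := isUnit_cauchy (𝔼 := 𝔼) hδ hw hx
  have h := (imaginaryPart_cauchy (𝔼 := 𝔼) hδ hw hx).1
  unfold ImGE recip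
  rw [imaginaryPart_inverse hu]
  refine hw.trans ?_
  have h2 := star_left_conjugate_le_conjugate h (Ring.inverse (𝔼.cauchy x w))
  rw [map_neg, AddSubgroup.coe_neg, mul_neg, neg_mul] at h2
  refine le_trans (le_of_eq ?_) h2
  have h3 := Ring.mul_inverse_cancel _ hu
  have h4 : star (Ring.inverse (𝔼.cauchy x w)) * star (𝔼.cauchy x w) = 1 := by
    rw [← star_mul, h3, star_one]
  calc (imaginaryPart w : D) = (star (Ring.inverse (𝔼.cauchy x w)) * star (𝔼.cauchy x w)) *
        (imaginaryPart w : D) * (𝔼.cauchy x w * Ring.inverse (𝔼.cauchy x w)) := by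
          rw [h3, h4]; simp
    _ = _ := by simp only [mul_assoc]

end CondExp

/-! ### Sums over paths -/

/-- The sum of `g [β i c₁, β c₁ c₂, …, β c_n j]` over all `c₁, …, c_n`. -/
def pathSum {κ B V : Type*} [Fintype κ] [AddCommMonoid V] (β : κ → κ → B) :
    ℕ → (List B → V) → κ → κ → V
  | 0, g, i, j => g [β i j]
  | n + 1, g, i, j => ∑ c, pathSum β n (fun l => g (β i c :: l)) c j

section pathSum

variable {κ B V W : Type*} [Fintype κ] [AddCommMonoid V] [AddCommMonoid W] (β : κ → κ → B)

lemma pathSum_congr {n : ℕ} {g g' : List B → V} (h : ∀ l, l.length = n + 1 → g l = g' l)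
    (i j : κ) : pathSum β n g i j = pathSum β n g' i j := by
  induction n generalizing g g' i with
  | zero => exact h _ rfl
  | succ n ih =>
    refine Finset.sum_congr rfl fun c _ => ih (fun l hl => h _ (by simp [hl])) c

lemma map_pathSum (f : V →+ W) (n : ℕ) (g : List B → V) (i j : κ) :
    f (pathSum β n g i j) = pathSum β n (fun l => f (g l)) i j := by
  induction n generalizing g i with
  | zero => rfl
  | succ n ih => simp only [pathSum, map_sum, ih]

lemma pathSum_sum {σ : Type*} (s : Finset σ) (n : ℕ) (g : σ → List B → V) (i j : κ) :
    pathSum β n (fun l => ∑ a ∈ s, g a l) i j = ∑ a ∈ s, pathSum β n (g a) i j := by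
  induction n generalizing g i with
  | zero => rfl
  | succ n ih =>
    simp only [pathSum, ih]
    rw [Finset.sum_comm]

lemma pathSum_zero (n : ℕ) (i j : κ) : pathSum β n (fun _ => (0 : V)) i j = 0 := by
  induction n generalizing i with
  | zero => rfl
  | succ n ih => simp [pathSum, ih]

/-- A path is cut at the vertex reached after d + 1 steps; this is how products of word functions
become matrix products. -/
lemma pathSum_split {R : Type*} [NonUnitalSemiring R] (d n : ℕ) (g g' : List B → R) (i j : κ) :
    pathSum β (d + 1 + n) (fun l => g (l.take (d + 1)) * g' (l.drop (d + 1))) i j =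
      ∑ c, pathSum β d g i c * pathSum β n g' c j := by
  induction d generalizing g i with
  | zero =>
    rw [show 0 + 1 + n = n + 1 by ring, pathSum]
    refine Finset.sum_congr rfl fun c _ => ?_
    simp only [zero_add, List.take_succ_cons, List.take_zero, List.drop_succ_cons, List.drop_zero]
    exact (map_pathSum β (AddMonoidHom.mulLeft (g [β i c])) n g' c j).symm
  | succ d ih =>
    rw [show d + 1 + 1 + n = d + 1 + n + 1 by ring, pathSum]
    simp only [List.take_succ_cons, List.drop_succ_cons]
    simp only [pathSum, Finset.sum_mul]
    rw [Finset.sum_comm]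
    exact Finset.sum_congr rfl fun c _ => ih (fun l => g (β i c :: l)) c

/-- If `β` is supported on the diagonal and the first superdiagonal and `g` vanishes on words with
a zero letter, then only one path reaches the corner. -/
lemma pathSum_corner {B : Type*} [Zero B] {m : ℕ} (β : Fin m → Fin m → B) (c : ℕ → B)
    (hβ : ∀ i j : Fin m, (j : ℕ) = i + 1 → β i j = c i)
    (hβ' : ∀ i j : Fin m, (i : ℕ) + 1 < j → β i j = 0)
    (n : ℕ) (g : List B → V) (hg : ∀ l, 0 ∈ l → g l = 0) (i j : Fin m) :
    ((i : ℕ) + n + 1 < j → pathSum β n g i j = 0) ∧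
    ((i : ℕ) + n + 1 = j → pathSum β n g i j = g ((List.range' i (n + 1)).map c)) := by
  induction n generalizing g i with
  | zero =>
    refine ⟨fun h => ?_, fun h => ?_⟩
    · rw [pathSum, hβ' i j (by simpa using h)]
      exact hg _ (by simp)
    · rw [pathSum, hβ i j (by simpa using h.symm)]
      simp
  | succ n ih =>
    have hg' : ∀ b, ∀ l, 0 ∈ l → g (b :: l) = 0 := fun b l hl => hg _ (by simp [hl])
    -- A first step to a vertex below i + 1 leaves too few steps to reach j, while a step beyond i +
    -- 1 uses a zero letter.
    have key : ∀ e : Fin m, (e : ℕ) ≠ i + 1 → (i : ℕ) + (n + 1) + 1 ≤ j →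
        pathSum β n (fun l => g (β i e :: l)) e j = 0 := by
      intro e he hj
      rcases lt_or_gt_of_ne he with h | h
      · exact (ih _ (hg' _) e).1 (by omega)
      · rw [← pathSum_zero (V := V) β n e j]
        refine pathSum_congr β (fun l _ => hg _ ?_) e j
        rw [hβ' i e h]
        simp
    refine ⟨fun h => ?_, fun h => ?_⟩
    · rw [pathSum]
      refine Finset.sum_eq_zero fun e _ => ?_
      by_cases he : (e : ℕ) = i + 1
      · exact (ih _ (hg' _) e).1 (by omega)
      · exact key e he (by omega)
    · rw [pathSum, Finset.sum_eq_single (⟨i + 1, by omega⟩ : Fin m)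
        (fun e _ he => key e (fun h' => he (Fin.ext h')) (by omega)) (by simp),
        (ih _ (hg' _) _).2 (by simp only; omega), hβ i _ rfl]
      simp [List.range'_succ]

end pathSum

/-! ### Matrices over a C⋆-algebra -/

lemma exists_eq_star_mul_self {M : Type*} [CStarAlgebra M] [PartialOrder M] [StarOrderedRing M]
    {a : M} (ha : 0 ≤ a) : ∃ z, a = star z * z :=
  CStarAlgebra.nonneg_iff_eq_star_mul_self.1 ha

namespace CStarMatrix

variable {A B : Type*} [CStarAlgebra A] [CStarAlgebra B] {k : ℕ}

/-- The entrywise application of a unital ⋆-homomorphism. -/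
def mapHom (k : ℕ) (f : B →⋆ₐ[ℂ] A) :
    CStarMatrix (Fin k) (Fin k) B →⋆ₐ[ℂ] CStarMatrix (Fin k) (Fin k) A where
  toFun M := M.map f
  map_one' := by
    ext i j
    simp only [map_apply, one_apply]
    split_ifs <;> simp
  map_zero' := by ext; simp
  map_add' _ _ := by ext; simp
  map_mul' M N := by
    ext
    simp only [map_apply, mul_apply, map_sum, map_mul]
  commutes' r := by
    ext i j
    change f (algebraMap ℂ (CStarMatrix (Fin k) (Fin k) B) r i j) = _
    rw [algebraMap_apply, algebraMap_apply]
    split_ifs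
    · exact AlgHomClass.commutes f r
    · exact map_zero f
  map_star' M := by ext; simp [star_apply, map_star]

/-- The `(i, j)` entry as a linear map. -/
def entry (A : Type*) [CStarAlgebra A] {k : ℕ} (i j : Fin k) :
    CStarMatrix (Fin k) (Fin k) A →ₗ[ℂ] A where
  toFun M := M i j
  map_add' _ _ := rfl
  map_smul' _ _ := rfl

lemma sum_apply {σ : Type*} (s : Finset σ) (f : σ → CStarMatrix (Fin k) (Fin k) A) (i j : Fin k) :
    (∑ a ∈ s, f a) i j = ∑ a ∈ s, f a i j :=
  map_sum (entry A i j) f s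

/-- The scalar matrices `1_k ⊗ x`. -/
def diagHom (A : Type*) [CStarAlgebra A] (k : ℕ) : A →⋆ₐ[ℂ] CStarMatrix (Fin k) (Fin k) A where
  toFun x := ofMatrix (Matrix.diagonal fun _ => x)
  map_one' := by
    ext i j
    exact Matrix.one_apply.symm
  map_zero' := by ext; simp
  map_add' _ _ := by
    ext i j
    simp only [ofMatrix_apply, Matrix.diagonal_apply, add_apply]
    split_ifs <;> simp
  map_mul' M N := by
    ext i j
    simp [mul_apply, Matrix.diagonal_apply]
  commutes' r := by
    ext i j
    simp [algebraMap_apply, Matrix.diagonal_apply]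
  map_star' M := by
    ext i j
    simp only [ofMatrix_apply, Matrix.diagonal_apply, star_apply]
    by_cases h : i = j
    · simp [h]
    · simp [h, Ne.symm h]

@[simp] lemma mapHom_apply (f : B →⋆ₐ[ℂ] A) (M : CStarMatrix (Fin k) (Fin k) B) (i j : Fin k) :
    mapHom k f M i j = f (M i j) := rfl

lemma diagHom_apply (x : A) (i j : Fin k) : diagHom A k x i j = if i = j then x else 0 := rfl

lemma mapHom_diagHom (f : B →⋆ₐ[ℂ] A) (x : B) :
    mapHom k f (diagHom B k x) = diagHom A k (f x) := by
  ext i j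
  rw [mapHom_apply, diagHom_apply, diagHom_apply]
  split_ifs
  · rfl
  · exact map_zero f

variable [PartialOrder A] [StarOrderedRing A]

lemma norm_diagHom_le (x : A) : ‖diagHom A k x‖ ≤ ‖x‖ :=
  NonUnitalStarAlgHom.norm_apply_le (diagHom A k) x

lemma diagHom_mul_apply (x : A) (M : CStarMatrix (Fin k) (Fin k) A) (i j : Fin k) :
    (diagHom A k x * M) i j = x * M i j := by
  simp [mul_apply, diagHom_apply]

lemma mul_diagHom_apply (x : A) (M : CStarMatrix (Fin k) (Fin k) A) (i j : Fin k) :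
    (M * diagHom A k x) i j = M i j * x := by
  simp [mul_apply, diagHom_apply]

/-- The norm of a positive matrix is at most the sum of the norms of its diagonal entries. -/
lemma norm_le_sum_diag {T : CStarMatrix (Fin k) (Fin k) A} (hT : 0 ≤ T) :
    ‖T‖ ≤ ∑ i, ‖T i i‖ := by
  obtain ⟨Z, rfl⟩ := exists_eq_star_mul_self hT
  let e : Fin k → CStarMatrix (Fin k) (Fin k) A := fun i =>
    ofMatrix (Matrix.diagonal fun j => if j = i then 1 else 0)
  have he_apply : ∀ i a b, e i a b = if a = b then (if a = i then 1 else 0) else 0 := by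
    intro i a b
    simp [e, Matrix.diagonal_apply]
  have he_mul : ∀ i (N : CStarMatrix (Fin k) (Fin k) A) a b,
      (e i * N) a b = if a = i then N a b else 0 := by
    intro i N a b
    simp [mul_apply, he_apply]
  have hmul_e : ∀ i (N : CStarMatrix (Fin k) (Fin k) A) a b,
      (N * e i) a b = if b = i then N a b else 0 := by
    intro i N a b
    simp [mul_apply, he_apply]
  have he : ∀ i, star (e i) = e i := by
    intro i
    ext a b
    rw [star_apply, he_apply, he_apply]
    by_cases h : a = b
    · subst h
      by_cases h' : a = i <;> simp [h']
    · simp [h, Ne.symm h]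
  have he_idem : ∀ i, e i * e i = e i := by
    intro i
    ext a b
    rw [he_mul, he_apply]
    by_cases h : a = i <;> simp [h]
  have hsum : ∑ i, e i * e i = 1 := by
    ext a b
    simp only [he_idem]
    rw [sum_apply, one_apply]
    simp [he_apply]
  -- For T = Z⋆Z the norm is that of ZZ⋆, which splits over the diagonal projections e_i. Each
  -- summand has the norm of (Z e_i)⋆(Z e_i), whose only nonzero entry is T i i.
  have h1 : Z * star Z = ∑ i, (Z * e i) * star (Z * e i) := by
    simp only [star_mul, he]
    rw [show Z * star Z = Z * 1 * star Z by rw [mul_one], ← hsum, Finset.mul_sum, Finset.sum_mul]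
    simp only [mul_assoc]
  rw [CStarRing.norm_star_mul_self, ← CStarRing.norm_self_mul_star, h1]
  refine (norm_sum_le _ _).trans (Finset.sum_le_sum fun i _ => ?_)
  rw [CStarRing.norm_self_mul_star, ← CStarRing.norm_star_mul_self]
  have h2 : star (Z * e i) * (Z * e i) = e i * diagHom A k ((star Z * Z) i i) := by
    ext a b
    rw [star_mul, he, ← mul_assoc, mul_assoc (e i), hmul_e, he_mul, he_mul, diagHom_apply]
    by_cases ha : a = i
    · by_cases hb : b = i
      · simp [ha, hb]
      · simp [ha, hb, Ne.symm hb]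
    · simp [ha]
  rw [h2]
  refine (norm_mul_le _ _).trans ?_
  have h3 : ‖e i‖ ≤ 1 := by
    have h4 := CStarRing.norm_star_mul_self (x := e i)
    rw [he, he_idem] at h4
    by_contra h5
    nlinarith [norm_nonneg (e i)]
  calc ‖e i‖ * ‖diagHom A k ((star Z * Z) i i)‖ ≤ 1 * ‖(star Z * Z) i i‖ := by
        gcongr
        exact norm_diagHom_le _
    _ = _ := one_mul _

end CStarMatrix

/-! ### Amplifications -/

namespace OVProbSpace

open CStarMatrix

variable {B : Type u} [CStarAlgebra B] [PartialOrder B] [StarOrderedRing B]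
  {A : Type v} [CStarAlgebra A] [PartialOrder A] [StarOrderedRing A] (P : OVProbSpace B A)

/-- The conditional expectation `id_k ⊗ E` from `M_k(A)` onto `M_k(B)`. -/
noncomputable def amp (k : ℕ) :
    CondExp (CStarMatrix (Fin k) (Fin k) B) (CStarMatrix (Fin k) (Fin k) A) where
  ι := mapHom k P.ι
  E := PositiveLinearMap.mk₀ (CStarMatrix.mapₗ (P.E : A →ₗ[ℂ] B))
    fun M hM => CompletelyPositiveMapClass.map_cstarMatrix_nonneg' P.E k M hM
  E_ι d := by
    ext i j
    exact P.E_ι _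
  E_bimodule d₁ a d₂ := by
    ext i j
    change P.E _ = _
    simp only [mul_apply, mapHom_apply, Finset.sum_mul, map_sum, P.E_bimodule]
    rfl

variable {P} {k : ℕ}

@[simp] lemma amp_ι_apply (M : CStarMatrix (Fin k) (Fin k) B) (i j : Fin k) :
    (P.amp k).ι M i j = P.ι (M i j) := rfl

@[simp] lemma amp_E_apply (M : CStarMatrix (Fin k) (Fin k) A) (i j : Fin k) :
    (P.amp k).E M i j = P.E (M i j) := rfl

lemma matrixShift_eq (x : A) (b : CStarMatrix (Fin k) (Fin k) B) :
    P.matrixShift x b = (P.amp k).ι b - diagHom A k x := rfl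

/-- The product `b₀ x b₁ x ⋯ x b_n` for the list `[b₀, …, b_n]`. -/
noncomputable def wordProd (P : OVProbSpace B A) (x : A) : List B → A
  -- A default value: the words that matter have at least one letter.
  | [] => 0
  | b :: l => P.ι b * (l.map fun c => x * P.ι c).prod

lemma wordProd_cons_of_length {n : ℕ} (x : A) (b : B) {l : List B} (hl : l.length = n + 1) :
    P.wordProd x (b :: l) = P.ι b * x * P.wordProd x l := by
  cases l with
  | nil => simp at hl
  | cons c l => simp [wordProd, mul_assoc]

lemma wordProd_eq_zero (x : A) {l : List B} (hl : 0 ∈ l) : P.wordProd x l = 0 := by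
  cases l with
  | nil => rfl
  | cons c l =>
    rw [wordProd]
    rcases List.mem_cons.1 hl with h | h
    · rw [← h]; simp
    · rw [List.prod_eq_zero (List.mem_map.2 ⟨0, h, by simp⟩), mul_zero]

lemma E_wordProd (x : A) (b c : B) (l : List B) :
    P.E (P.wordProd x (b :: (l ++ [c]))) = b * P.moment x l * c := by
  simp only [wordProd, List.map_append, List.map_cons, List.map_nil, List.prod_append,
    List.prod_cons, List.prod_nil, mul_one, moment, word]
  rw [← P.E_bimodule]
  simp only [mul_assoc]

/-- Since 1 ⊗ x is diagonal, an entry of the product runs over paths through the entries of β. The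
moments of one amplified element thus encode B-valued moments with varying letters. -/
lemma amp_pow_apply (x : A) (β : CStarMatrix (Fin k) (Fin k) B) (n : ℕ) (i j : Fin k) :
    (((P.amp k).ι β * diagHom A k x) ^ n * (P.amp k).ι β) i j = pathSum β n (P.wordProd x) i j := by
  induction n generalizing i with
  | zero => simp [pathSum, wordProd]
  | succ n ih =>
    rw [pow_succ', mul_assoc, mul_apply]
    refine Finset.sum_congr rfl fun c _ => ?_
    rw [mul_diagHom_apply, ih, amp_ι_apply]
    refine (map_pathSum β (AddMonoidHom.mulLeft (P.ι (β i c) * x)) n _ c j).trans ?_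
    exact pathSum_congr β (fun l hl => (wordProd_cons_of_length x _ hl).symm) c j

lemma amp_E_pow_apply (x : A) (β : CStarMatrix (Fin k) (Fin k) B) (n : ℕ) (i j : Fin k) :
    (P.amp k).E (((P.amp k).ι β * diagHom A k x) ^ n * (P.amp k).ι β) i j =
      pathSum β n (fun l => P.E (P.wordProd x l)) i j := by
  rw [amp_E_apply, amp_pow_apply]
  exact map_pathSum β (P.E.toLinearMap.toAddMonoidHom) n _ i j

end OVProbSpace

set_option linter.style.haveILetI false

/-! ### The C⋆-algebra generated by `B` and some self-adjoint elements -/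

lemma Ring.inverse_eq_of_mul_eq_one {R : Type*} [Ring R] {a b : R} (h : a * b = 1)
    (h' : b * a = 1) : Ring.inverse a = b :=
  Ring.inverse_unit (⟨a, b, h, h'⟩ : Rˣ)

lemma Ring.map_inverse_of_isUnit {R S F : Type*} [Ring R] [Ring S] [FunLike F R S]
    [RingHomClass F R S] (f : F) {a : R} (ha : IsUnit a) :
    Ring.inverse (f a) = f (Ring.inverse a) :=
  Ring.inverse_eq_of_mul_eq_one
    (by rw [← map_mul, Ring.mul_inverse_cancel _ ha, map_one])
    (by rw [← map_mul, Ring.inverse_mul_cancel _ ha, map_one])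

/-- Spectral permanence. It keeps resolvents, even those without a convergent Neumann series, inside
the closed span of words. -/
lemma StarSubalgebra.inverse_mem {A : Type*} [CStarAlgebra A] (S : StarSubalgebra ℂ A)
    (hS : IsClosed (S : Set A)) {a : A} (ha : a ∈ S) (hu : IsUnit a) : Ring.inverse a ∈ S := by
  haveI := hS
  have h : IsUnit (⟨a, ha⟩ : S) := S.coe_isUnit.1 hu
  have := Ring.map_inverse_of_isUnit S.subtype h
  change Ring.inverse a = _ at this
  rw [this]
  exact (Ring.inverse (⟨a, ha⟩ : S)).2

section WordAlgebra

variable {B A Λ : Type*} [CStarAlgebra B] [CStarAlgebra A]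

/-- The word `b₀ y_{i₁} b₁ ⋯ y_{i_m} b_m` for `[(i₁, b₁), …, (i_m, b_m)]`. -/
noncomputable def indexedWord (ι : B →⋆ₐ[ℂ] A) (y : Λ → A) (b : B) (l : List (Λ × B)) : A :=
  ι b * (l.map fun p => y p.1 * ι p.2).prod

/-- The C⋆-algebra generated by `ι(B)` and the elements `y i`. -/
noncomputable def wordAlg (ι : B →⋆ₐ[ℂ] A) (y : Λ → A) : StarSubalgebra ℂ A :=
  (StarAlgebra.adjoin ℂ (Set.range ι ∪ Set.range y)).topologicalClosure

variable (ι : B →⋆ₐ[ℂ] A) (y : Λ → A)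

lemma isClosed_wordAlg : IsClosed (wordAlg ι y : Set A) :=
  StarSubalgebra.isClosed_topologicalClosure _

lemma ι_mem_wordAlg (b : B) : ι b ∈ wordAlg ι y :=
  StarSubalgebra.le_topologicalClosure _ (StarAlgebra.subset_adjoin ℂ _ (.inl ⟨b, rfl⟩))

lemma mem_wordAlg (i : Λ) : y i ∈ wordAlg ι y :=
  StarSubalgebra.le_topologicalClosure _ (StarAlgebra.subset_adjoin ℂ _ (.inr ⟨i, rfl⟩))

/-- The generating set is stable under the involution, so the generated algebra is spanned by
monomials; adjacent coefficients merge, and inserting 1 brings each monomial into word form. -/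
lemma wordAlg_subset_closure_span (hy : ∀ i, IsSelfAdjoint (y i)) :
    (wordAlg ι y : Set A) ⊆
      closure (Submodule.span ℂ {a | ∃ b l, a = indexedWord ι y b l} : Set A) := by
  rw [wordAlg, StarSubalgebra.topologicalClosure_coe]
  refine closure_mono fun a ha => ?_
  have hstar : star (Set.range ι ∪ Set.range y) = Set.range ι ∪ Set.range y := by
    rw [Set.union_star]
    congr 1
    · ext a
      constructor
      · rintro ⟨b, hb⟩
        exact ⟨star b, by rw [map_star, hb, star_star]⟩
      · rintro ⟨b, rfl⟩
        exact ⟨star b, by rw [map_star]⟩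
    · ext a
      constructor
      · rintro ⟨b, hb⟩
        exact ⟨b, by rw [← (hy b).star_eq, hb, star_star]⟩
      · rintro ⟨b, rfl⟩
        exact ⟨b, by rw [(hy b).star_eq]⟩
  have ha' : a ∈ Algebra.adjoin ℂ (Set.range ι ∪ Set.range y) := by
    have h := StarAlgebra.adjoin_toSubalgebra ℂ (Set.range ι ∪ Set.range y)
    rw [hstar, Set.union_self] at h
    rw [← h]
    exact ha
  rw [← Subalgebra.mem_toSubmodule, Algebra.adjoin_eq_span] at ha'
  refine Submodule.span_mono (fun m hm => ?_) ha'
  induction hm using Submonoid.closure_induction_left with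
  | one => exact ⟨1, [], by simp [indexedWord]⟩
  | mul_left x hx z hz ih =>
    obtain ⟨b, l, rfl⟩ := ih
    rcases hx with ⟨c, rfl⟩ | ⟨i, rfl⟩
    · exact ⟨c * b, l, by simp [indexedWord, mul_assoc]⟩
    · exact ⟨1, (i, b) :: l, by simp [indexedWord, mul_assoc]⟩

end WordAlgebra

/-! ### Matrices with entries in a subalgebra -/

namespace CStarMatrix

variable {A : Type*} [CStarAlgebra A] [PartialOrder A] [StarOrderedRing A] {k : ℕ}

/-- The matrices with entries in `K`. -/
def entriesIn (K : StarSubalgebra ℂ A) (k : ℕ) :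
    StarSubalgebra ℂ (CStarMatrix (Fin k) (Fin k) A) where
  carrier := {M | ∀ i j, M i j ∈ K}
  mul_mem' := by
    intro M N hM hN i j
    rw [mul_apply]
    exact sum_mem fun c _ => mul_mem (hM i c) (hN c j)
  add_mem' hM hN i j := add_mem (hM i j) (hN i j)
  algebraMap_mem' r i j := by
    rw [algebraMap_apply]
    split_ifs
    · exact K.algebraMap_mem r
    · exact zero_mem K
  star_mem' := by
    intro M hM i j
    rw [star_apply]
    exact star_mem (hM j i)

lemma mem_entriesIn {K : StarSubalgebra ℂ A} {M : CStarMatrix (Fin k) (Fin k) A} :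
    M ∈ entriesIn K k ↔ ∀ i j, M i j ∈ K := Iff.rfl

lemma continuous_entry (i j : Fin k) :
    Continuous fun M : CStarMatrix (Fin k) (Fin k) A => M i j :=
  (continuous_apply j).comp (continuous_apply i)

lemma isClosed_entriesIn {K : StarSubalgebra ℂ A} (hK : IsClosed (K : Set A)) :
    IsClosed (entriesIn K k : Set (CStarMatrix (Fin k) (Fin k) A)) := by
  have : (entriesIn K k : Set (CStarMatrix (Fin k) (Fin k) A)) =
      ⋂ i, ⋂ j, (fun M : CStarMatrix (Fin k) (Fin k) A => M i j) ⁻¹' K := by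
    ext M
    simp [mem_entriesIn]
  rw [this]
  exact isClosed_iInter fun i => isClosed_iInter fun j => hK.preimage (continuous_entry i j)

lemma inverse_mem_entriesIn {K : StarSubalgebra ℂ A} (hK : IsClosed (K : Set A))
    {M : CStarMatrix (Fin k) (Fin k) A} (hM : M ∈ entriesIn K k) (hu : IsUnit M) :
    Ring.inverse M ∈ entriesIn K k :=
  (entriesIn K k).inverse_mem (isClosed_entriesIn hK) hM hu

end CStarMatrix

namespace OVProbSpace

open CStarMatrix

variable {B : Type u} [CStarAlgebra B] [PartialOrder B] [StarOrderedRing B]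
  {A : Type v} [CStarAlgebra A] [PartialOrder A] [StarOrderedRing A] (P : OVProbSpace B A)
  {A' : Type w} [CStarAlgebra A'] [PartialOrder A'] [StarOrderedRing A'] (Q : OVProbSpace B A')

lemma continuous_E : Continuous P.E := by
  obtain ⟨C, hC⟩ := PositiveLinearMap.exists_norm_apply_le
    (PositiveLinearMap.mk₀ (P.E : A →ₗ[ℂ] B) fun _ h => map_nonneg P.E h)
  exact AddMonoidHomClass.continuous_of_bound P.E C hC

lemma E_left (b : B) (a : A) : P.E (P.ι b * a) = b * P.E a := by
  simpa using P.E_bimodule b a 1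

lemma E_right (a : A) (b : B) : P.E (a * P.ι b) = P.E a * b := by
  simpa using P.E_bimodule 1 a b

lemma isSelfAdjoint_diagHom {x : A} (hx : IsSelfAdjoint x) (k : ℕ) :
    IsSelfAdjoint (diagHom A k x) := hx.map (diagHom A k)

/-! ### Elements with the same distribution -/

variable {P Q}

/-- The outer coefficients leave the expectation by the bimodule property; what remains is a moment.
-/
lemma E_indexedWord_eq {x : A} {y : A'} (h : P.SameDistribution x Q y) (b : B)
    (l : List (Unit × B)) :
    P.E (indexedWord P.ι (fun _ => x) b l) = Q.E (indexedWord Q.ι (fun _ => y) b l) := by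
  rcases l.eq_nil_or_concat with rfl | ⟨l, p, rfl⟩
  · simp [indexedWord, P.E_ι, Q.E_ι]
  · have h1 := P.E_wordProd x b p.2 (l.map Prod.snd)
    have h2 := Q.E_wordProd y b p.2 (l.map Prod.snd)
    rw [h, ← h2] at h1
    simpa [wordProd, indexedWord, Function.comp_def] using h1

/-- The distribution over `B` determines the Cauchy transforms of all amplifications. -/
lemma SameDistribution.cauchy_eq {x : A} {y : A'} (h : P.SameDistribution x Q y)
    (hx : IsSelfAdjoint x) (hy : IsSelfAdjoint y) {k : ℕ} {δ : ℝ} (hδ : 0 < δ)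
    {w : CStarMatrix (Fin k) (Fin k) B} (hw : ImGE δ w) :
    (P.amp k).cauchy (diagHom A k x) w = (Q.amp k).cauchy (diagHom A' k y) w := by
  -- Both elements are treated at once as (x, y) in A × A'. On the C⋆-algebra generated by B and
  -- this pair the two expectations agree, and the entries of its resolvent lie there, so no power
  -- series expansion is needed.
  let j : B →⋆ₐ[ℂ] A × A' := P.ι.prod Q.ι
  let K := wordAlg j (fun _ : Unit => (x, y))
  have hxy : IsSelfAdjoint (x, y) := Prod.ext hx hy
  have hK : ∀ a ∈ K, P.E a.1 = Q.E a.2 := by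
    have hcl : IsClosed {a : A × A' | P.E a.1 = Q.E a.2} :=
      isClosed_eq (P.continuous_E.comp continuous_fst) (Q.continuous_E.comp continuous_snd)
    intro a ha
    refine closure_minimal ?_ hcl (wordAlg_subset_closure_span j _ (fun _ => hxy) ha)
    intro a ha
    induction ha using Submodule.span_induction with
    | mem a ha =>
      obtain ⟨b, l, rfl⟩ := ha
      have h1 : StarAlgHom.fst ℂ A A' (indexedWord j (fun _ => (x, y)) b l) =
          indexedWord P.ι (fun _ => x) b l := by
        simp only [indexedWord, map_mul, map_list_prod, List.map_map, Function.comp_def]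
        rfl
      have h2 : StarAlgHom.snd ℂ A A' (indexedWord j (fun _ => (x, y)) b l) =
          indexedWord Q.ι (fun _ => y) b l := by
        simp only [indexedWord, map_mul, map_list_prod, List.map_map, Function.comp_def]
        rfl
      exact (congrArg P.E h1).trans ((E_indexedWord_eq h b l).trans (congrArg Q.E h2).symm)
    | zero => simp
    | add a b _ _ ha hb => simpa using congrArg₂ (· + ·) ha hb
    | smul c a _ ha => simpa using congrArg (c • ·) ha
  let T := mapHom k j w - diagHom (A × A') k (x, y)
  have hT : IsUnit T := ((imGE_map (mapHom k j) hw).sub_selfAdjoint (hxy.map _)).isUnit hδ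
  have hTK : T ∈ entriesIn K k := by
    refine sub_mem (fun a b => ι_mem_wordAlg j _ _) fun a b => ?_
    rw [diagHom_apply]
    split_ifs
    · exact mem_wordAlg j _ ()
    · exact zero_mem _
  have hinv := inverse_mem_entriesIn (isClosed_wordAlg _ _) hTK hT
  have h1 : Ring.inverse ((P.amp k).ι w - diagHom A k x) =
      mapHom k (StarAlgHom.fst ℂ A A') (Ring.inverse T) := by
    rw [← Ring.map_inverse_of_isUnit _ hT]
    congr 1
    rw [map_sub, mapHom_diagHom]
    rfl
  have h2 : Ring.inverse ((Q.amp k).ι w - diagHom A' k y) =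
      mapHom k (StarAlgHom.snd ℂ A A') (Ring.inverse T) := by
    rw [← Ring.map_inverse_of_isUnit _ hT]
    congr 1
    rw [map_sub, mapHom_diagHom]
    rfl
  ext a b
  rw [CondExp.cauchy, CondExp.cauchy, CondExp.resolvent, CondExp.resolvent, h1, h2]
  exact hK _ (hinv a b)

/-! ### Monotone independence -/

variable {Λ : Type*} [LinearOrder Λ] {y : Λ → A}

/-- The closed span of the products of letters from the algebras of the `y j`, the last of which
belongs to an index below `i`. -/
noncomputable def lowerLeft (P : OVProbSpace B A) (y : Λ → A) (i : Λ) : Submodule ℂ A :=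
  (Submodule.span ℂ {a | ∃ l : List (Λ × A), (∀ p ∈ l, p.2 ∈ P.bimoduleAlgebra (y p.1)) ∧
    (∀ p ∈ l.getLast?, p.1 < i) ∧ a = (l.map Prod.snd).prod}).topologicalClosure

/-- The closed span of the products of letters from the algebras of the `y j`, the first of which
belongs to an index below `i`. -/
noncomputable def lowerRight (P : OVProbSpace B A) (y : Λ → A) (i : Λ) : Submodule ℂ A :=
  (Submodule.span ℂ {a | ∃ l : List (Λ × A), (∀ p ∈ l, p.2 ∈ P.bimoduleAlgebra (y p.1)) ∧
    (∀ p ∈ l.head?, p.1 < i) ∧ a = (l.map Prod.snd).prod}).topologicalClosure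

lemma mem_bimoduleAlgebra (x : A) (b c : B) : P.ι b * x * P.ι c ∈ P.bimoduleAlgebra x :=
  NonUnitalAlgebra.subset_adjoin ℂ ⟨b, c, rfl⟩

lemma indexedWord_mem_bimoduleAlgebra (x : A) (b : B) (p : Unit × B) (l : List (Unit × B)) :
    indexedWord P.ι (fun _ => x) b (p :: l) ∈ P.bimoduleAlgebra x := by
  induction l generalizing b p with
  | nil => simpa [indexedWord, mul_assoc] using mem_bimoduleAlgebra (P := P) x b p.2
  | cons q l ih =>
    have : indexedWord P.ι (fun _ => x) b (p :: q :: l) =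
        (P.ι b * x * P.ι 1) * indexedWord P.ι (fun _ => x) p.2 (q :: l) := by
      simp [indexedWord, mul_assoc]
    rw [this]
    exact mul_mem (mem_bimoduleAlgebra x b 1) (ih _ _)

lemma one_mem_lowerLeft (i : Λ) : 1 ∈ P.lowerLeft y i :=
  Submodule.le_topologicalClosure _ (Submodule.subset_span ⟨[], by simp⟩)

lemma one_mem_lowerRight (i : Λ) : 1 ∈ P.lowerRight y i :=
  Submodule.le_topologicalClosure _ (Submodule.subset_span ⟨[], by simp⟩)

/-- On words each coefficient is absorbed into an adjacent letter, and the last letter has index j;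
closedness extends this to the whole C⋆-algebra. -/
lemma mul_mem_lowerLeft (hy : ∀ i, IsSelfAdjoint (y i)) {i j : Λ} (hij : j < i) {p : A}
    (hp : p ∈ wordAlg P.ι y) : p * y j ∈ P.lowerLeft y i := by
  have hcl : IsClosed {p : A | p * y j ∈ P.lowerLeft y i} :=
    (Submodule.isClosed_topologicalClosure _).preimage (continuous_mul_const (y j))
  refine closure_minimal ?_ hcl (wordAlg_subset_closure_span P.ι y hy hp)
  intro a ha
  induction ha using Submodule.span_induction with
  | mem a ha =>
    obtain ⟨b, l, rfl⟩ := ha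
    refine Submodule.le_topologicalClosure _ (Submodule.subset_span ?_)
    -- Nonemptiness is carried along so that prepending a letter does not change the last one.
    suffices h : ∃ m : List (Λ × A), m ≠ [] ∧ (∀ p ∈ m, p.2 ∈ P.bimoduleAlgebra (y p.1)) ∧
        (∀ p ∈ m.getLast?, p.1 < i) ∧ indexedWord P.ι y b l * y j = (m.map Prod.snd).prod from
      h.imp fun _ hm => hm.2
    induction l generalizing b with
    | nil =>
      refine ⟨[(j, P.ι b * y j * P.ι 1)], by simp, ?_, ?_, ?_⟩
      · simpa using mem_bimoduleAlgebra (P := P) (y j) b 1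
      · simpa using hij
      · simp [indexedWord]
    | cons q l ih =>
      obtain ⟨m, h0, h1, h2, h3⟩ := ih q.2
      refine ⟨(q.1, P.ι b * y q.1 * P.ι 1) :: m, by simp, ?_, ?_, ?_⟩
      · simpa using ⟨by simpa using mem_bimoduleAlgebra (P := P) (y q.1) b 1, by simpa using h1⟩
      · intro p hp
        cases m with
        | nil => exact absurd rfl h0
        | cons c m => exact h2 p (by simpa [List.getLast?_cons_cons] using hp)
      · simp only [List.map_cons, List.prod_cons, ← h3]
        simp [indexedWord, mul_assoc]
  | zero => simp
  | add a b _ _ ha hb => simpa [add_mul] using add_mem ha hb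
  | smul c a _ ha => simpa using Submodule.smul_mem _ c ha

lemma mul_mem_lowerRight (hy : ∀ i, IsSelfAdjoint (y i)) {i j : Λ} (hij : j < i) {p : A}
    (hp : p ∈ wordAlg P.ι y) : y j * p ∈ P.lowerRight y i := by
  have hcl : IsClosed {p : A | y j * p ∈ P.lowerRight y i} :=
    (Submodule.isClosed_topologicalClosure _).preimage (continuous_const_mul (y j))
  refine closure_minimal ?_ hcl (wordAlg_subset_closure_span P.ι y hy hp)
  intro a ha
  induction ha using Submodule.span_induction with
  | mem a ha =>
    obtain ⟨b, l, rfl⟩ := ha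
    refine Submodule.le_topologicalClosure _ (Submodule.subset_span
      ⟨(j, P.ι 1 * y j * P.ι b) :: l.map fun p => (p.1, P.ι 1 * y p.1 * P.ι p.2), ?_, ?_, ?_⟩)
    · intro p hp
      rcases List.mem_cons.1 hp with rfl | hp
      · exact mem_bimoduleAlgebra _ _ _
      · obtain ⟨q, -, rfl⟩ := List.mem_map.1 hp
        exact mem_bimoduleAlgebra _ _ _
    · simpa using hij
    · simp [indexedWord, mul_assoc, Function.comp_def]
  | zero => simp
  | add a b _ _ ha hb => simpa [mul_add] using add_mem ha hb
  | smul c a _ ha => simpa using Submodule.smul_mem _ c ha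

/-- In a monotone independent family, an element of the algebra of `y i` between factors of lower
index can be replaced by its conditional expectation. -/
lemma MonotoneIndependent.E_mul_mul
    (hMI : P.MonotoneIndependent fun i => P.bimoduleAlgebra (y i))
    (hy : ∀ i, IsSelfAdjoint (y i)) {i : Λ} {a x b : A} (ha : a ∈ P.lowerLeft y i)
    (hx : x ∈ wordAlg P.ι (fun _ : Unit => y i)) (hb : b ∈ P.lowerRight y i) :
    P.E (a * x * b) = P.E (a * P.ι (P.E x) * b) := by
  have hE := P.continuous_E
  have hι : Continuous P.ι := AddMonoidHomClass.continuous_of_bound P.ι 1 fun d => by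
    simpa using NonUnitalStarAlgHom.norm_apply_le P.ι d
  revert a
  change ∀ a ∈ (P.lowerLeft y i : Set A), _
  intro a ha
  rw [lowerLeft, Submodule.topologicalClosure_coe] at ha
  rw [lowerRight, ← SetLike.mem_coe, Submodule.topologicalClosure_coe] at hb
  refine closure_minimal
    (t := {a | P.E (a * x * b) = P.E (a * P.ι (P.E x) * b)}) ?_
    (isClosed_eq (by fun_prop) (by fun_prop)) ha
  clear! a
  intro a ha
  induction ha using Submodule.span_induction with
  | zero => simp
  | add a b _ _ ha hb => simpa [add_mul] using congrArg₂ (· + ·) ha hb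
  | smul c a _ ha => simpa using congrArg (c • ·) ha
  | mem a ha =>
    obtain ⟨l₁, h₁, h₁', rfl⟩ := ha
    refine closure_minimal
      (t := {b | P.E ((l₁.map Prod.snd).prod * x * b) =
        P.E ((l₁.map Prod.snd).prod * P.ι (P.E x) * b)}) ?_
      (isClosed_eq (by fun_prop) (by fun_prop)) hb
    clear! b
    intro b hb
    induction hb using Submodule.span_induction with
    | zero => simp
    | add a b _ _ ha hb => simpa [mul_add] using congrArg₂ (· + ·) ha hb
    | smul c a _ ha => simpa using congrArg (c • ·) ha
    | mem b hb =>
      obtain ⟨l₂, h₂, h₂', rfl⟩ := hb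
      refine closure_minimal
        (t := {x | P.E ((l₁.map Prod.snd).prod * x * (l₂.map Prod.snd).prod) =
          P.E ((l₁.map Prod.snd).prod * P.ι (P.E x) * (l₂.map Prod.snd).prod)}) ?_
        (isClosed_eq (by fun_prop) (by fun_prop))
        (wordAlg_subset_closure_span P.ι _ (fun _ => hy i) hx)
      clear! x
      intro x hx
      induction hx using Submodule.span_induction with
      | zero => simp
      | add a b _ _ ha hb => simpa [mul_add, add_mul] using congrArg₂ (· + ·) ha hb
      | smul c a _ ha => simpa using congrArg (c • ·) ha
      | mem x hx =>
        obtain ⟨d, l, rfl⟩ := hx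
        cases l with
        -- Coefficients from B need not lie in the non-unital algebra of y i, but for them the
        -- replacement by the expectation is trivial.
        | nil => simp [indexedWord, P.E_ι]
        | cons p l =>
          exact hMI l₁ l₂ i _ h₁ h₂ (indexedWord_mem_bimoduleAlgebra _ _ _ _) h₁' h₂'

/-- For monotone independent elements, `G_{x + y}(w) = G_x(F_y(w))`. -/
lemma MonotoneIndependent.cauchy_add
    (hMI : P.MonotoneIndependent fun i => P.bimoduleAlgebra (y i))
    (hy : ∀ i, IsSelfAdjoint (y i)) {i : Λ} {s : Finset Λ} (hs : ∀ j ∈ s, j < i) {k : ℕ} {δ : ℝ}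
    (hδ : 0 < δ) {w : CStarMatrix (Fin k) (Fin k) B} (hw : ImGE δ w) :
    (P.amp k).cauchy (diagHom A k (∑ j ∈ s, y j + y i)) w =
      (P.amp k).cauchy (diagHom A k (∑ j ∈ s, y j)) ((P.amp k).recip (diagHom A k (y i)) w) := by
  set x := ∑ j ∈ s, y j with hx
  have hxs : IsSelfAdjoint x := by
    rw [IsSelfAdjoint, hx, star_sum]
    exact Finset.sum_congr rfl fun j _ => hy j
  have hX := isSelfAdjoint_diagHom hxs k
  have hY := isSelfAdjoint_diagHom (hy i) k
  have hXY := isSelfAdjoint_diagHom (hxs.add (hy i)) k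
  set X := diagHom A k x
  set Y := diagHom A k (y i)
  set F := (P.amp k).recip Y w with hF
  set g := (P.amp k).cauchy Y w with hg
  have hgF : g * F = 1 := Ring.mul_inverse_cancel _ (CondExp.isUnit_cauchy hδ hw hY)
  have hFge : ImGE δ F := CondExp.imGE_recip hδ hw hY
  set R := (P.amp k).resolvent (diagHom A k (x + y i)) w with hR
  set r := (P.amp k).resolvent X F with hr
  set ρ := (P.amp k).resolvent Y w with hρ
  have hXYs : diagHom A k (x + y i) = X + Y := map_add _ _ _
  have e1 : R * ((P.amp k).ι w - (X + Y)) = 1 := by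
    rw [hR, hXYs]; exact CondExp.resolvent_mul hδ hw (hX.add hY)
  have e2 : ((P.amp k).ι F - X) * r = 1 := CondExp.mul_resolvent hδ hFge hX
  have e3 : ((P.amp k).ι w - Y) * ρ = 1 := CondExp.mul_resolvent hδ hw hY
  have e4 : (P.amp k).ι g * (P.amp k).ι F = 1 := by rw [← map_mul, hgF, map_one]
  -- The middle factor belongs to the top index i and has expectation zero. The outer factors are 1
  -- or end, respectively begin, with a lower index, so monotone independence annihilates the
  -- product.
  have key : R - r = (1 + R * X) * (ρ - (P.amp k).ι g) * (1 + X * r) := by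
    have e5 : 1 + X * r = (P.amp k).ι F * r := by rw [← e2]; noncomm_ring
    have e6 : 1 + R * X = R * ((P.amp k).ι w - Y) := by rw [← e1]; noncomm_ring
    rw [e5, e6]
    calc R - r = R * (((P.amp k).ι F - X) * r) - R * ((P.amp k).ι w - (X + Y)) * r := by
          rw [e1, e2, mul_one, one_mul]
      _ = R * (P.amp k).ι F * r - R * ((P.amp k).ι w - Y) * 1 * r := by noncomm_ring
      _ = R * (((P.amp k).ι w - Y) * ρ) * (P.amp k).ι F * r
          - R * ((P.amp k).ι w - Y) * ((P.amp k).ι g * (P.amp k).ι F) * r := by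
          rw [e3, e4]; noncomm_ring
      _ = _ := by noncomm_ring
  have hcl : IsClosed (wordAlg P.ι y : Set A) := isClosed_wordAlg _ _
  have hxmem : x ∈ wordAlg P.ι y := sum_mem fun j _ => mem_wordAlg _ _ _
  have hdiag : ∀ {K : StarSubalgebra ℂ A} {a : A}, a ∈ K → diagHom A k a ∈ entriesIn K k := by
    intro K a ha c d
    rw [diagHom_apply]
    split_ifs
    exacts [ha, zero_mem _]
  have hRmem : R ∈ entriesIn (wordAlg P.ι y) k := by
    refine inverse_mem_entriesIn hcl (sub_mem (fun a b => ι_mem_wordAlg _ _ _)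
      (hdiag (add_mem hxmem (mem_wordAlg _ _ _)))) (CondExp.isUnit_shift hδ hw hXY)
  have hrmem : r ∈ entriesIn (wordAlg P.ι y) k :=
    inverse_mem_entriesIn hcl (sub_mem (fun a b => ι_mem_wordAlg _ _ _) (hdiag hxmem))
      (CondExp.isUnit_shift hδ hFge hX)
  have hρmem : ρ ∈ entriesIn (wordAlg P.ι fun _ : Unit => y i) k :=
    inverse_mem_entriesIn (isClosed_wordAlg _ _) (sub_mem (fun a b => ι_mem_wordAlg _ _ _)
      (hdiag (mem_wordAlg P.ι (fun _ : Unit => y i) ()))) (CondExp.isUnit_shift hδ hw hY)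
  have hL : ∀ a b, (1 + R * X) a b ∈ P.lowerLeft y i := by
    intro a b
    rw [CStarMatrix.add_apply, mul_diagHom_apply, one_apply, hx, Finset.mul_sum]
    refine add_mem ?_ (sum_mem fun j hj => mul_mem_lowerLeft hy (hs j hj) (hRmem a b))
    split_ifs
    exacts [one_mem_lowerLeft i, zero_mem _]
  have hRt : ∀ a b, (1 + X * r) a b ∈ P.lowerRight y i := by
    intro a b
    rw [CStarMatrix.add_apply, diagHom_mul_apply, one_apply, hx, Finset.sum_mul]
    refine add_mem ?_ (sum_mem fun j hj => mul_mem_lowerRight hy (hs j hj) (hrmem a b))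
    split_ifs
    exacts [one_mem_lowerRight i, zero_mem _]
  have hzero : (P.amp k).E (R - r) = 0 := by
    rw [key]
    ext a b
    rw [amp_E_apply, mul_apply, map_sum]
    refine Finset.sum_eq_zero fun c _ => ?_
    rw [mul_apply, Finset.sum_mul, map_sum]
    refine Finset.sum_eq_zero fun d _ => ?_
    have hd : (ρ - (P.amp k).ι g) d c ∈ wordAlg P.ι fun _ : Unit => y i :=
      sub_mem (hρmem d c) (ι_mem_wordAlg _ _ _)
    rw [hMI.E_mul_mul hy (hL a d) hd (hRt c b)]
    have : P.E ((ρ - (P.amp k).ι g) d c) = 0 := by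
      rw [CStarMatrix.sub_apply, map_sub, amp_ι_apply, P.E_ι]
      exact sub_self _
    rw [this]
    simp
  rw [map_sub, sub_eq_zero] at hzero
  exact hzero

end OVProbSpace

namespace OVProbSpace

variable {B : Type u} [CStarAlgebra B] [PartialOrder B] [StarOrderedRing B]
  {A : Type v} [CStarAlgebra A] [PartialOrder A] [StarOrderedRing A] {P : OVProbSpace B A}
  {C : Type z} [CStarAlgebra C] [PartialOrder C] [StarOrderedRing C] {Q : OVProbSpace B C}

/-! ### Low moments of sums of monotone independent elements -/

section Steps

variable {Λ : Type*} [LinearOrder Λ] {y : Λ → A}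

lemma sum_mem_lowerLeft (hy : ∀ i, IsSelfAdjoint (y i)) {i : Λ} {s : Finset Λ}
    (hs : ∀ j ∈ s, j < i) {p : A} (hp : p ∈ wordAlg P.ι y) :
    p * ∑ j ∈ s, y j ∈ P.lowerLeft y i := by
  rw [Finset.mul_sum]
  exact sum_mem fun j hj => mul_mem_lowerLeft hy (hs j hj) hp

lemma sum_mem_lowerRight (hy : ∀ i, IsSelfAdjoint (y i)) {i : Λ} {s : Finset Λ}
    (hs : ∀ j ∈ s, j < i) {p : A} (hp : p ∈ wordAlg P.ι y) :
    (∑ j ∈ s, y j) * p ∈ P.lowerRight y i := by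
  rw [Finset.sum_mul]
  exact sum_mem fun j hj => mul_mem_lowerRight hy (hs j hj) hp

/-- In both cross terms the centered element of top index can be replaced by its expectation, which
is zero. -/
lemma MonotoneIndependent.second_moment_add
    (hMI : P.MonotoneIndependent fun i => P.bimoduleAlgebra (y i))
    (hy : ∀ i, IsSelfAdjoint (y i)) {i : Λ} {s : Finset Λ} (hs : ∀ j ∈ s, j < i)
    (hi : P.E (y i) = 0) (b : B) :
    P.E ((∑ j ∈ s, y j + y i) * P.ι b * (∑ j ∈ s, y j + y i)) =
      P.E ((∑ j ∈ s, y j) * P.ι b * ∑ j ∈ s, y j) + P.E (y i * P.ι b * y i) := by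
  set x := ∑ j ∈ s, y j with hx
  have hL : x ∈ P.lowerLeft y i := by
    simpa using sum_mem_lowerLeft (P := P) hy hs (one_mem (wordAlg P.ι y))
  have hR : x ∈ P.lowerRight y i := by
    simpa using sum_mem_lowerRight (P := P) hy hs (one_mem (wordAlg P.ι y))
  have hyW := mem_wordAlg P.ι (fun _ : Unit => y i) ()
  have hbW := ι_mem_wordAlg P.ι (fun _ : Unit => y i) b
  have h1 : P.E (x * P.ι b * y i) = 0 := by
    have := hMI.E_mul_mul hy hL (mul_mem hbW hyW) (one_mem_lowerRight i)
    rw [E_left, hi] at this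
    simpa [mul_assoc] using this
  have h2 : P.E (y i * P.ι b * x) = 0 := by
    have := hMI.E_mul_mul hy (one_mem_lowerLeft i) (mul_mem hyW hbW) hR
    rw [E_right, hi] at this
    simpa [mul_assoc] using this
  have : (x + y i) * P.ι b * (x + y i) = x * P.ι b * x + x * P.ι b * y i + y i * P.ι b * x
      + y i * P.ι b * y i := by noncomm_ring
  rw [this, map_add, map_add, map_add, h1, h2, add_zero, add_zero]

/-- Of the sixteen products in x = ∑ y_j and t = y i, an isolated t gives zero because t is
centered, and xttt, tttx vanish because x is. What survives is xxxx, xxtt, ttxx, xttx and tttt. The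
product txxt is missing: its outer factors t are separate peaks, so only lower indices may enclose
higher ones. -/
lemma MonotoneIndependent.fourth_moment_add
    (hMI : P.MonotoneIndependent fun i => P.bimoduleAlgebra (y i))
    (hy : ∀ i, IsSelfAdjoint (y i)) {i : Λ} {s : Finset Λ} (hs : ∀ j ∈ s, j < i)
    (hi : P.E (y i) = 0) (hs0 : P.E (∑ j ∈ s, y j) = 0) {S : A} (hS : S = ∑ j ∈ s, y j + y i)
    (b b' : B) :
    P.E (S * P.ι b * S * S * P.ι b' * S) =
      P.E ((∑ j ∈ s, y j) * P.ι b * (∑ j ∈ s, y j) * (∑ j ∈ s, y j) * P.ι b' * ∑ j ∈ s, y j) +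
      P.E ((∑ j ∈ s, y j) * P.ι b * (∑ j ∈ s, y j)) * P.E (y i * P.ι b' * y i) +
      P.E (y i * P.ι b * y i) * P.E ((∑ j ∈ s, y j) * P.ι b' * (∑ j ∈ s, y j)) +
      P.E ((∑ j ∈ s, y j) * P.ι (b * P.E (y i * y i) * b') * ∑ j ∈ s, y j) +
      P.E (y i * P.ι b * y i * y i * P.ι b' * y i) := by
  subst hS
  set x := ∑ j ∈ s, y j with hx
  set t := y i
  have hL : ∀ p ∈ wordAlg P.ι y, p * x ∈ P.lowerLeft y i := fun p hp =>
    sum_mem_lowerLeft hy hs hp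
  have hR : ∀ p ∈ wordAlg P.ι y, x * p ∈ P.lowerRight y i := fun p hp =>
    sum_mem_lowerRight hy hs hp
  have hxK : x ∈ wordAlg P.ι y := sum_mem fun j _ => mem_wordAlg _ _ _
  have htK : t ∈ wordAlg P.ι y := mem_wordAlg _ _ _
  have hbK : ∀ b, P.ι b ∈ wordAlg P.ι y := ι_mem_wordAlg P.ι y
  have hyW : t ∈ wordAlg P.ι (fun _ : Unit => y i) := mem_wordAlg P.ι (fun _ : Unit => y i) ()
  have hbW : ∀ b, P.ι b ∈ wordAlg P.ι (fun _ : Unit => y i) := ι_mem_wordAlg P.ι _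
  have hL1 := one_mem_lowerLeft (P := P) (y := y) i
  have hR1 := one_mem_lowerRight (P := P) (y := y) i
  have hLx : x ∈ P.lowerLeft y i := by simpa using hL 1 (one_mem _)
  have hRx : x ∈ P.lowerRight y i := by simpa using hR 1 (one_mem _)
  have zL : ∀ c, ∀ p ∈ P.lowerLeft y i, ∀ q ∈ P.lowerRight y i,
      P.E (p * (P.ι c * t) * q) = 0 := by
    intro c p hp q hq
    rw [hMI.E_mul_mul hy hp (mul_mem (hbW c) hyW) hq, E_left, hi]
    simp
  have zR : ∀ c, ∀ p ∈ P.lowerLeft y i, ∀ q ∈ P.lowerRight y i,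
      P.E (p * (t * P.ι c) * q) = 0 := by
    intro c p hp q hq
    rw [hMI.E_mul_mul hy hp (mul_mem hyW (hbW c)) hq, E_right, hi]
    simp
  have e2 : P.E (x * P.ι b * x * x * P.ι b' * t) = 0 := by
    have := zL b' _ (hL _ (mul_mem (mul_mem hxK (hbK b)) hxK)) 1 hR1
    simpa only [mul_assoc, mul_one] using this
  have e3 : P.E (x * P.ι b * x * t * P.ι b' * x) = 0 := by
    have := zR b' _ (hL _ (mul_mem hxK (hbK b))) x hRx
    simpa only [mul_assoc, mul_one] using this
  have e4 : P.E (x * P.ι b * x * t * P.ι b' * t) = P.E (x * P.ι b * x) * P.E (t * P.ι b' * t) := by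
    have := hMI.E_mul_mul hy (hL _ (mul_mem hxK (hbK b))) (mul_mem (mul_mem hyW (hbW b')) hyW) hR1
    rw [mul_one, mul_one, E_right] at this
    simpa only [mul_assoc, mul_one] using this
  have e5 : P.E (x * P.ι b * t * x * P.ι b' * x) = 0 := by
    have := zL b _ hLx _ (hR _ (mul_mem (hbK b') hxK))
    simpa only [mul_assoc, mul_one] using this
  have e6 : P.E (x * P.ι b * t * x * P.ι b' * t) = 0 := by
    have := zL b _ hLx _ (hR _ (mul_mem (hbK b') htK))
    simpa only [mul_assoc, mul_one] using this
  have e7 : P.E (x * P.ι b * t * t * P.ι b' * x) = P.E (x * P.ι (b * P.E (t * t) * b') * x) := by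
    have := hMI.E_mul_mul hy hLx
      (mul_mem (mul_mem (hbW b) (mul_mem hyW hyW)) (hbW b')) hRx
    rw [P.E_bimodule] at this
    simpa only [mul_assoc, mul_one] using this
  have e8 : P.E (x * P.ι b * t * t * P.ι b' * t) = 0 := by
    have := hMI.E_mul_mul hy hLx
      (mul_mem (mul_mem (mul_mem (mul_mem (hbW b) hyW) hyW) (hbW b')) hyW) hR1
    rw [mul_one, mul_one, E_right, hs0, zero_mul] at this
    simpa only [mul_assoc, mul_one] using this
  have e9 : P.E (t * P.ι b * x * x * P.ι b' * x) = 0 := by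
    have := zR b _ hL1 _ (hR _ (mul_mem (mul_mem hxK (hbK b')) hxK))
    simpa only [mul_assoc, one_mul] using this
  have e10 : P.E (t * P.ι b * x * x * P.ι b' * t) = 0 := by
    have := zR b _ hL1 _ (hR _ (mul_mem (mul_mem hxK (hbK b')) htK))
    simpa only [mul_assoc, one_mul] using this
  have e11 : P.E (t * P.ι b * x * t * P.ι b' * x) = 0 := by
    have := zR b _ hL1 _ (hR _ (mul_mem (mul_mem htK (hbK b')) hxK))
    simpa only [mul_assoc, one_mul] using this
  have e12 : P.E (t * P.ι b * x * t * P.ι b' * t) = 0 := by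
    have := zR b _ hL1 _ (hR _ (mul_mem (mul_mem htK (hbK b')) htK))
    simpa only [mul_assoc, one_mul] using this
  have e13 : P.E (t * P.ι b * t * x * P.ι b' * x) = P.E (t * P.ι b * t) * P.E (x * P.ι b' * x) := by
    have := hMI.E_mul_mul hy hL1 (mul_mem (mul_mem hyW (hbW b)) hyW) (hR _ (mul_mem (hbK b') hxK))
    rw [one_mul, one_mul, E_left] at this
    simpa only [mul_assoc, one_mul] using this
  have e14 : P.E (t * P.ι b * t * x * P.ι b' * t) = 0 := by
    have := zL b' _ (hL _ (mul_mem (mul_mem htK (hbK b)) htK)) 1 hR1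
    simpa only [mul_assoc, mul_one] using this
  have e15 : P.E (t * P.ι b * t * t * P.ι b' * x) = 0 := by
    have := hMI.E_mul_mul hy hL1
      (mul_mem (mul_mem (mul_mem (mul_mem hyW (hbW b)) hyW) hyW) (hbW b')) hRx
    rw [one_mul, one_mul, E_left, hs0, mul_zero] at this
    simpa only [mul_assoc, mul_one] using this
  have : (x + t) * P.ι b * (x + t) * (x + t) * P.ι b' * (x + t) =
      x * P.ι b * x * x * P.ι b' * x + x * P.ι b * x * x * P.ι b' * t
      + x * P.ι b * x * t * P.ι b' * x + x * P.ι b * x * t * P.ι b' * t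
      + x * P.ι b * t * x * P.ι b' * x + x * P.ι b * t * x * P.ι b' * t
      + x * P.ι b * t * t * P.ι b' * x + x * P.ι b * t * t * P.ι b' * t
      + t * P.ι b * x * x * P.ι b' * x + t * P.ι b * x * x * P.ι b' * t
      + t * P.ι b * x * t * P.ι b' * x + t * P.ι b * x * t * P.ι b' * t
      + t * P.ι b * t * x * P.ι b' * x + t * P.ι b * t * x * P.ι b' * t
      + t * P.ι b * t * t * P.ι b' * x + t * P.ι b * t * t * P.ι b' * t := by
    simp only [add_mul, mul_add]
    abel
  rw [this]
  simp only [map_add]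
  rw [e2, e3, e4, e5, e6, e7, e8, e9, e10, e11, e12, e13, e14, e15]
  abel

end Steps

/-! ### Summands of divisible elements -/

/-- The partial sum `y₀ + ⋯ + y_{s-1}`. -/
def partialSum {M : Type*} [AddCommMonoid M] {n : ℕ} (y : Fin n → M) (s : ℕ) : M :=
  ∑ j ∈ Finset.univ.filter (fun j : Fin n => (j : ℕ) < s), y j

lemma partialSum_zero {M : Type*} [AddCommMonoid M] {n : ℕ} (y : Fin n → M) :
    partialSum y 0 = 0 := by
  simp [partialSum]

lemma partialSum_self {M : Type*} [AddCommMonoid M] {n : ℕ} (y : Fin n → M) :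
    partialSum y n = ∑ i, y i := by
  simp [partialSum]

lemma partialSum_succ {M : Type*} [AddCommMonoid M] {n : ℕ} (y : Fin n → M) {s : ℕ} (hs : s < n) :
    partialSum y (s + 1) = partialSum y s + y ⟨s, hs⟩ := by
  rw [partialSum, partialSum, add_comm _ (y _), ← Finset.sum_insert (by simp)]
  congr 1
  ext j
  simp [Fin.ext_iff]
  omega

lemma moment_singleton (x : A) (b : B) : P.moment x [b] = P.E (x * P.ι b * x) := by
  simp [moment, word]

lemma moment_four (x : A) (b b' : B) :
    P.moment x [b, 1, b'] = P.E (x * P.ι b * x * x * P.ι b' * x) := by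
  simp [moment, word, mul_assoc]

section Divisible

variable {n : ℕ} {y : Fin n → C} {Y : A} {η : B → B}

/-- The mean, the variance and the fourth moments of the summands of a divisible element. -/
lemma summand_moments (hn : 0 < n) (hy : ∀ i, IsSelfAdjoint (y i))
    (hMI : Q.MonotoneIndependent fun i => Q.bimoduleAlgebra (y i))
    (hid : ∀ i j, Q.SameDistribution (y i) Q (y j))
    (hsum : P.SameDistribution Y Q (∑ i, y i)) (hmean : P.E Y = 0)
    (hvar : ∀ b, P.E (Y * P.ι b * Y) = η b) (i : Fin n) :
    Q.E (y i) = 0 ∧ (∀ b, Q.E (y i * Q.ι b * y i) = (n : ℂ)⁻¹ • η b) ∧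
    ∀ b b', Q.E (y i * Q.ι b * y i * y i * Q.ι b' * y i) =
      (n : ℂ)⁻¹ • (P.E (Y * P.ι b * Y * Y * P.ι b' * Y) -
        ((n - 1) / (2 * n) : ℂ) • ((2 : ℂ) • (η b * η b') + η (b * η 1 * b'))) := by
  have hn0 : (n : ℂ) ≠ 0 := by exact_mod_cast hn.ne'
  have hE1 : ∀ j, Q.E (y j) = Q.E (y i) := by
    intro j
    simpa [moment, word] using hid j i []
  have hmean_i : Q.E (y i) = 0 := by
    have h1 := hsum []
    simp only [moment, word, List.map_nil, List.nil_append, List.prod_singleton, hmean, map_sum,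
      hE1, Finset.sum_const, Finset.card_univ, Fintype.card_fin] at h1
    rw [← Nat.cast_smul_eq_nsmul ℂ] at h1
    exact (smul_eq_zero.1 h1.symm).resolve_left hn0
  have hmean_j : ∀ j, Q.E (y j) = 0 := fun j => (hE1 j).trans hmean_i
  have hE2 : ∀ j b, Q.E (y j * Q.ι b * y j) = Q.E (y i * Q.ι b * y i) := by
    intro j b
    simpa only [moment_singleton] using hid j i [b]
  have hE2' : ∀ j, Q.E (y j * y j) = Q.E (y i * y i) := by
    intro j
    simpa using hE2 j 1
  have hE4 : ∀ j b b', Q.E (y j * Q.ι b * y j * y j * Q.ι b' * y j) =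
      Q.E (y i * Q.ι b * y i * y i * Q.ι b' * y i) := by
    intro j b b'
    simpa only [moment_four] using hid j i [b, 1, b']
  have hlt : ∀ {s : ℕ} (hs : s < n),
      ∀ j ∈ Finset.univ.filter (fun j : Fin n => (j : ℕ) < s), j < (⟨s, hs⟩ : Fin n) := by
    intro s hs j hj
    simpa [Fin.lt_def] using hj
  have hS1 : ∀ s, Q.E (partialSum y s) = 0 := by
    intro s
    rw [partialSum, map_sum]
    exact Finset.sum_eq_zero fun j _ => hmean_j j
  have hS2 : ∀ s ≤ n, ∀ b, Q.E (partialSum y s * Q.ι b * partialSum y s) =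
      (s : ℂ) • Q.E (y i * Q.ι b * y i) := by
    intro s hs b
    induction s with
    | zero => simp [partialSum_zero]
    | succ s ih =>
      rw [partialSum_succ y hs, partialSum, hMI.second_moment_add hy (hlt hs) (hmean_j _) b,
        ← partialSum, ih (by omega), hE2 ⟨s, hs⟩]
      push_cast
      rw [add_smul, one_smul]
  have hvar_i : ∀ b, Q.E (y i * Q.ι b * y i) = (n : ℂ)⁻¹ • η b := by
    intro b
    have h1 := hS2 n le_rfl b
    rw [partialSum_self, ← moment_singleton, ← hsum, moment_singleton, hvar] at h1
    rw [h1, inv_smul_smul₀ hn0]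
  refine ⟨hmean_i, hvar_i, fun b b' => ?_⟩
  -- Adding the summand number s + 1 contributes s mixed terms of size n⁻² for each of the three
  -- mixed products, so up to s there are s(s - 1)/2 of each kind.
  have hS4 : ∀ s ≤ n, Q.E (partialSum y s * Q.ι b * partialSum y s * partialSum y s * Q.ι b' *
      partialSum y s) = (s : ℂ) • Q.E (y i * Q.ι b * y i * y i * Q.ι b' * y i) +
        (s * (s - 1) / 2 * ((n : ℂ)⁻¹) ^ 2) • ((2 : ℂ) • (η b * η b') + η (b * η 1 * b')) := by
    intro s hs
    induction s with
    | zero => simp [partialSum_zero]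
    | succ s ih =>
      have h1 := hMI.fourth_moment_add hy (hlt hs) (hmean_j _) (hS1 s) (partialSum_succ y hs) b b'
      have hη : η ((n : ℂ)⁻¹ • (b * η 1 * b')) = (n : ℂ)⁻¹ • η (b * η 1 * b') := by
        rw [← hvar, ← hvar (b * η 1 * b'), map_smul, mul_smul_comm, smul_mul_assoc, map_smul]
      have h2 : Q.E (y i * y i) = (n : ℂ)⁻¹ • η 1 := by simpa using hvar_i 1
      rw [h1, ← partialSum, ih (by omega), hS2 s (by omega), hS2 s (by omega), hS2 s (by omega),
        hE2 ⟨s, hs⟩, hE2 ⟨s, hs⟩, hE2' ⟨s, hs⟩, hE4 ⟨s, hs⟩, hvar_i, hvar_i, hvar_i, h2]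
      rw [mul_smul_comm _ b, smul_mul_assoc _ _ b', hη]
      simp only [smul_mul_assoc, mul_smul_comm]
      push_cast
      module
  have h4 := hS4 n le_rfl
  rw [partialSum_self, ← moment_four, ← hsum, moment_four] at h4
  rw [h4, eq_inv_smul_iff₀ hn0]
  have : (n * (n - 1) / 2 * ((n : ℂ)⁻¹) ^ 2) = ((n - 1) / (2 * n) : ℂ) := by
    field_simp
  rw [this]
  abel

end Divisible

end OVProbSpace

/-! ### Nested evaluations -/

section NestedEval

variable {A B : Type*} [Mul A] [Mul B] [One B] {ι : B → A} {f : List A → B}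

lemma nestedEval_of_nonempty (ι : B → A) (f : List A → B) (blk : ℕ → Finset ℕ) (x : ℕ → A)
    {S : Finset ℕ} (h : S.Nonempty) :
    nestedEval ι f blk x S =
      f (((blk (S.min' h)).sort (· ≤ ·)).map fun v =>
        x v * ι (nestedEval ι f blk x (gapAfter (S.erase (S.min' h)) (blk (S.min' h)) v))) *
      nestedEval ι f blk x
        ((S.erase (S.min' h)).filter fun s => ∀ w ∈ blk (S.min' h), w < s) := by
  rw [nestedEval, dif_pos h]

lemma nestedEval_empty (ι : B → A) (f : List A → B) (blk : ℕ → Finset ℕ) (x : ℕ → A) :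
    nestedEval ι f blk x ∅ = 1 := by
  rw [nestedEval, dif_neg (by simp)]

lemma gapAfter_subset (S V : Finset ℕ) (v : ℕ) : gapAfter S V v ⊆ S := Finset.filter_subset _ _

/-- A nested evaluation only depends on the values on the occurring blocks. -/
lemma nestedEval_congr {f' : List A → B} {blk blk' : ℕ → Finset ℕ} {x x' : ℕ → A} {S : Finset ℕ}
    (hblk : ∀ i ∈ S, blk i = blk' i)
    (hf : ∀ i ∈ S, ∀ g : ℕ → B, f (((blk i).sort (· ≤ ·)).map fun v => x v * ι (g v)) =
      f' (((blk i).sort (· ≤ ·)).map fun v => x' v * ι (g v))) :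
    nestedEval ι f blk x S = nestedEval ι f' blk' x' S := by
  induction hn : S.card using Nat.strong_induction_on generalizing S with
  | _ n ih =>
    subst hn
    rcases S.eq_empty_or_nonempty with rfl | h
    · rw [nestedEval_empty, nestedEval_empty]
    · rw [nestedEval_of_nonempty ι f blk x h, nestedEval_of_nonempty ι f' blk' x' h,
        ← hblk _ (S.min'_mem h), hf _ (S.min'_mem h)]
      have hlt : ∀ T : Finset ℕ, T ⊆ S.erase (S.min' h) →
          nestedEval ι f blk x T = nestedEval ι f' blk' x' T := fun T hT =>
        ih _ ((Finset.card_le_card hT).trans_lt (Finset.card_erase_lt_of_mem (S.min'_mem h)))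
          (fun i hi => hblk i (Finset.mem_of_mem_erase (hT hi)))
          (fun i hi => hf i (Finset.mem_of_mem_erase (hT hi))) rfl
      rw [hlt _ (Finset.filter_subset _ _)]
      congr 3
      funext v
      rw [hlt _ (gapAfter_subset _ _ _)]

end NestedEval

/-- If all evaluations on the block of some `v ∈ S` vanish, so does the nested evaluation. -/
lemma nestedEval_eq_zero {A B : Type*} [MulZeroClass A] [MulZeroClass B] [One B] {ι : B → A}
    (hι : ι 0 = 0) {f : List A → B} (hf : ∀ l, 0 ∈ l → f l = 0) {blk : ℕ → Finset ℕ} {x : ℕ → A}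
    {S : Finset ℕ} (hself : ∀ u ∈ S, u ∈ blk u) {v : ℕ} (hv : v ∈ S)
    (hblk : ∀ u ∈ S, v ∈ blk u → ∀ g : ℕ → B,
      f (((blk u).sort (· ≤ ·)).map fun w => x w * ι (g w)) = 0) :
    nestedEval ι f blk x S = 0 := by
  induction hn : S.card using Nat.strong_induction_on generalizing S with
  | _ n ih =>
    subst hn
    have h : S.Nonempty := ⟨v, hv⟩
    set a := S.min' h with ha
    have haS : a ∈ S := S.min'_mem h
    have hlt : ∀ T : Finset ℕ, T ⊆ S.erase a → v ∈ T → nestedEval ι f blk x T = 0 :=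
      fun T hT hvT =>
        ih _ ((Finset.card_le_card hT).trans_lt (Finset.card_erase_lt_of_mem haS))
          (fun i hi => hself i (Finset.mem_of_mem_erase (hT hi))) hvT
          (fun i hi => hblk i (Finset.mem_of_mem_erase (hT hi))) rfl
    rw [nestedEval_of_nonempty ι f blk x h, ← ha]
    by_cases hva : v ∈ blk a
    · rw [hblk a haS hva, zero_mul]
    · have hvne : v ≠ a := fun h' => hva (h' ▸ hself a haS)
      have hav : a < v := lt_of_le_of_ne (S.min'_le v hv) (Ne.symm hvne)
      have hvS : v ∈ S.erase a := Finset.mem_erase.2 ⟨hvne, hv⟩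
      by_cases hlast : ∀ w ∈ blk a, w < v
      · rw [hlt _ (Finset.filter_subset _ _) (Finset.mem_filter.2 ⟨hvS, hlast⟩), mul_zero]
      · push Not at hlast
        obtain ⟨w, hw, hvw⟩ := hlast
        have hvw' : v < w := lt_of_le_of_ne hvw fun h' => hva (h' ▸ hw)
        have hne : ((blk a).filter (· < v)).Nonempty :=
          ⟨a, Finset.mem_filter.2 ⟨hself a haS, hav⟩⟩
        -- The element v lies in the gap after u, its nearest predecessor in the block of a, so the
        -- vanishing inner value appears as an argument of f.
        set u := ((blk a).filter (· < v)).max' hne with hu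
        have hu' := Finset.mem_filter.1 (Finset.max'_mem _ hne)
        have hgap : v ∈ gapAfter (S.erase a) (blk a) u := by
          refine Finset.mem_filter.2 ⟨hvS, hu'.2, ⟨w, hw, hvw'⟩, fun w' hw' huw' => ?_⟩
          by_contra hcon
          have hne' : w' ≠ v := fun h' => hva (h' ▸ hw')
          have : w' ≤ u := Finset.le_max' _ _ (Finset.mem_filter.2 ⟨hw', by omega⟩)
          omega
        rw [hf, zero_mul]
        refine List.mem_map.2 ⟨u, by simpa using hu'.1, ?_⟩
        rw [hlt _ (gapAfter_subset _ _ _) hgap, hι, mul_zero]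

/-! ### Noncrossing pairings -/

/-- The noncrossing pairings of `S`, as sets of blocks. -/
noncomputable def pairings (S : Finset ℕ) : Finset (Finset (Finset ℕ)) := by
  classical
  exact S.powerset.powerset.filter fun p => (∀ V ∈ p, V.card = 2) ∧
    (∀ i ∈ S, ∃! V, V ∈ p ∧ i ∈ V) ∧
    ∀ V ∈ p, ∀ W ∈ p, V ≠ W → ∀ a ∈ V, ∀ b ∈ V, ∀ c ∈ W, ∀ d ∈ W, ¬(a < c ∧ c < b ∧ b < d)

lemma mem_pairings {S : Finset ℕ} {p : Finset (Finset ℕ)} :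
    p ∈ pairings S ↔ (∀ V ∈ p, V ⊆ S) ∧ (∀ V ∈ p, V.card = 2) ∧
    (∀ i ∈ S, ∃! V, V ∈ p ∧ i ∈ V) ∧
    ∀ V ∈ p, ∀ W ∈ p, V ≠ W → ∀ a ∈ V, ∀ b ∈ V, ∀ c ∈ W, ∀ d ∈ W, ¬(a < c ∧ c < b ∧ b < d) := by
  classical
  simp only [pairings, Finset.mem_filter, Finset.mem_powerset]
  refine and_congr_left fun _ => ⟨fun h V hV => Finset.mem_powerset.1 (h hV),
    fun h V hV => Finset.mem_powerset.2 (h V hV)⟩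

/-- The block of `i`. -/
def blockOf (p : Finset (Finset ℕ)) (i : ℕ) : Finset ℕ := (p.filter (i ∈ ·)).biUnion id

/-- The tree factorial of a set of blocks. -/
def blocksFactorial (p : Finset (Finset ℕ)) : ℕ :=
  ∏ V ∈ p, (p.filter fun W => ∀ w ∈ W, (∃ a ∈ V, a ≤ w) ∧ (∃ b ∈ V, w ≤ b)).card

section Pairings

variable {S : Finset ℕ} {p : Finset (Finset ℕ)}

lemma eq_of_mem_pairings (hp : p ∈ pairings S) {V W : Finset ℕ} (hV : V ∈ p) (hW : W ∈ p)
    {i : ℕ} (hiV : i ∈ V) (hiW : i ∈ W) : V = W :=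
  ((mem_pairings.1 hp).2.2.1 i ((mem_pairings.1 hp).1 V hV hiV)).unique ⟨hV, hiV⟩ ⟨hW, hiW⟩

lemma blockOf_eq {V : Finset ℕ} {i : ℕ} (hV : V ∈ p) (hi : i ∈ V)
    (h : ∀ W ∈ p, i ∈ W → W = V) : blockOf p i = V := by
  have : p.filter (i ∈ ·) = {V} := by
    ext W
    simp only [Finset.mem_filter, Finset.mem_singleton]
    exact ⟨fun hW => h W hW.1 hW.2, fun hW => hW ▸ ⟨hV, hi⟩⟩
  rw [blockOf, this, Finset.singleton_biUnion, id]

lemma blockOf_eq_of_mem_pairings (hp : p ∈ pairings S) {V : Finset ℕ} (hV : V ∈ p) {i : ℕ}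
    (hi : i ∈ V) : blockOf p i = V :=
  blockOf_eq hV hi fun _ hW hiW => eq_of_mem_pairings hp hW hV hiW hi

lemma card_eq_of_mem_pairings (hp : p ∈ pairings S) : S.card = 2 * p.card := by
  obtain ⟨h1, h2, h3, -⟩ := mem_pairings.1 hp
  have hS : S = p.biUnion id := by
    ext i
    simp only [Finset.mem_biUnion, id]
    exact ⟨fun hi => (h3 i hi).exists, fun ⟨V, hV, hi⟩ => h1 V hV hi⟩
  have hdisj : (p : Set (Finset ℕ)).PairwiseDisjoint id := by
    intro V hV W hW hVW
    refine Finset.disjoint_left.2 fun i hiV hiW => hVW (eq_of_mem_pairings hp hV hW hiV hiW)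
  rw [hS, Finset.card_biUnion hdisj]
  simp only [id]
  rw [Finset.sum_congr rfl h2]
  simp [mul_comm]

variable {a d : ℕ}

/-- The part of `S` between `a` and `d`. -/
def innerPart (S : Finset ℕ) (a d : ℕ) : Finset ℕ := S.filter fun s => a < s ∧ s < d

/-- The part of `S` beyond `d`. -/
def outerPart (S : Finset ℕ) (d : ℕ) : Finset ℕ := S.filter fun s => d < s

lemma mem_innerPart {s : ℕ} : s ∈ innerPart S a d ↔ s ∈ S ∧ a < s ∧ s < d := Finset.mem_filter

lemma mem_outerPart {s : ℕ} : s ∈ outerPart S d ↔ s ∈ S ∧ d < s := Finset.mem_filter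

/-- The block of the least element separates S into an inside and an outside that no block of the
two parts connects. This is one half of the bijection behind `sum_pairings`. -/
lemma glue_mem_pairings (ha : a ∈ S) (hmin : ∀ s ∈ S, a ≤ s) (hd : d ∈ S) (had : a < d)
    {p₁ p₂ : Finset (Finset ℕ)} (h₁ : p₁ ∈ pairings (innerPart S a d))
    (h₂ : p₂ ∈ pairings (outerPart S d)) : insert {a, d} (p₁ ∪ p₂) ∈ pairings S := by
  obtain ⟨a1, b1, c1, d1⟩ := mem_pairings.1 h₁
  obtain ⟨a2, b2, c2, d2⟩ := mem_pairings.1 h₂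
  have m1 : ∀ V ∈ p₁, ∀ s ∈ V, s ∈ S ∧ a < s ∧ s < d := fun V hV s hs => mem_innerPart.1 (a1 V hV hs)
  have m2 : ∀ V ∈ p₂, ∀ s ∈ V, s ∈ S ∧ d < s := fun V hV s hs => mem_outerPart.1 (a2 V hV hs)
  have hmem : ∀ V, V ∈ insert {a, d} (p₁ ∪ p₂) ↔ V = {a, d} ∨ V ∈ p₁ ∨ V ∈ p₂ := by
    intro V
    simp
  refine mem_pairings.2 ⟨?_, ?_, ?_, ?_⟩
  · intro V hV s hs
    rcases (hmem V).1 hV with rfl | h | h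
    · rcases Finset.mem_insert.1 hs with rfl | hs
      · exact ha
      · rwa [Finset.mem_singleton.1 hs]
    · exact (m1 V h s hs).1
    · exact (m2 V h s hs).1
  · intro V hV
    rcases (hmem V).1 hV with rfl | h | h
    · exact Finset.card_pair had.ne
    · exact b1 V h
    · exact b2 V h
  · intro i hi
    have hcases : (i = a ∨ i = d) ∨ i ∈ innerPart S a d ∨ i ∈ outerPart S d := by
      have := hmin i hi
      rw [mem_innerPart, mem_outerPart]
      by_cases h1 : i = a
      · exact .inl (.inl h1)
      by_cases h2 : i = d
      · exact .inl (.inr h2)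
      rcases lt_or_gt_of_ne h2 with h3 | h3
      · exact .inr (.inl ⟨hi, by omega, h3⟩)
      · exact .inr (.inr ⟨hi, h3⟩)
    rcases hcases with h | h | h
    · refine ⟨{a, d}, ⟨(hmem _).2 (.inl rfl), by simpa using h⟩, ?_⟩
      rintro V ⟨hV, hiV⟩
      rcases (hmem V).1 hV with rfl | h' | h'
      · rfl
      · have := m1 V h' i hiV; omega
      · have := m2 V h' i hiV; omega
    · obtain ⟨V, ⟨hV, hiV⟩, huniq⟩ := c1 i h
      have h0 := mem_innerPart.1 h
      refine ⟨V, ⟨(hmem _).2 (.inr (.inl hV)), hiV⟩, ?_⟩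
      rintro W ⟨hW, hiW⟩
      rcases (hmem W).1 hW with rfl | h' | h'
      · simp at hiW; omega
      · exact huniq W ⟨h', hiW⟩
      · have := m2 W h' i hiW; omega
    · obtain ⟨V, ⟨hV, hiV⟩, huniq⟩ := c2 i h
      have h0 := mem_outerPart.1 h
      refine ⟨V, ⟨(hmem _).2 (.inr (.inr hV)), hiV⟩, ?_⟩
      rintro W ⟨hW, hiW⟩
      rcases (hmem W).1 hW with rfl | h' | h'
      · simp at hiW; omega
      · have := m1 W h' i hiW; omega
      · exact huniq W ⟨h', hiW⟩
  · intro V hV W hW hVW x hx y hy s hs t ht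
    rcases (hmem V).1 hV with rfl | h | h <;> rcases (hmem W).1 hW with rfl | h' | h'
    · exact absurd rfl hVW
    · have := m1 W h' s hs; have := m1 W h' t ht
      simp at hx hy; omega
    · have := m2 W h' s hs; have := m2 W h' t ht
      simp at hx hy; omega
    · have := m1 V h x hx; have := m1 V h y hy
      simp at hs ht; omega
    · exact d1 V h W h' hVW x hx y hy s hs t ht
    · have := m1 V h x hx; have := m1 V h y hy
      have := m2 W h' s hs; have := m2 W h' t ht
      omega
    · have := m2 V h x hx; have := m2 V h y hy
      simp at hs ht; omega
    · have := m2 V h x hx; have := m2 V h y hy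
      have := m1 W h' s hs; have := m1 W h' t ht
      omega
    · exact d2 V h W h' hVW x hx y hy s hs t ht

/-- The block of the least element of `S` is `{a, d}`, and the other blocks lie between `a` and `d`
or beyond `d`. -/
lemma exists_of_mem_pairings (ha : a ∈ S) (hmin : ∀ s ∈ S, a ≤ s) (hp : p ∈ pairings S) :
    ∃ d ∈ S, a < d ∧ {a, d} ∈ p ∧
      ∀ V ∈ p, V = {a, d} ∨ V ⊆ innerPart S a d ∨ V ⊆ outerPart S d := by
  obtain ⟨h1, h2, h3, h4⟩ := mem_pairings.1 hp
  obtain ⟨V, ⟨hV, haV⟩, -⟩ := h3 a ha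
  obtain ⟨u, v, huv, rfl⟩ := Finset.card_eq_two.1 (h2 V hV)
  obtain ⟨d, hdS, hda, hd⟩ : ∃ d ∈ S, d ≠ a ∧ ({u, v} : Finset ℕ) = {a, d} := by
    rcases Finset.mem_insert.1 haV with rfl | h
    · exact ⟨v, h1 _ hV (by simp), huv.symm, rfl⟩
    · rw [Finset.mem_singleton] at h
      subst h
      exact ⟨u, h1 _ hV (by simp), huv, Finset.pair_comm _ _⟩
  rw [hd] at hV
  have had : a < d := lt_of_le_of_ne (hmin d hdS) hda.symm
  refine ⟨d, hdS, had, hV, fun W hW => ?_⟩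
  by_cases hWV : W = {a, d}
  · exact .inl hWV
  right
  have hWa : ∀ s ∈ W, a < s ∧ s ≠ d := by
    intro s hs
    refine ⟨lt_of_le_of_ne (hmin s (h1 W hW hs)) ?_, ?_⟩
    · rintro rfl
      exact hWV (eq_of_mem_pairings hp hW hV hs (by simp))
    · rintro rfl
      exact hWV (eq_of_mem_pairings hp hW hV hs (by simp))
  by_cases hin : ∃ s ∈ W, s < d
  · left
    obtain ⟨s, hs, hsd⟩ := hin
    intro t ht
    refine mem_innerPart.2 ⟨h1 W hW ht, (hWa t ht).1, ?_⟩
    by_contra hcon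
    have := (hWa t ht).2
    exact h4 _ hV W hW (Ne.symm hWV) a (by simp) d (by simp) s hs t ht
      ⟨(hWa s hs).1, hsd, by omega⟩
  · right
    push Not at hin
    intro t ht
    exact mem_outerPart.2 ⟨h1 W hW ht, lt_of_le_of_ne (hin t ht) (Ne.symm (hWa t ht).2)⟩

lemma filter_mem_pairings (hp : p ∈ pairings S) {T : Finset ℕ} (hT : T ⊆ S)
    (h : ∀ V ∈ p, ∀ i ∈ V, i ∈ T → V ⊆ T) : p.filter (· ⊆ T) ∈ pairings T := by
  obtain ⟨h1, h2, h3, h4⟩ := mem_pairings.1 hp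
  refine mem_pairings.2 ⟨fun V hV => (Finset.mem_filter.1 hV).2,
    fun V hV => h2 V (Finset.mem_filter.1 hV).1, fun i hi => ?_, fun V hV W hW =>
    h4 V (Finset.mem_filter.1 hV).1 W (Finset.mem_filter.1 hW).1⟩
  obtain ⟨V, ⟨hV, hiV⟩, hu⟩ := h3 i (hT hi)
  exact ⟨V, ⟨Finset.mem_filter.2 ⟨hV, h V hV i hiV hi⟩, hiV⟩,
    fun W hW => hu W ⟨(Finset.mem_filter.1 hW.1).1, hW.2⟩⟩

/-- Sums over the noncrossing pairings of `S`, according to the partner of the least element. -/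
lemma sum_pairings {V : Type*} [AddCommMonoid V] (ha : a ∈ S) (hmin : ∀ s ∈ S, a ≤ s)
    (F : Finset (Finset ℕ) → V) :
    ∑ p ∈ pairings S, F p = ∑ d ∈ S.filter (a < ·), ∑ p₁ ∈ pairings (innerPart S a d),
      ∑ p₂ ∈ pairings (outerPart S d), F (insert {a, d} (p₁ ∪ p₂)) := by
  have hsplit : ∀ {d p₁ p₂}, a < d → p₁ ∈ pairings (innerPart S a d) →
      p₂ ∈ pairings (outerPart S d) →
      (insert {a, d} (p₁ ∪ p₂)).filter (· ⊆ innerPart S a d) = p₁ ∧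
      (insert {a, d} (p₁ ∪ p₂)).filter (· ⊆ outerPart S d) = p₂ := by
    intro d p₁ p₂ had h₁ h₂
    have a1 := (mem_pairings.1 h₁).1
    have a2 := (mem_pairings.1 h₂).1
    have e : ∀ V ∈ p₁, ∃ s, s ∈ V := fun V hV => Finset.card_pos.1 (by
      rw [(mem_pairings.1 h₁).2.1 V hV]; norm_num)
    have e' : ∀ V ∈ p₂, ∃ s, s ∈ V := fun V hV => Finset.card_pos.1 (by
      rw [(mem_pairings.1 h₂).2.1 V hV]; norm_num)
    constructor
    · ext V
      simp only [Finset.mem_filter, Finset.mem_insert, Finset.mem_union]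
      refine ⟨?_, fun h => ⟨.inr (.inl h), a1 V h⟩⟩
      rintro ⟨rfl | h | h, hV⟩
      · have := mem_innerPart.1 (hV (Finset.mem_insert_self a _)); omega
      · exact h
      · obtain ⟨s, hs⟩ := e' V h
        have := mem_innerPart.1 (hV hs); have := mem_outerPart.1 (a2 V h hs); omega
    · ext V
      simp only [Finset.mem_filter, Finset.mem_insert, Finset.mem_union]
      refine ⟨?_, fun h => ⟨.inr (.inr h), a2 V h⟩⟩
      rintro ⟨rfl | h | h, hV⟩
      · have := mem_outerPart.1 (hV (Finset.mem_insert_self a _)); omega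
      · obtain ⟨s, hs⟩ := e V h
        have := mem_outerPart.1 (hV hs); have := mem_innerPart.1 (a1 V h hs); omega
      · exact h
  simp_rw [← Finset.sum_product']
  rw [Finset.sum_sigma']
  symm
  -- The partner of a is recovered as the largest element of its block, and the two parts as the
  -- blocks inside and beyond.
  refine Finset.sum_bij' (fun x _ => insert {a, x.1} (x.2.1 ∪ x.2.2))
    (fun p _ => ⟨(blockOf p a).sup id, p.filter (· ⊆ innerPart S a ((blockOf p a).sup id)),
      p.filter (· ⊆ outerPart S ((blockOf p a).sup id))⟩) ?_ ?_ ?_ ?_ ?_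
  · rintro ⟨d, p₁, p₂⟩ hx
    simp only [Finset.mem_sigma, Finset.mem_filter, Finset.mem_product] at hx
    exact glue_mem_pairings ha hmin hx.1.1 hx.1.2 hx.2.1 hx.2.2
  · intro p hp
    obtain ⟨d, hdS, had, hd, hV⟩ := exists_of_mem_pairings ha hmin hp
    have hb : (blockOf p a).sup id = d := by
      rw [blockOf_eq_of_mem_pairings hp hd (by simp)]
      simp [had.le]
    rw [hb]
    simp only [Finset.mem_sigma, Finset.mem_filter, Finset.mem_product]
    refine ⟨⟨hdS, had⟩, filter_mem_pairings hp (Finset.filter_subset _ _) ?_,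
      filter_mem_pairings hp (Finset.filter_subset _ _) ?_⟩
    · intro V hVp i hi hi'
      have h0 := mem_innerPart.1 hi'
      rcases hV V hVp with rfl | h | h
      · simp at hi; omega
      · exact h
      · have := mem_outerPart.1 (h hi); omega
    · intro V hVp i hi hi'
      have h0 := mem_outerPart.1 hi'
      rcases hV V hVp with rfl | h | h
      · simp at hi; omega
      · have := mem_innerPart.1 (h hi); omega
      · exact h
  · rintro ⟨d, p₁, p₂⟩ hx
    simp only [Finset.mem_sigma, Finset.mem_filter, Finset.mem_product] at hx
    have hp := glue_mem_pairings ha hmin hx.1.1 hx.1.2 hx.2.1 hx.2.2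
    have hb : (blockOf (insert {a, d} (p₁ ∪ p₂)) a).sup id = d := by
      rw [blockOf_eq_of_mem_pairings hp (Finset.mem_insert_self _ _) (by simp)]
      simp [hx.1.2.le]
    simp only [hb]
    rw [(hsplit hx.1.2 hx.2.1 hx.2.2).1, (hsplit hx.1.2 hx.2.1 hx.2.2).2]
  · intro p hp
    obtain ⟨d, hdS, had, hd, hV⟩ := exists_of_mem_pairings ha hmin hp
    have hb : (blockOf p a).sup id = d := by
      rw [blockOf_eq_of_mem_pairings hp hd (by simp)]
      simp [had.le]
    simp only [hb]
    ext V
    simp only [Finset.mem_filter, Finset.mem_insert, Finset.mem_union]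
    constructor
    · rintro (rfl | h | h)
      exacts [hd, h.1, h.1]
    · intro h
      rcases hV V h with h' | h' | h'
      exacts [.inl h', .inr (.inl ⟨h, h'⟩), .inr (.inr ⟨h, h'⟩)]
  · rintro ⟨d, p₁, p₂⟩ hx
    rfl

/-- The block {a, d} covers itself and all of p₁, which gives the factor #p₁ + 1; the blocks of p₁
and p₂ cover only blocks of their own part. -/
lemma blocksFactorial_glue (had : a < d) {p₁ p₂ : Finset (Finset ℕ)}
    (h₁ : p₁ ∈ pairings (innerPart S a d)) (h₂ : p₂ ∈ pairings (outerPart S d)) :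
    blocksFactorial (insert {a, d} (p₁ ∪ p₂)) =
      (p₁.card + 1) * blocksFactorial p₁ * blocksFactorial p₂ := by
  have m1 : ∀ V ∈ p₁, ∀ s ∈ V, a < s ∧ s < d := fun V hV s hs =>
    (mem_innerPart.1 ((mem_pairings.1 h₁).1 V hV hs)).2
  have m2 : ∀ V ∈ p₂, ∀ s ∈ V, d < s := fun V hV s hs =>
    (mem_outerPart.1 ((mem_pairings.1 h₂).1 V hV hs)).2
  have e1 : ∀ V ∈ p₁, ∃ s, s ∈ V := fun V hV => Finset.card_pos.1 (by
    rw [(mem_pairings.1 h₁).2.1 V hV]; norm_num)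
  have e2 : ∀ V ∈ p₂, ∃ s, s ∈ V := fun V hV => Finset.card_pos.1 (by
    rw [(mem_pairings.1 h₂).2.1 V hV]; norm_num)
  have hd12 : Disjoint p₁ p₂ := Finset.disjoint_left.2 fun V hV hV' => by
    obtain ⟨s, hs⟩ := e1 V hV
    have := m1 V hV s hs; have := m2 V hV' s hs; omega
  have hn1 : {a, d} ∉ p₁ := fun h => by have := m1 _ h a (by simp); omega
  have hn2 : {a, d} ∉ p₂ := fun h => by have := m2 _ h a (by simp); omega
  rw [blocksFactorial, Finset.prod_insert (by simp [hn1, hn2]), Finset.prod_union hd12, mul_assoc]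
  congr 1
  · rw [← Finset.card_insert_of_notMem hn1]
    congr 1
    ext W
    simp only [Finset.mem_filter, Finset.mem_insert, Finset.mem_union]
    constructor
    · rintro ⟨rfl | h | h, hW⟩
      · exact .inl rfl
      · exact .inr h
      · obtain ⟨s, hs⟩ := e2 W h
        obtain ⟨-, b, hb, hsb⟩ := hW s hs
        have := m2 W h s hs
        simp at hb
        omega
    · rintro (rfl | h)
      · refine ⟨.inl rfl, fun w hw => ?_⟩
        exact ⟨⟨w, by simpa using hw, le_rfl⟩, ⟨w, by simpa using hw, le_rfl⟩⟩
      · refine ⟨.inr (.inl h), fun w hw => ?_⟩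
        have := m1 W h w hw
        exact ⟨⟨a, by simp, by omega⟩, ⟨d, by simp, by omega⟩⟩
  · congr 1
    · refine Finset.prod_congr rfl fun V hV => ?_
      congr 1
      ext W
      simp only [Finset.mem_filter, Finset.mem_insert, Finset.mem_union]
      refine ⟨?_, fun h => ⟨.inr (.inl h.1), h.2⟩⟩
      rintro ⟨rfl | h | h, hW⟩
      · obtain ⟨⟨b, hb, hba⟩, -⟩ := hW a (by simp)
        have := m1 V hV b hb; omega
      · exact ⟨h, hW⟩
      · obtain ⟨s, hs⟩ := e2 W h
        obtain ⟨-, b, hb, hsb⟩ := hW s hs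
        have := m1 V hV b hb; have := m2 W h s hs; omega
    · refine Finset.prod_congr rfl fun V hV => ?_
      congr 1
      ext W
      simp only [Finset.mem_filter, Finset.mem_insert, Finset.mem_union]
      refine ⟨?_, fun h => ⟨.inr (.inr h.1), h.2⟩⟩
      rintro ⟨rfl | h | h, hW⟩
      · obtain ⟨⟨b, hb, hba⟩, -⟩ := hW a (by simp)
        have := m2 V hV b hb; omega
      · obtain ⟨s, hs⟩ := e1 W h
        obtain ⟨⟨b, hb, hsb⟩, -⟩ := hW s hs
        have := m2 V hV b hb; have := m1 W h s hs; omega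
      · exact ⟨h, hW⟩

lemma sort_pair (had : a < d) : ({a, d} : Finset ℕ).sort (· ≤ ·) = [a, d] := by
  rw [Finset.sort_insert (· ≤ ·) (by simp [had.le]) (by simp [had.ne]), Finset.sort_singleton]

/-- The nested evaluation along a pairing, according to the partner of the least element. -/
lemma nestedEval_glue {A B : Type*} [Mul A] [Monoid B] (ι : B → A) (f : List A → B) (x : ℕ → A)
    (ha : a ∈ S) (hmin : ∀ s ∈ S, a ≤ s) (hd : d ∈ S) (had : a < d)
    {p₁ p₂ : Finset (Finset ℕ)} (h₁ : p₁ ∈ pairings (innerPart S a d))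
    (h₂ : p₂ ∈ pairings (outerPart S d)) :
    nestedEval ι f (blockOf (insert {a, d} (p₁ ∪ p₂))) x S =
      f [x a * ι (nestedEval ι f (blockOf p₁) x (innerPart S a d)), x d * ι 1] *
        nestedEval ι f (blockOf p₂) x (outerPart S d) := by
  have hp := glue_mem_pairings ha hmin hd had h₁ h₂
  have hS : S.Nonempty := ⟨a, ha⟩
  have hmin' : S.min' hS = a :=
    le_antisymm (S.min'_le a ha) (hmin _ (S.min'_mem hS))
  have hblk : blockOf (insert {a, d} (p₁ ∪ p₂)) a = {a, d} :=
    blockOf_eq_of_mem_pairings hp (Finset.mem_insert_self _ _) (by simp)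
  have hg1 : gapAfter (S.erase a) {a, d} a = innerPart S a d := by
    ext s
    simp only [gapAfter, Finset.mem_filter, mem_innerPart, Finset.mem_erase, Finset.mem_insert,
      Finset.mem_singleton, exists_eq_or_imp, exists_eq_left, forall_eq_or_imp, forall_eq]
    constructor
    · rintro ⟨⟨-, h1⟩, h2, -, -, h3⟩
      exact ⟨h1, h2, h3 had⟩
    · rintro ⟨h1, h2, h3⟩
      exact ⟨⟨by omega, h1⟩, h2, .inr h3, by omega, fun _ => h3⟩
  -- Nothing follows d within its block, which is why the second entry carries the factor ι 1.
  have hg2 : gapAfter (S.erase a) {a, d} d = ∅ := by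
    refine Finset.filter_eq_empty_iff.2 ?_
    rintro s - ⟨h1, ⟨w, hw, h2⟩, -⟩
    simp at hw
    omega
  have hrest : ((S.erase a).filter fun s => ∀ w ∈ ({a, d} : Finset ℕ), w < s) = outerPart S d := by
    ext s
    simp only [Finset.mem_filter, mem_outerPart, Finset.mem_erase, Finset.mem_insert,
      Finset.mem_singleton, forall_eq_or_imp, forall_eq]
    constructor
    · rintro ⟨⟨-, h1⟩, -, h2⟩
      exact ⟨h1, h2⟩
    · rintro ⟨h1, h2⟩
      exact ⟨⟨by omega, h1⟩, by omega, h2⟩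
  rw [nestedEval_of_nonempty ι f _ x hS, hmin', hblk, sort_pair had]
  simp only [List.map_cons, List.map_nil, hg1, hg2, hrest, nestedEval_empty]
  congr 1
  · congr 4
    refine nestedEval_congr (fun i hi => ?_) (fun _ _ _ => rfl)
    obtain ⟨V, ⟨hV, hiV⟩, -⟩ := (mem_pairings.1 h₁).2.2.1 i hi
    rw [blockOf_eq_of_mem_pairings h₁ hV hiV,
      blockOf_eq_of_mem_pairings hp (by simp [hV]) hiV]
  · refine nestedEval_congr (fun i hi => ?_) (fun _ _ _ => rfl)
    obtain ⟨V, ⟨hV, hiV⟩, -⟩ := (mem_pairings.1 h₂).2.2.1 i hi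
    rw [blockOf_eq_of_mem_pairings h₂ hV hiV,
      blockOf_eq_of_mem_pairings hp (by simp [hV]) hiV]

end Pairings

/-- Sums over `NC₂(n)` as sums over pairings. -/
lemma sum_NC₂ {V : Type*} [AddCommMonoid V] {n : ℕ} (F : ℕ → (ℕ → Finset ℕ) → V)
    (hF : ∀ m b b', (∀ i ∈ Finset.range n, b i = b' i) → F m b = F m b') :
    ∑ π ∈ NC₂ n, F (treeFactorial π) (fun i => π.part i) =
      ∑ p ∈ pairings (Finset.range n), F (blocksFactorial p) (blockOf p) := by
  refine Finset.sum_bij (fun π _ => π.parts) ?_ ?_ ?_ ?_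
  · intro π hπ
    simp only [NC₂, NC, Finset.mem_filter, Finset.mem_univ, true_and] at hπ
    exact mem_pairings.2 ⟨fun V hV => π.subset hV, hπ.2, fun i hi => π.existsUnique_mem hi, hπ.1⟩
  · intro π _ π' _ h
    exact Finpartition.ext h
  · intro p hp
    obtain ⟨h1, h2, h3, h4⟩ := mem_pairings.1 hp
    refine ⟨Finpartition.ofExistsUnique p h1 (fun a ha => by simpa [and_assoc] using h3 a ha)
      (fun h => by simpa using h2 _ h), ?_, rfl⟩
    simp only [NC₂, NC, Finset.mem_filter, Finset.mem_univ, true_and]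
    exact ⟨h4, h2⟩
  · intro π hπ
    change F (blocksFactorial π.parts) _ = _
    refine hF _ _ _ fun i hi => ?_
    exact (blockOf_eq (π.part_mem.2 hi) (π.mem_part_self.2 hi)
      fun W hW hiW => (π.part_eq_of_mem hW hiW).symm).symm

/-! ### The moments of an arcsine element -/

section PairSum

variable {A B : Type*} [Mul A] [Ring B] [Algebra ℂ B]

/-- The sum over all noncrossing pairings of `S` of the nested evaluations, weighted by the inverse
tree factorials. -/
noncomputable def pairSum (ι : B → A) (f : List A → B) (x : ℕ → A) (S : Finset ℕ) : B :=
  ∑ p ∈ pairings S, (1 / (blocksFactorial p : ℂ)) • nestedEval ι f (blockOf p) x S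

variable (ι : B → A) (f : List A → B) (x : ℕ → A)

lemma pairSum_empty : pairSum ι f x ∅ = 1 := by
  have : pairings ∅ = {∅} := by
    ext p
    rw [mem_pairings, Finset.mem_singleton]
    constructor
    · rintro ⟨h1, h2, -, -⟩
      refine Finset.eq_empty_of_forall_notMem fun V hV => ?_
      have := h2 V hV
      rw [Finset.subset_empty.1 (h1 V hV)] at this
      simp at this
    · rintro rfl
      simp
  simp [pairSum, this, blocksFactorial, nestedEval_empty]

/-- A pairing of the inner part has half as many blocks as that part has points, so the weight
1/(#p₁ + 1) depends on d alone. The sums over the inner and the outer pairings therefore factor. -/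
lemma pairSum_eq {S : Finset ℕ} {a : ℕ} (ha : a ∈ S) (hmin : ∀ s ∈ S, a ≤ s)
    (g : ℕ → ℕ → B →ₗ[ℂ] B) (hf : ∀ a d b, f [x a * ι b, x d * ι 1] = g a d b) :
    pairSum ι f x S = ∑ d ∈ S.filter (a < ·),
      ((2 : ℂ) / ((innerPart S a d).card + 2)) •
        (g a d (pairSum ι f x (innerPart S a d)) * pairSum ι f x (outerPart S d)) := by
  rw [pairSum, sum_pairings ha hmin]
  refine Finset.sum_congr rfl fun d hd => ?_
  obtain ⟨hd, had⟩ := Finset.mem_filter.1 hd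
  rw [pairSum, pairSum, map_sum, Finset.sum_mul, Finset.smul_sum]
  refine Finset.sum_congr rfl fun p₁ h₁ => ?_
  rw [Finset.mul_sum, Finset.smul_sum]
  refine Finset.sum_congr rfl fun p₂ h₂ => ?_
  rw [nestedEval_glue ι f x ha hmin hd had h₁ h₂, hf, blocksFactorial_glue had h₁ h₂,
    card_eq_of_mem_pairings h₁, map_smul, smul_mul_smul_comm, smul_smul]
  congr 1
  push_cast
  have : ((p₁.card : ℂ) + 1) ≠ 0 := by exact_mod_cast Nat.succ_ne_zero p₁.card
  rcases eq_or_ne (blocksFactorial p₁ : ℂ) 0 with h0 | h0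
  · simp [h0]
  rcases eq_or_ne (blocksFactorial p₂ : ℂ) 0 with h0' | h0'
  · simp [h0']
  field_simp

lemma pairSum_Ico {i m : ℕ} (g : ℕ → ℕ → B →ₗ[ℂ] B)
    (hf : ∀ a d b, f [x a * ι b, x d * ι 1] = g a d b) :
    pairSum ι f x (Finset.Ico i (i + (m + 1))) = ∑ e ∈ Finset.range m,
      ((2 : ℂ) / ((e : ℂ) + 2)) • (g i (i + 1 + e) (pairSum ι f x (Finset.Ico (i + 1) (i + 1 + e))) *
        pairSum ι f x (Finset.Ico (i + 1 + e + 1) (i + (m + 1)))) := by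
  rw [pairSum_eq ι f x (a := i) (by simp) (by simp; omega) g hf]
  have : (Finset.Ico i (i + (m + 1))).filter (i < ·) = (Finset.range m).map (addLeftEmbedding (i + 1)) := by
    ext d
    simp only [Finset.mem_filter, Finset.mem_Ico, Finset.mem_map, Finset.mem_range,
      addLeftEmbedding_apply]
    constructor
    · rintro ⟨⟨h1, h2⟩, h3⟩
      exact ⟨d - (i + 1), by omega, by omega⟩
    · rintro ⟨e, he, rfl⟩
      omega
  rw [this, Finset.sum_map]
  refine Finset.sum_congr rfl fun e he => ?_
  have he := Finset.mem_range.1 he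
  have h1 : innerPart (Finset.Ico i (i + (m + 1))) i (i + 1 + e) = Finset.Ico (i + 1) (i + 1 + e) := by
    ext s
    simp only [mem_innerPart, Finset.mem_Ico]
    omega
  have h2 : outerPart (Finset.Ico i (i + (m + 1))) (i + 1 + e) =
      Finset.Ico (i + 1 + e + 1) (i + (m + 1)) := by
    ext s
    simp only [mem_outerPart, Finset.mem_Ico]
    omega
  simp only [addLeftEmbedding_apply, h1, h2, Nat.card_Ico, add_tsub_cancel_left]

end PairSum

section ArcsineMoment

variable {B : Type*} [NormedRing B] [NormedAlgebra ℂ B] (η : B →L[ℂ] B)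

/-- The recursive description of `E[b₀ X b₁ X ⋯ X b_n]` for an arcsine element `X` with
variance `η`. -/
noncomputable def arcsineMoment : List B → B
  | [] => 0
  -- The first X is paired with the one in front of `l.drop d`. The d letters in between enclose d -
  -- 1 factors X, so the weight 2/((d - 1) + 2) is that of `pairSum_eq`. The term d = 0 vanishes
  -- because the value on the empty list is 0.
  | b :: l => if l = [] then b else ∑ d ∈ Finset.range l.length,
      (2 / ((d : ℂ) + 1)) • (b * η (arcsineMoment (l.take d)) * arcsineMoment (l.drop d))
termination_by l => l.length
decreasing_by
  all_goals simp
  try omega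

@[simp] lemma arcsineMoment_nil : arcsineMoment η [] = 0 := by rw [arcsineMoment]

@[simp] lemma arcsineMoment_singleton (b : B) : arcsineMoment η [b] = b := by
  rw [arcsineMoment, if_pos rfl]

lemma arcsineMoment_cons (b : B) {l : List B} (hl : l ≠ []) :
    arcsineMoment η (b :: l) = ∑ d ∈ Finset.range l.length,
      (2 / ((d : ℂ) + 1)) •
        (b * η (arcsineMoment η (l.take d)) * arcsineMoment η (l.drop d)) := by
  rw [arcsineMoment, if_neg hl]

lemma arcsineMoment_eq_zero {l : List B} (h : 0 ∈ l) : arcsineMoment η l = 0 := by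
  induction hn : l.length using Nat.strong_induction_on generalizing l with
  | _ n ih =>
    cases l with
    | nil => simp
    | cons b l =>
      by_cases hl : l = []
      · subst hl
        simpa [eq_comm] using h
      rw [arcsineMoment_cons η b hl]
      refine Finset.sum_eq_zero fun d hd => ?_
      have hd := Finset.mem_range.1 hd
      simp only [List.length_cons] at hn
      rcases List.mem_cons.1 h with rfl | h
      · simp
      · rw [← List.take_append_drop d l, List.mem_append] at h
        rcases h with h | h
        · rw [ih _ (by simp; omega) h rfl]; simp
        · rw [ih _ (by simp; omega) h rfl]; simp

/-- An even number of letters separates an odd number of factors X, which cannot be paired. -/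
lemma arcsineMoment_eq_zero_of_even {l : List B} (h : Even l.length) : arcsineMoment η l = 0 := by
  induction hn : l.length using Nat.strong_induction_on generalizing l with
  | _ n ih =>
    cases l with
    | nil => simp
    | cons b l =>
      by_cases hl : l = []
      · subst hl
        simp at h
      rw [arcsineMoment_cons η b hl]
      refine Finset.sum_eq_zero fun d hd => ?_
      have hd := Finset.mem_range.1 hd
      simp only [List.length_cons] at hn h
      rcases Nat.even_or_odd d with hd' | hd'
      · rw [ih _ (by simp; omega) (by simpa [hd.le] using hd') rfl]; simp
      · rw [ih (l.drop d).length (by simp; omega) ?_ rfl]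
        · simp
        · rw [List.length_drop, Nat.even_sub hd.le]
          rw [Nat.even_add_one] at h
          simp only [h, ← Nat.not_odd_iff_even, hd', not_true]

lemma arcsineMoment_concat (l : List B) (c : B) :
    arcsineMoment η (l ++ [c]) = arcsineMoment η (l ++ [1]) * c := by
  induction hn : l.length using Nat.strong_induction_on generalizing l with
  | _ n ih =>
    cases l with
    | nil => simp
    | cons b l =>
      simp only [List.cons_append]
      rw [arcsineMoment_cons η b (by simp), arcsineMoment_cons η b (by simp), Finset.sum_mul]
      simp only [List.length_append, List.length_singleton]
      refine Finset.sum_congr rfl fun d hd => ?_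
      have hd := Finset.mem_range.1 hd
      simp only [List.length_cons] at hn
      rw [List.take_append_of_le_length (by omega), List.take_append_of_le_length (by omega),
        List.drop_append_of_le_length (by omega), List.drop_append_of_le_length (by omega),
        ih _ (by simp; omega) _ rfl, smul_mul_assoc, mul_assoc (b * _)]

lemma arcsineMoment_cons_mul (b : B) (l : List B) :
    arcsineMoment η (b :: l) = b * arcsineMoment η (1 :: l) := by
  by_cases hl : l = []
  · simp [hl]
  · simp only [arcsineMoment_cons η _ hl, Finset.mul_sum, one_mul, mul_smul_comm, mul_assoc]

/-- Both sides obey the same recursion in the partner of the first X. This connects the definition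
through nested evaluations with the recursive one used afterwards. -/
lemma arcsineMoment_cons_map {A : Type*} [Mul A] (ι : B → A) (f : List A → B) (x : ℕ → A)
    (c : ℕ → B) (hf : ∀ a d b, f [x a * ι b, x d * ι 1] = η (c a * b) * c d) (b : B) (i m : ℕ) :
    arcsineMoment η (b :: (List.range' i m).map c) =
      b * pairSum ι f x (Finset.Ico i (i + m)) := by
  induction m using Nat.strong_induction_on generalizing b i with
  | _ m ih =>
    cases m with
    | zero => simp [pairSum_empty]
    | succ m =>
      have hg : ∀ a d b, f [x a * ι b, x d * ι 1] =
          (LinearMap.mulRight ℂ (c d) ∘ₗ η.toLinearMap ∘ₗ LinearMap.mulLeft ℂ (c a)) b := by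
        simpa using hf
      rw [arcsineMoment_cons η b (by simp), pairSum_Ico ι f x _ hg, Finset.mul_sum]
      simp only [List.length_map, List.length_range']
      -- The vanishing term d = 0 is split off; d = e + 1 then corresponds to the partner i + 1 + e.
      rw [Finset.sum_range_succ']
      simp only [List.take_zero, arcsineMoment_nil, map_zero, mul_zero, zero_mul, smul_zero, add_zero]
      refine Finset.sum_congr rfl fun e he => ?_
      have he := Finset.mem_range.1 he
      rw [← List.map_take, ← List.map_drop, List.take_range'_of_length_ge (by omega),
        List.drop_range', List.range'_succ, List.map_cons, ih e (by omega),
        show m + 1 - (e + 1) = (m - e - 1) + 1 by omega, List.range'_succ, List.map_cons,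
        ih _ (by omega)]
      simp only [LinearMap.comp_apply, LinearMap.mulLeft_apply, LinearMap.mulRight_apply,
        ContinuousLinearMap.coe_coe, mul_smul_comm, mul_assoc, mul_one]
      rw [show i + (e + 1) = i + 1 + e by ring,
        show i + 1 + e + 1 + (m - e - 1) = i + (m + 1) by omega]
      push_cast
      ring_nf

end ArcsineMoment

namespace OVProbSpace

variable {B : Type u} [CStarAlgebra B] [PartialOrder B] [StarOrderedRing B]
  {A : Type v} [CStarAlgebra A] [PartialOrder A] [StarOrderedRing A]

lemma word_getD (P : OVProbSpace B A) (X : A) (l : List B) {n : ℕ} (hn : n < l.length + 1) :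
    (P.word X l).getD n 0 = X * P.ι ((l ++ [1]).getD n 1) := by
  unfold word
  rcases Nat.lt_or_ge n l.length with h | h
  · rw [List.getD_append _ _ _ _ (by simpa using h), List.getD_append _ _ _ _ h,
      List.getD_eq_getElem _ _ (by simpa using h), List.getD_eq_getElem _ _ h]
    simp
  · obtain rfl : n = l.length := by omega
    rw [List.getD_append_right _ _ _ _ (by simp), List.getD_append_right _ _ _ _ le_rfl]
    simp

/-- The sum over noncrossing pair partitions in the definition of arcsine elements. -/
lemma sum_NC₂_word (P : OVProbSpace B A) (η : B →L[ℂ] B) {X : A}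
    (hX : ∀ b, P.E (X * P.ι b * X) = η b) (l : List B) {n : ℕ} (hn : n = l.length + 1) :
    ∑ π ∈ NC₂ n,
      (1 / (treeFactorial π : ℂ)) • evalPartition P.ι (fun l' => P.E l'.prod) π (P.word X l) =
    arcsineMoment η (1 :: (l ++ [1])) := by
  subst hn
  set c : ℕ → B := fun n => (l ++ [1]).getD n 1
  have hc : (l ++ [1]) = (List.range' 0 (l.length + 1)).map c := by
    refine List.ext_getElem (by simp) fun n h1 h2 => ?_
    simp only [c, List.getElem_map, List.getElem_range', one_mul, zero_add]
    rw [List.getD_eq_getElem _ _ h1]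
  rw [hc, arcsineMoment_cons_map η P.ι (fun l' => P.E l'.prod) (fun n => X * P.ι (c n)) c,
    one_mul, zero_add, ← Finset.range_eq_Ico, pairSum,
    ← sum_NC₂ (fun m b => (1 / (m : ℂ)) •
      nestedEval P.ι (fun l' => P.E l'.prod) b (fun n => X * P.ι (c n)) _)]
  · refine Finset.sum_congr rfl fun π hπ => ?_
    rw [evalPartition]
    congr 1
    refine nestedEval_congr (fun _ _ => rfl) fun i hi g => ?_
    refine congrArg (fun L : List A => P.E L.prod) (List.map_congr_left fun v hv => ?_)
    rw [word_getD]
    exact Finset.mem_range.1 (π.subset (π.part_mem.2 hi) (by simpa using hv))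
  · intro m b b' h
    exact congrArg _ (nestedEval_congr h fun _ _ _ => rfl)
  · intro a d b
    have : X * P.ι (c a) * P.ι b * (X * P.ι (c d) * P.ι 1) =
        X * P.ι (c a * b) * X * P.ι (c d) := by simp [mul_assoc]
    simp only [List.prod_cons, List.prod_nil, mul_one]
    rw [this, P.E_right, hX]

/-- The definition only has outer coefficients 1; arbitrary ones factor out on both sides. -/
lemma IsArcsine.E_wordProd {P : OVProbSpace B A} {η : B →L[ℂ] B} {X : A} (h : P.IsArcsine η X)
    (l : List B) : P.E (P.wordProd X l) = arcsineMoment η l := by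
  cases l with
  | nil => simp [wordProd]
  | cons b l =>
    rcases List.eq_nil_or_concat l with rfl | ⟨l, c, rfl⟩
    · simp [wordProd, P.E_ι]
    · rw [List.concat_eq_append, OVProbSpace.E_wordProd, h.moment_eq, P.sum_NC₂_word η h.variance l rfl,
        show b :: (l ++ [c]) = (b :: l) ++ [c] from rfl, arcsineMoment_concat, List.cons_append,
        ← arcsineMoment_cons_mul]

/-! ### The fourth cumulant -/

lemma evalPartition_eq_zero (P : OVProbSpace B A) {n : ℕ} {f : List A → B}
    (hf : ∀ l, 0 ∈ l → f l = 0) (π : Finpartition (Finset.range n)) (l : List A) {v : ℕ}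
    (hv : v < n) (h : ∀ g : ℕ → B,
      f (((π.part v).sort (· ≤ ·)).map fun w => l.getD w 0 * P.ι (g w)) = 0) :
    evalPartition P.ι f π l = 0 := by
  refine nestedEval_eq_zero (map_zero _) hf (v := v) (fun u hu => π.mem_part hu)
    (Finset.mem_range.2 hv) fun u hu hvu g => ?_
  rw [← π.part_eq_of_mem (π.part_mem.2 hu) hvu]
  exact h g

lemma monotoneCumulant_eq_zero (P : OVProbSpace B A) {l : List A} (h : 0 ∈ l) :
    P.monotoneCumulant l = 0 := by
  induction hn : l.length using Nat.strong_induction_on generalizing l with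
  | _ n ih =>
    subst hn
    rw [monotoneCumulant, List.prod_eq_zero h, map_zero, zero_sub, neg_eq_zero]
    refine Finset.sum_eq_zero fun π _ => ?_
    obtain ⟨v, hv, hv0⟩ := List.mem_iff_getElem.1 h
    rw [P.evalPartition_eq_zero ?_ π l hv, smul_zero]
    · intro g
      split_ifs with hlt
      · refine ih _ hlt (List.mem_map.2 ⟨v, ?_, ?_⟩) rfl
        · simpa using hv
        · rw [List.getD_eq_getElem _ _ hv, hv0, zero_mul]
      · rfl
    · intro l' hl'
      split_ifs with hlt
      · exact ih _ hlt hl' rfl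
      · rfl

lemma monotoneCumulant_singleton (P : OVProbSpace B A) (a : A) :
    P.monotoneCumulant [a] = P.E a := by
  rw [monotoneCumulant, Finset.filter_false_of_mem, Finset.sum_empty, sub_zero, List.prod_singleton]
  intro π _ h
  refine h ?_
  have h0 : 0 ∈ Finset.range [a].length := by simp
  have : π.part 0 = Finset.range [a].length := by
    refine (π.subset (π.part_mem.2 h0)).antisymm fun i hi => ?_
    obtain rfl : i = 0 := by simpa using hi
    exact π.mem_part h0
  have hm := π.part_mem.2 h0
  rwa [this] at hm

section Centered

variable {P : OVProbSpace B A} {Y : A} {l : List A}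

/-- On a singleton block the cumulant is E[Y b] = E[Y] b = 0, and a zero on one block kills the
nested evaluation. -/
lemma evalPartition_eq_zero_of_singleton (hY : P.E Y = 0)
    (hl : ∀ v < l.length, ∃ b, l.getD v 0 = Y * P.ι b) (hl2 : 1 < l.length)
    (π : Finpartition (Finset.range l.length)) {v : ℕ} (hv : {v} ∈ π.parts) :
    evalPartition P.ι
      (fun l' => if _h : l'.length < l.length then P.monotoneCumulant l' else 0) π l = 0 := by
  have hvl : v < l.length := Finset.mem_range.1 (π.subset hv (Finset.mem_singleton_self v))
  refine P.evalPartition_eq_zero (fun l' hl' => ?_) π l hvl fun g => ?_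
  · split_ifs
    · exact P.monotoneCumulant_eq_zero hl'
    · rfl
  · obtain ⟨b, hb⟩ := hl v hvl
    rw [π.part_eq_of_mem hv (Finset.mem_singleton_self v), Finset.sort_singleton]
    simp only [List.map_cons, List.map_nil, List.length_singleton, hl2, dif_pos]
    rw [monotoneCumulant_singleton, hb, mul_assoc, ← map_mul, P.E_right, hY, zero_mul]

lemma monotoneCumulant_pair (hY : P.E Y = 0) (b c : B) :
    P.monotoneCumulant [Y * P.ι b, Y * P.ι c] = P.E (Y * P.ι b * (Y * P.ι c)) := by
  rw [monotoneCumulant, Finset.sum_eq_zero, sub_zero]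
  · simp
  intro π hπ
  obtain ⟨-, hπ⟩ := Finset.mem_filter.1 hπ
  have h0 : 0 ∈ Finset.range [Y * P.ι b, Y * P.ι c].length := by simp
  have hs := π.subset (π.part_mem.2 h0)
  have : π.part 0 = {0} := by
    refine (Finset.eq_singleton_iff_unique_mem.2 ⟨π.mem_part h0, fun i hi => ?_⟩)
    by_contra hi0
    refine hπ ?_
    have : π.part 0 = Finset.range [Y * P.ι b, Y * P.ι c].length := by
      refine hs.antisymm fun j hj => ?_
      have hi2 := Finset.mem_range.1 (hs hi)
      have hj2 := Finset.mem_range.1 hj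
      simp only [List.length_cons, List.length_nil] at hi2 hj2
      rcases Nat.eq_zero_or_pos j with rfl | hj
      · exact π.mem_part h0
      · obtain rfl : j = i := by omega
        exact hi
    have hm := π.part_mem.2 h0
    rwa [this] at hm
  rw [evalPartition_eq_zero_of_singleton hY ?_ (by simp) π (this ▸ π.part_mem.2 h0), smul_zero]
  intro v hv
  simp only [List.length_cons, List.length_nil] at hv
  interval_cases v
  · exact ⟨b, rfl⟩
  · exact ⟨c, rfl⟩

/-- The two terms are the two noncrossing pairings of four points; the nested one has tree factorial
2. -/
lemma arcsineMoment_four (η : B →L[ℂ] B) (b b' : B) :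
    arcsineMoment η [1, b, 1, b', 1] = η b * η b' + (1 / 2 : ℂ) • η (b * η 1 * b') := by
  have h2 : ∀ u v : B, arcsineMoment η [u, v] = 0 := fun u v =>
    arcsineMoment_eq_zero_of_even η (by simp; try decide)
  have h3 : ∀ u v w : B, arcsineMoment η [u, v, w] = u * η v * w := by
    intro u v w
    rw [arcsineMoment_cons η u (by simp)]
    simp [Finset.sum_range_succ]
    norm_num
  have h4 : ∀ u v w x : B, arcsineMoment η [u, v, w, x] = 0 := fun u v w x =>
    arcsineMoment_eq_zero_of_even η (by simp; try decide)
  rw [arcsineMoment_cons η 1 (by simp)]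
  simp [Finset.sum_range_succ, h2, h3]
  norm_num

/-- A partition of four points with at least two blocks is either a pairing or has a singleton,
since a block of size 3 leaves one point over. Singletons contribute nothing, and on pairs the
cumulant is the moment. -/
lemma monotoneCumulant_eq_sub_sum_NC₂ (hY : P.E Y = 0)
    (hl : ∀ v < l.length, ∃ b, l.getD v 0 = Y * P.ι b) (hlen : l.length = 4) :
    P.monotoneCumulant l = P.E l.prod - ∑ π ∈ NC₂ l.length,
      (1 / (treeFactorial π : ℂ)) • evalPartition P.ι (fun l' => P.E l'.prod) π l := by
  rw [monotoneCumulant]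
  congr 1
  symm
  refine (Finset.sum_congr rfl fun π hπ => ?_).trans
    (Finset.sum_subset (s₁ := NC₂ l.length) (fun π hπ => ?_) fun π hπ hπ' => ?_)
  · congr 1
    refine nestedEval_congr (fun _ _ => rfl) fun i hi g => ?_
    have hcard := (Finset.mem_filter.1 hπ).2 _ (π.part_mem.2 hi)
    obtain ⟨s, t, hst⟩ := List.length_eq_two.1
      ((Finset.length_sort (s := π.part i) (· ≤ ·)).trans hcard)
    have hmem : ∀ v ∈ [s, t], v < l.length := fun v hv => by
      rw [← hst] at hv
      exact Finset.mem_range.1 (π.subset (π.part_mem.2 hi) ((Finset.mem_sort _).1 hv))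
    obtain ⟨c, hc⟩ := hl s (hmem s (by simp))
    obtain ⟨c', hc'⟩ := hl t (hmem t (by simp))
    rw [hst]
    simp only [List.map_cons, List.map_nil, List.length_cons, List.length_nil]
    rw [dif_pos (by rw [hlen]; norm_num), hc, hc', mul_assoc Y, mul_assoc Y, ← map_mul, ← map_mul,
      monotoneCumulant_pair hY]
    simp
  · refine Finset.mem_filter.2 ⟨(Finset.mem_filter.1 hπ).1, fun h => ?_⟩
    have := (Finset.mem_filter.1 hπ).2 _ h
    simp [hlen] at this
  · rw [Finset.mem_filter] at hπ
    have : ∃ V ∈ π.parts, V.card ≠ 2 := by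
      by_contra! h
      exact hπ' (Finset.mem_filter.2 ⟨hπ.1, h⟩)
    obtain ⟨V, hV, hV2⟩ := this
    obtain ⟨v, hv⟩ : ∃ v, {v} ∈ π.parts := by
      have h1 := (π.nonempty_of_mem_parts hV).card_pos
      have h2 : V ⊂ Finset.range l.length :=
        (π.subset hV).ssubset_of_ne fun h => hπ.2 (h ▸ hV)
      have h3 := Finset.card_lt_card h2
      rw [Finset.card_range, hlen] at h3
      rcases (by omega : V.card = 1 ∨ V.card = 3) with h | h
      · obtain ⟨v, rfl⟩ := Finset.card_eq_one.1 h
        exact ⟨v, hV⟩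
      · obtain ⟨v, hv, hvV⟩ := Finset.exists_of_ssubset h2
        have hd : Disjoint V (π.part v) := π.disjoint hV (π.part_mem.2 hv) fun h =>
          hvV (h ▸ π.mem_part hv)
        have h4 := Finset.card_le_card
          (Finset.union_subset (π.subset hV) (π.subset (π.part_mem.2 hv)))
        rw [Finset.card_union_of_disjoint hd, Finset.card_range] at h4
        have h5 := Finset.card_pos.2 ⟨v, π.mem_part hv⟩
        obtain ⟨w, hw⟩ := Finset.card_eq_one.1 (by omega : (π.part v).card = 1)
        exact ⟨w, hw ▸ π.part_mem.2 hv⟩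
    rw [evalPartition_eq_zero_of_singleton hY hl (by rw [hlen]; norm_num) π hv, smul_zero]

/-- The fourth cumulant of a centered element is the excess of its fourth moment over that of an
arcsine element with the same variance. It thus measures the distance to the arcsine law. -/
lemma monotoneCumulant_four (η : B →L[ℂ] B) (hY : P.E Y = 0)
    (hη : ∀ b, P.E (Y * P.ι b * Y) = η b) (b b' : B) :
    P.monotoneCumulant [Y * P.ι b, Y, Y * P.ι b', Y] =
      P.E (Y * P.ι b * Y * Y * P.ι b' * Y) -
        (η b * η b' + (1 / 2 : ℂ) • η (b * η 1 * b')) := by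
  have hw : [Y * P.ι b, Y, Y * P.ι b', Y] = P.word Y [b, 1, b'] := by simp [word]
  have hlen : (P.word Y [b, 1, b']).length = [b, 1, b'].length + 1 := by simp [word]
  rw [hw, monotoneCumulant_eq_sub_sum_NC₂ hY
    (fun v hv => ⟨_, P.word_getD Y _ (hlen ▸ hv)⟩) hlen, P.sum_NC₂_word η hη _ hlen,
    ← arcsineMoment_four]
  congr 2
  simp [word, mul_assoc]

lemma norm_fourth_correction_le (η : B →L[ℂ] B) (b b' : B) :
    ‖η b * η b'‖ ≤ ‖η‖ ^ 2 * (‖b‖ * ‖b'‖) ∧ ‖η (b * η 1 * b')‖ ≤ ‖η‖ ^ 2 * (‖b‖ * ‖b'‖) := by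
  have h1 : ‖(1 : B)‖ ≤ 1 := by
    rcases subsingleton_or_nontrivial B with h | h
    · simp [Subsingleton.elim (1 : B) 0]
    · exact CStarRing.norm_one.le
  constructor
  · calc ‖η b * η b'‖ ≤ (‖η‖ * ‖b‖) * (‖η‖ * ‖b'‖) :=
          (norm_mul_le _ _).trans (by gcongr <;> exact η.le_opNorm _)
      _ = _ := by ring
  · calc ‖η (b * η 1 * b')‖ ≤ ‖η‖ * (‖b‖ * (‖η‖ * 1) * ‖b'‖) := by
          refine (η.le_opNorm _).trans ?_
          gcongr
          refine (norm_mul_le _ _).trans ?_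
          gcongr
          refine (norm_mul_le _ _).trans ?_
          gcongr
          refine (η.le_opNorm _).trans ?_
          gcongr
      _ = _ := by ring

lemma bddAbove_fourthCumulantNorms (η : B →L[ℂ] B) (hY : P.E Y = 0)
    (hη : ∀ b, P.E (Y * P.ι b * Y) = η b) : BddAbove (P.fourthCumulantNorms Y) := by
  let EL : A →L[ℂ] B := ⟨P.E.toLinearMap, P.continuous_E⟩
  refine ⟨‖EL‖ * ‖Y‖ ^ 4 + 2 * ‖η‖ ^ 2, ?_⟩
  rintro _ ⟨b, b', hb, hb', rfl⟩
  rw [monotoneCumulant_four η hY hη]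
  have hι : ∀ d, ‖P.ι d‖ ≤ ‖d‖ := NonUnitalStarAlgHom.norm_apply_le P.ι
  have h1 : ‖Y * P.ι b * Y * Y * P.ι b' * Y‖ ≤ ‖Y‖ * 1 * ‖Y‖ * ‖Y‖ * 1 * ‖Y‖ := by
    repeat' refine (norm_mul_le _ _).trans ?_; gcongr
    · exact (hι b).trans hb.le
    · exact (hι b').trans hb'.le
  have h2 : ‖P.E (Y * P.ι b * Y * Y * P.ι b' * Y)‖ ≤ ‖EL‖ * ‖Y‖ ^ 4 := by
    refine (EL.le_opNorm _).trans ?_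
    gcongr
    exact h1.trans_eq (by ring)
  obtain ⟨h3, h4⟩ := norm_fourth_correction_le η b b'
  rw [hb, hb'] at h3 h4
  refine (norm_sub_le _ _).trans (add_le_add h2 ((norm_add_le _ _).trans ?_))
  rw [norm_smul]
  norm_num at h3 h4 ⊢
  nlinarith [sq_nonneg ‖η‖]

/-- Homogeneity reduces to ‖b‖ = 1, where the supremum applies. The choice b' = b⋆ is the one
produced by Cauchy-Schwarz. -/
lemma norm_monotoneCumulant_star_le (η : B →L[ℂ] B) (hY : P.E Y = 0)
    (hη : ∀ b, P.E (Y * P.ι b * Y) = η b) (b : B) :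
    ‖P.monotoneCumulant [Y * P.ι b, Y, Y * P.ι (star b), Y]‖ ≤
      sSup (P.fourthCumulantNorms Y) * ‖b‖ ^ 2 := by
  rcases eq_or_ne b 0 with rfl | hb
  · rw [P.monotoneCumulant_eq_zero (by simp)]
    simp
  have hb' : (‖b‖ : ℂ) ≠ 0 := by simpa using hb
  obtain ⟨u, hu, hbu⟩ : ∃ u : B, ‖u‖ = 1 ∧ b = (‖b‖ : ℂ) • u :=
    ⟨(‖b‖ : ℂ)⁻¹ • b, by simp [norm_smul, hb], by rw [smul_smul, mul_inv_cancel₀ hb', one_smul]⟩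
  have key : P.monotoneCumulant [Y * P.ι b, Y, Y * P.ι (star b), Y] =
      ((‖b‖ : ℂ) ^ 2) • P.monotoneCumulant [Y * P.ι u, Y, Y * P.ι (star u), Y] := by
    rw [monotoneCumulant_four η hY hη, monotoneCumulant_four η hY hη]
    have hr : star (‖b‖ : ℂ) = ‖b‖ := Complex.conj_ofReal _
    generalize (‖b‖ : ℂ) = r at hbu hr
    subst hbu
    simp only [star_smul, hr, map_smul, mul_smul_comm, smul_mul_assoc, smul_smul, smul_sub,
      smul_add]
    ring_nf
  have hnorm : ‖(‖b‖ : ℂ) ^ 2‖ = ‖b‖ ^ 2 := by simp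
  rw [key, norm_smul, hnorm, mul_comm]
  gcongr
  exact le_csSup (bddAbove_fourthCumulantNorms η hY hη) ⟨u, star u, hu, by simpa using hu, rfl⟩

end Centered

/-- The fourth moments of the summands of a centered monotone `n`-divisible element are controlled
by the fourth cumulant. -/
lemma norm_summand_fourth_moment_le {C : Type w} [CStarAlgebra C] [PartialOrder C]
    [StarOrderedRing C] {P : OVProbSpace B A} {Q : OVProbSpace B C} {Y : A} {n : ℕ} {y : Fin n → C}
    (η : B →L[ℂ] B) (hn : 0 < n) (hy : ∀ i, IsSelfAdjoint (y i))
    (hMI : Q.MonotoneIndependent fun i => Q.bimoduleAlgebra (y i))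
    (hid : ∀ i j, Q.SameDistribution (y i) Q (y j))
    (hsum : P.SameDistribution Y Q (∑ i, y i)) (hmean : P.E Y = 0)
    (hvar : ∀ b, P.E (Y * P.ι b * Y) = η b) (i : Fin n) (b : B) :
    ‖Q.E (y i * Q.ι b * y i * y i * Q.ι (star b) * y i)‖ ≤
      (n : ℝ)⁻¹ * (sSup (P.fourthCumulantNorms Y) + 3 / 2 * ‖η‖ ^ 2 * (n : ℝ)⁻¹) * ‖b‖ ^ 2 := by
  have hn0 : (n : ℂ) ≠ 0 := by exact_mod_cast hn.ne'
  obtain ⟨h3, h4⟩ := norm_fourth_correction_le η b (star b)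
  have h5 := norm_monotoneCumulant_star_le η hmean hvar b
  rw [monotoneCumulant_four η hmean hvar] at h5
  rw [(summand_moments hn hy hMI hid hsum hmean hvar i).2.2 b (star b)]
  set M := P.E (Y * P.ι b * Y * Y * P.ι (star b) * Y)
  set u := η b * η (star b)
  set v := η (b * η 1 * star b)
  -- Since (n - 1)/(2n) = 1/2 - 1/(2n), the main part is exactly the fourth cumulant; the remainder
  -- has norm at most 3‖η‖²‖b‖²/(2n).
  have : M - ((n - 1) / (2 * n) : ℂ) • ((2 : ℂ) • u + v) =
      M - (u + (1 / 2 : ℂ) • v) + ((1 / 2 : ℂ) * (n : ℂ)⁻¹) • ((2 : ℂ) • u + v) := by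
    simp only [smul_add, smul_smul, sub_eq_add_neg, add_assoc, neg_add, ← neg_smul]
    congr 1
    rw [show (-((n + -1) / (2 * n) * 2) : ℂ) = -1 + (1 / 2 * (n : ℂ)⁻¹ * 2) by field_simp; ring,
      show (-((n + -1) / (2 * n)) : ℂ) = -(1 / 2) + (1 / 2 * (n : ℂ)⁻¹) by field_simp; ring,
      add_smul, add_smul, neg_one_smul]
    abel
  rw [this, norm_smul, norm_inv, Complex.norm_natCast, mul_assoc]
  gcongr
  refine (norm_add_le _ _).trans ?_
  rw [add_mul]
  gcongr
  rw [norm_smul, norm_mul, norm_inv, Complex.norm_natCast]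
  have h6 : ‖(2 : ℂ) • u + v‖ ≤ 3 * (‖η‖ ^ 2 * ‖b‖ ^ 2) := by
    refine (norm_add_le _ _).trans ?_
    rw [norm_smul]
    simp only [norm_star, ← pow_two] at h3 h4
    norm_num
    linarith
  calc ‖(1 / 2 : ℂ)‖ * (n : ℝ)⁻¹ * ‖(2 : ℂ) • u + v‖
      ≤ (1 / 2) * (n : ℝ)⁻¹ * (3 * (‖η‖ ^ 2 * ‖b‖ ^ 2)) := by
        gcongr
        norm_num
    _ = _ := by ring

end OVProbSpace

/-! ### The expansion of the Cauchy transform of an arcsine element -/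

section ArcsineTerm

variable {D : Type*} [NormedRing D] [NormedAlgebra ℂ D] (η : D →L[ℂ] D) (β : D)

/-- The term of degree `2p` in the expansion of the Cauchy transform, as a function of the inverse
`β` of its argument. -/
noncomputable def arcsineTerm : ℕ → D
  | 0 => β
  | p + 1 => ∑ q : Fin (p + 1),
      (1 / ((q : ℂ) + 1)) • (β * η (arcsineTerm q) * arcsineTerm (p - q))
termination_by p => p
decreasing_by all_goals omega

@[simp] lemma arcsineTerm_zero : arcsineTerm η β 0 = β := by rw [arcsineTerm]

lemma arcsineTerm_succ (p : ℕ) : arcsineTerm η β (p + 1) = ∑ x ∈ Finset.HasAntidiagonal.antidiagonal p,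
    (1 / ((x.1 : ℂ) + 1)) • (β * η (arcsineTerm η β x.1) * arcsineTerm η β x.2) := by
  rw [arcsineTerm, Finset.Nat.sum_antidiagonal_eq_sum_range_succ_mk, Finset.sum_range]

lemma arcsineTerm_smul (t : ℂ) (p : ℕ) :
    arcsineTerm (t • η) β p = t ^ p • arcsineTerm η β p := by
  induction p using Nat.strong_induction_on with
  | _ p ih =>
    cases p with
    | zero => simp
    | succ p =>
      rw [arcsineTerm_succ, arcsineTerm_succ, Finset.smul_sum]
      refine Finset.sum_congr rfl fun x hx => ?_
      have hx := Finset.HasAntidiagonal.mem_antidiagonal.1 hx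
      rw [ih _ (by omega), ih _ (by omega), smul_apply, map_smul]
      simp only [mul_smul_comm, smul_mul_assoc, smul_smul]
      congr 1
      rw [← hx, pow_succ, pow_add]
      ring

/-- The derivative of `arcsineTerm η · p` in the direction `c`. -/
noncomputable def arcsineTermDeriv (c : D) : ℕ → D
  | 0 => c
  | p + 1 => ∑ q : Fin (p + 1), (1 / ((q : ℂ) + 1)) •
      (c * η (arcsineTerm η β q) * arcsineTerm η β (p - q) +
        β * η (arcsineTermDeriv c q) * arcsineTerm η β (p - q) +
        β * η (arcsineTerm η β q) * arcsineTermDeriv c (p - q))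
termination_by p => p
decreasing_by all_goals omega

@[simp] lemma arcsineTermDeriv_zero (c : D) : arcsineTermDeriv η β c 0 = c := by
  rw [arcsineTermDeriv]

lemma arcsineTermDeriv_succ (c : D) (p : ℕ) :
    arcsineTermDeriv η β c (p + 1) = ∑ x ∈ Finset.HasAntidiagonal.antidiagonal p, (1 / ((x.1 : ℂ) + 1)) •
      (c * η (arcsineTerm η β x.1) * arcsineTerm η β x.2 +
        β * η (arcsineTermDeriv η β c x.1) * arcsineTerm η β x.2 +
        β * η (arcsineTerm η β x.1) * arcsineTermDeriv η β c x.2) := by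
  rw [arcsineTermDeriv, Finset.Nat.sum_antidiagonal_eq_sum_range_succ_mk, Finset.sum_range]

lemma hasDerivAt_arcsineTerm (c : D) (p : ℕ) :
    HasDerivAt (fun s : ℂ => arcsineTerm η (β + s • c) p) (arcsineTermDeriv η β c p) 0 := by
  have h0 : HasDerivAt (fun s : ℂ => β + s • c) c 0 := by
    simpa using ((hasDerivAt_id (0 : ℂ)).smul_const c).const_add β
  induction p using Nat.strong_induction_on with
  | _ p ih =>
    cases p with
    | zero => simpa using h0
    | succ p =>
      simp only [arcsineTerm_succ, arcsineTermDeriv_succ]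
      refine HasDerivAt.fun_sum fun x hx => ?_
      have hx := Finset.HasAntidiagonal.mem_antidiagonal.1 hx
      have h1 := ih x.1 (by omega)
      have h2 := ih x.2 (by omega)
      have h3 := ((h0.mul (η.hasFDerivAt.comp_hasDerivAt 0 h1)).mul h2).const_smul
        (1 / ((x.1 : ℂ) + 1))
      exact h3.congr_deriv (by simp [add_mul])

/-- Differentiating the expansion in the direction `β η(β) β` amounts to a shift of the degree. -/
lemma arcsineTermDeriv_eq (p : ℕ) :
    arcsineTermDeriv η β (β * η β * β) p = ((p : ℂ) + 1) • arcsineTerm η β (p + 1) := by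
  induction p using Nat.strong_induction_on with
  | _ p ih =>
    cases p with
    | zero => simp [arcsineTerm_succ]
    | succ p =>
      set X : ℕ × ℕ → D := fun x => β * η (arcsineTerm η β x.1) * arcsineTerm η β x.2 with hX
      -- The product rule gives three sums. Together they put the weight 1 + r/(q + 1) on X (q, r)
      -- for q + r = p + 1, and this equals (p + 2)/(q + 1).
      have h1 : ∑ x ∈ Finset.HasAntidiagonal.antidiagonal p, (1 / ((x.1 : ℂ) + 1)) •
          (β * η β * β * η (arcsineTerm η β x.1) * arcsineTerm η β x.2) = X (0, p + 1) := by
        simp only [hX, arcsineTerm_zero, arcsineTerm_succ, Finset.mul_sum, mul_smul_comm, mul_assoc]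
      have h2 : ∑ x ∈ Finset.HasAntidiagonal.antidiagonal p, (1 / ((x.1 : ℂ) + 1)) •
          (β * η (arcsineTermDeriv η β (β * η β * β) x.1) * arcsineTerm η β x.2) =
          ∑ x ∈ Finset.HasAntidiagonal.antidiagonal p, X (x.1 + 1, x.2) := by
        refine Finset.sum_congr rfl fun x hx => ?_
        have hx := Finset.HasAntidiagonal.mem_antidiagonal.1 hx
        have hne : ((x.1 : ℂ) + 1) ≠ 0 := by exact_mod_cast Nat.succ_ne_zero x.1
        rw [ih x.1 (by omega), map_smul, mul_smul_comm, smul_mul_assoc, smul_smul,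
          one_div_mul_cancel hne, one_smul]
      have h3 : ∑ x ∈ Finset.HasAntidiagonal.antidiagonal p, (1 / ((x.1 : ℂ) + 1)) •
          (β * η (arcsineTerm η β x.1) * arcsineTermDeriv η β (β * η β * β) x.2) =
          ∑ x ∈ Finset.HasAntidiagonal.antidiagonal (p + 1), ((x.2 : ℂ) / ((x.1 : ℂ) + 1)) • X x := by
        rw [Finset.Nat.sum_antidiagonal_succ']
        simp only [Nat.cast_zero, zero_div, zero_smul, zero_add]
        refine Finset.sum_congr rfl fun x hx => ?_
        have hx := Finset.HasAntidiagonal.mem_antidiagonal.1 hx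
        rw [ih x.2 (by omega), mul_smul_comm, smul_smul]
        push_cast
        congr 1
        ring
      rw [arcsineTermDeriv_succ]
      simp only [smul_add, Finset.sum_add_distrib]
      rw [h1, h2, h3, ← Finset.Nat.sum_antidiagonal_succ (f := X), ← Finset.sum_add_distrib,
        arcsineTerm_succ, Finset.smul_sum]
      refine Finset.sum_congr rfl fun x hx => ?_
      have hx := Finset.HasAntidiagonal.mem_antidiagonal.1 hx
      have hne : ((x.1 : ℂ) + 1) ≠ 0 := by exact_mod_cast Nat.succ_ne_zero x.1
      rw [smul_smul, ← one_smul ℂ (X x), smul_smul, ← add_smul, hX]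
      congr 1
      have : ((p + 1 : ℕ) : ℂ) = x.1 + x.2 := by exact_mod_cast hx.symm
      rw [this]
      field_simp
      ring

end ArcsineTerm

section Word

variable {M : Type*} [NormedRing M] [NormedAlgebra ℂ M] (x β : M)

lemma hasDerivAt_mul_pow_mul (c : M) (n : ℕ) :
    HasDerivAt (fun s : ℂ => ((β + s • c) * x) ^ n * (β + s • c))
      (∑ y ∈ Finset.HasAntidiagonal.antidiagonal n, (β * x) ^ y.1 * c * (x * β) ^ y.2) 0 := by
  have h0 : HasDerivAt (fun s : ℂ => β + s • c) c 0 := by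
    simpa using ((hasDerivAt_id (0 : ℂ)).smul_const c).const_add β
  induction n with
  | zero => simpa using h0
  | succ n ih =>
    have h1 := (h0.mul_const x).mul ih
    simp only [zero_smul, add_zero] at h1
    have h2 : (fun s : ℂ => ((β + s • c) * x) ^ (n + 1) * (β + s • c)) =
        (fun s : ℂ => (β + s • c) * x) * fun s : ℂ => ((β + s • c) * x) ^ n * (β + s • c) := by
      ext s
      simp [pow_succ', mul_assoc]
    rw [h2]
    convert h1 using 1
    rw [Finset.Nat.sum_antidiagonal_succ, Finset.mul_sum]
    congr 1
    · rw [pow_zero, one_mul, pow_succ', mul_assoc, mul_assoc, mul_pow_mul]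
    · simp only [pow_succ', mul_assoc]

end Word

/-! ### Differentiated moment identities for arcsine elements -/

namespace CondExp

variable {D M : Type*} [CStarAlgebra D] [PartialOrder D] [StarOrderedRing D]
    [CStarAlgebra M] [PartialOrder M] [StarOrderedRing M] (𝔼 : CondExp D M)

/-- The covariance `d ↦ E[x d x]` of an element. -/
noncomputable def covar (x : M) : D →L[ℂ] D :=
  𝔼.toCLM ∘L ((ContinuousLinearMap.mul ℂ M).flip x ∘L ContinuousLinearMap.mul ℂ M x) ∘L
    ⟨𝔼.ι.toAlgHom.toLinearMap, 𝔼.continuous_ι⟩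

lemma covar_apply (x : M) (d : D) : 𝔼.covar x d = 𝔼.E (x * 𝔼.ι d * x) := rfl

/-- The moments `E[(β x)ⁿ β]` are those of an arcsine element of variance `η`. -/
def HasArcsineMoments (η : D →L[ℂ] D) (x : M) : Prop :=
  ∀ (β : D) (n : ℕ), 𝔼.E ((𝔼.ι β * x) ^ n * 𝔼.ι β) =
    if Even n then arcsineTerm η β (n / 2) else 0

variable {𝔼} {η : D →L[ℂ] D} {x : M}

lemma HasArcsineMoments.smul (h : 𝔼.HasArcsineMoments η x) (u : ℂ) :
    𝔼.HasArcsineMoments (u ^ 2 • η) (u • x) := by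
  intro β n
  rw [mul_smul_comm, smul_pow, smul_mul_assoc, map_smul, h]
  split_ifs with hn
  · obtain ⟨m, rfl⟩ := hn
    rw [arcsineTerm_smul, ← pow_mul]
    congr 2
    omega
  · simp

/-- The moment formula holds for every β, so it may be differentiated in the direction β η(β) β. On
the left this inserts η(β) at each position; on the right it raises the degree, by
`arcsineTermDeriv_eq`. -/
lemma HasArcsineMoments.E_antidiagonal (h : 𝔼.HasArcsineMoments η x) (β : D) (n : ℕ) :
    ((n : ℂ) + 2) • 𝔼.E ((𝔼.ι β * x) ^ (n + 2) * 𝔼.ι β) =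
      (2 : ℂ) • ∑ y ∈ Finset.HasAntidiagonal.antidiagonal n, 𝔼.E (((𝔼.ι β * x) ^ y.1 * 𝔼.ι β) *
        𝔼.ι (η β) * ((𝔼.ι β * x) ^ y.2 * 𝔼.ι β)) := by
  set c := β * η β * β
  have h1 := (𝔼.toCLM.hasFDerivAt.comp_hasDerivAt 0
    (hasDerivAt_mul_pow_mul x (𝔼.ι β) (𝔼.ι c) n))
  have h2 : (𝔼.toCLM ∘ fun s : ℂ => ((𝔼.ι β + s • 𝔼.ι c) * x) ^ n * (𝔼.ι β + s • 𝔼.ι c)) =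
      fun s : ℂ => if Even n then arcsineTerm η (β + s • c) (n / 2) else 0 := by
    ext s
    rw [← h]
    simp
  rw [h2] at h1
  have h3 : ∑ y ∈ Finset.HasAntidiagonal.antidiagonal n, 𝔼.E (((𝔼.ι β * x) ^ y.1 * 𝔼.ι β) *
        𝔼.ι (η β) * ((𝔼.ι β * x) ^ y.2 * 𝔼.ι β)) =
      if Even n then arcsineTermDeriv η β c (n / 2) else 0 := by
    have h4 : HasDerivAt (fun s : ℂ => if Even n then arcsineTerm η (β + s • c) (n / 2) else 0)
        (if Even n then arcsineTermDeriv η β c (n / 2) else 0) 0 := by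
      split_ifs
      · exact hasDerivAt_arcsineTerm η β c _
      · exact hasDerivAt_const _ _
    rw [← h1.unique h4, toCLM_apply, map_sum]
    refine Finset.sum_congr rfl fun y _ => congrArg 𝔼.E ?_
    rw [mul_pow_mul (𝔼.ι β) x y.2]
    simp only [c, map_mul, mul_assoc]
  rw [h3, h]
  simp only [Nat.even_add, even_two, iff_true]
  split_ifs with hn
  · obtain ⟨m, rfl⟩ := hn
    rw [arcsineTermDeriv_eq, smul_smul, show (m + m) / 2 = m by omega,
      show (m + m + 2) / 2 = m + 1 by omega]
    push_cast
    congr 1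
    ring
  · simp

end CondExp

-- Summed over paths, the recursion for words becomes the recursion for matrices. Odd inner degrees
-- vanish, and for inner degree 2q the weight 2/(2q + 2) is the 1/(q + 1) of `arcsineTerm`.
open CStarMatrix in
lemma pathSum_arcsineMoment {B : Type*} [CStarAlgebra B] [PartialOrder B] [StarOrderedRing B]
    {k : ℕ} (η : B →L[ℂ] B)
    (ηk : CStarMatrix (Fin k) (Fin k) B →L[ℂ] CStarMatrix (Fin k) (Fin k) B)
    (hη : ∀ d i j, ηk d i j = η (d i j)) {b : Fin k → Fin k → B} {β : CStarMatrix (Fin k) (Fin k) B}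
    (hb : ∀ i j, b i j = β i j) (n : ℕ) (i j : Fin k) :
    pathSum b n (arcsineMoment η) i j =
      (if Even n then arcsineTerm ηk β (n / 2) else 0 : CStarMatrix (Fin k) (Fin k) B) i j := by
  induction n using Nat.strong_induction_on generalizing i j with
  | _ n ih =>
    rcases Nat.even_or_odd n with hn | hn
    swap
    · rw [if_neg (Nat.not_even_iff_odd.2 hn), pathSum_congr b (g' := fun _ => 0), pathSum_zero]
      · rfl
      · intro l hl
        exact arcsineMoment_eq_zero_of_even η (by rw [hl]; exact hn.add_one)
    obtain ⟨p, rfl⟩ := hn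
    rcases p with _ | p
    · simp [pathSum, hb]
    rw [if_pos ⟨_, rfl⟩, show (p + 1 + (p + 1)) / 2 = p + 1 by omega, arcsineTerm_succ,
      CStarMatrix.sum_apply, Finset.Nat.sum_antidiagonal_eq_sum_range_succ_mk,
      show p + 1 + (p + 1) = (2 * p + 1) + 1 by ring, pathSum]
    have key : ∀ c, pathSum b (2 * p + 1) (fun l => arcsineMoment η (b i c :: l)) c j =
        ∑ e ∈ Finset.range (2 * p + 1), ∑ c', ((2 : ℂ) / ((e : ℂ) + 2)) •
          (b i c * η (pathSum b e (arcsineMoment η) c c')) *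
          pathSum b (2 * p - e) (arcsineMoment η) c' j := by
      intro c
      rw [pathSum_congr b (g' := fun l => ∑ e ∈ Finset.range (2 * p + 1),
        (fun l => ((2 : ℂ) / ((e : ℂ) + 2)) • (b i c * η (arcsineMoment η l))) (l.take (e + 1)) *
          arcsineMoment η (l.drop (e + 1))), pathSum_sum]
      · refine Finset.sum_congr rfl fun e he => ?_
        have he := Finset.mem_range.1 he
        obtain ⟨m, hm⟩ : ∃ m, 2 * p + 1 = e + 1 + m := ⟨2 * p - e, by omega⟩
        rw [hm, pathSum_split b e m (fun l => ((2 : ℂ) / ((e : ℂ) + 2)) •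
          (b i c * η (arcsineMoment η l))) (arcsineMoment η), show 2 * p - e = m by omega]
        refine Finset.sum_congr rfl fun c' _ => ?_
        congr 1
        let f : B →+ B := (((2 : ℂ) / ((e : ℂ) + 2)) •
          (LinearMap.mulLeft ℂ (b i c) ∘ₗ η.toLinearMap)).toAddMonoidHom
        exact (map_pathSum b f e _ c c').symm
      · intro l hl
        rw [arcsineMoment_cons η _ (by rintro rfl; simp at hl), hl, Finset.sum_range_succ']
        simp only [List.take_zero, arcsineMoment_nil, map_zero, mul_zero, zero_mul, smul_zero,
          add_zero, smul_mul_assoc]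
        refine Finset.sum_congr rfl fun e _ => ?_
        push_cast
        ring_nf
    simp only [key]
    rw [Finset.sum_comm]
    set f : ℕ → B := fun e => ∑ c, ∑ c', ((2 : ℂ) / ((e : ℂ) + 2)) •
      (b i c * η (pathSum b e (arcsineMoment η) c c')) *
        pathSum b (2 * p - e) (arcsineMoment η) c' j with hf
    have hodd : ∀ e, Odd e → e < 2 * p + 1 → f e = 0 := by
      intro e he hlt
      refine Finset.sum_eq_zero fun c _ => Finset.sum_eq_zero fun c' _ => ?_
      rw [ih e (by omega), if_neg (Nat.not_even_iff_odd.2 he), CStarMatrix.zero_apply]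
      simp
    have hsum : ∀ q, q ≤ p → ∑ e ∈ Finset.range (2 * q + 1), f e =
        ∑ e ∈ Finset.range (q + 1), f (2 * e) := by
      intro q hq
      induction q with
      | zero => simp
      | succ q ihq =>
        rw [Finset.sum_range_succ _ (q + 1), ← ihq (by omega), show 2 * (q + 1) + 1 =
          2 * q + 1 + 1 + 1 by ring, Finset.sum_range_succ, Finset.sum_range_succ _ (2 * q + 1),
          hodd (2 * q + 1) ⟨q, rfl⟩ (by omega), add_zero]
        rfl
    rw [hsum p le_rfl]
    refine Finset.sum_congr rfl fun q hq => ?_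
    have hq := Finset.mem_range.1 hq
    have h1 : ∀ c c', pathSum b (2 * q) (arcsineMoment η) c c' = arcsineTerm ηk β q c c' := by
      intro c c'
      rw [ih _ (by omega), if_pos (even_two_mul q), Nat.mul_div_cancel_left _ two_pos]
    have h2 : ∀ c, pathSum b (2 * p - 2 * q) (arcsineMoment η) c j =
        arcsineTerm ηk β (p - q) c j := by
      intro c
      rw [← Nat.mul_sub, ih _ (by omega), if_pos (even_two_mul _),
        Nat.mul_div_cancel_left _ two_pos]
    rw [hf, CStarMatrix.smul_apply, CStarMatrix.mul_apply]
    simp only [h1, h2, CStarMatrix.mul_apply, hη, hb, Finset.sum_mul, Finset.smul_sum, smul_mul_assoc]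
    rw [Finset.sum_comm]
    refine Finset.sum_congr rfl fun c _ => Finset.sum_congr rfl fun c' _ => ?_
    congr 1
    push_cast
    rw [show (2 * (q : ℂ) + 2) = 2 * (q + 1) by ring, div_mul_eq_div_div, div_self two_ne_zero]

namespace OVProbSpace

open CStarMatrix

variable {B : Type u} [CStarAlgebra B] [PartialOrder B] [StarOrderedRing B]
  {A : Type v} [CStarAlgebra A] [PartialOrder A] [StarOrderedRing A] {P : OVProbSpace B A}

lemma amp_covar_apply {x : A} {k : ℕ} (d : CStarMatrix (Fin k) (Fin k) B) (i j : Fin k) :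
    (P.amp k).covar (diagHom A k x) d i j = P.E (x * P.ι (d i j) * x) := by
  rw [CondExp.covar_apply, amp_E_apply, mul_diagHom_apply, diagHom_mul_apply, amp_ι_apply]

lemma IsArcsine.hasArcsineMoments {η : B →L[ℂ] B} {X : A} (h : P.IsArcsine η X) {k : ℕ}
    {ηk : CStarMatrix (Fin k) (Fin k) B →L[ℂ] CStarMatrix (Fin k) (Fin k) B}
    (hη : ∀ d i j, ηk d i j = η (d i j)) :
    (P.amp k).HasArcsineMoments ηk (diagHom A k X) := by
  intro β n
  ext i j
  refine (P.amp_E_pow_apply X β n i j).trans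
    (.trans ?_ (pathSum_arcsineMoment η ηk hη (b := fun i j => β i j) (fun _ _ => rfl) n i j))
  exact pathSum_congr _ (fun l _ => h.E_wordProd l) i j

end OVProbSpace

/-! ### The resolvent of an arcsine element -/

section Neumann

variable {M : Type*} [NormedRing M] [CompleteSpace M] {v x : M}

lemma summable_norm_neumann (h : ‖Ring.inverse v * x‖ < 1) :
    Summable fun n : ℕ => ‖(Ring.inverse v * x) ^ n * Ring.inverse v‖ :=
  .of_nonneg_of_le (fun _ => norm_nonneg _) (fun _ => norm_mul_le _ _)
    ((summable_norm_geometric_of_norm_lt_one h).mul_right _)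

lemma tsum_neumann (hv : IsUnit v) (h : ‖Ring.inverse v * x‖ < 1) :
    ∑' n : ℕ, (Ring.inverse v * x) ^ n * Ring.inverse v = Ring.inverse (v - x) := by
  have hv1 := Ring.mul_inverse_cancel _ hv
  have hv2 := Ring.inverse_mul_cancel _ hv
  have hfac : v - x = v * (1 - Ring.inverse v * x) := by
    rw [mul_sub, mul_one, ← mul_assoc, hv1, one_mul]
  rw [(summable_geometric_of_norm_lt_one h).tsum_mul_right, hfac]
  refine (Ring.inverse_eq_of_mul_eq_one ?_ ?_).symm
  · rw [mul_assoc, ← mul_assoc (1 - _), mul_neg_geom_series _ h, one_mul, hv1]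
  · rw [mul_assoc, ← mul_assoc (Ring.inverse v), hv2, one_mul, geom_series_mul_neg _ h]

end Neumann

namespace CondExp

variable {D M : Type*} [CStarAlgebra D] [PartialOrder D] [StarOrderedRing D]
    [CStarAlgebra M] [PartialOrder M] [StarOrderedRing M] {𝔼 : CondExp D M}
    {η : D →L[ℂ] D} {x : M}

/-- With u_n = (βx)ⁿβ and R = ∑ u_n, the Cauchy products are RxR = ∑ (n + 1) u_{n+1} and R η(β) R =
∑ u_a η(β) u_b. Their expectations match degree by degree by `E_antidiagonal`, the first moment
being zero. -/
lemma HasArcsineMoments.resolvent_identity_of_norm_lt (h : 𝔼.HasArcsineMoments η x) {w : D}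
    (hw : IsUnit w) (hlt : ‖Ring.inverse w‖ * ‖x‖ < 1) :
    𝔼.E (𝔼.resolvent x w * x * 𝔼.resolvent x w) =
      (2 : ℂ) • 𝔼.E (𝔼.resolvent x w * 𝔼.ι (η (Ring.inverse w)) * 𝔼.resolvent x w) := by
  set β := Ring.inverse w with hβ
  have hβι : Ring.inverse (𝔼.ι w) = 𝔼.ι β := Ring.map_inverse_of_isUnit 𝔼.ι hw
  have hlt' : ‖Ring.inverse (𝔼.ι w) * x‖ < 1 := by
    rw [hβι]
    exact ((norm_mul_le _ _).trans (by gcongr; exact 𝔼.norm_ι_le β)).trans_lt hlt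
  set u : ℕ → M := fun n => (𝔼.ι β * x) ^ n * 𝔼.ι β with hu
  have hsum : Summable fun n => ‖u n‖ := by
    simpa only [hβι] using summable_norm_neumann hlt'
  have hR : 𝔼.resolvent x w = ∑' n, u n := by
    simpa only [hβι, hu, resolvent] using (tsum_neumann (hw.map 𝔼.ι) hlt').symm
  have hprod : ∀ c : M, Summable (fun n => ∑ y ∈ Finset.HasAntidiagonal.antidiagonal n,
        u y.1 * c * u y.2) ∧
      (∑' n, u n) * c * (∑' n, u n) =
        ∑' n, ∑ y ∈ Finset.HasAntidiagonal.antidiagonal n, u y.1 * c * u y.2 := by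
    intro c
    have hc : Summable fun n => ‖u n * c‖ :=
      .of_nonneg_of_le (fun _ => norm_nonneg _) (fun _ => norm_mul_le _ _) (hsum.mul_right _)
    rw [← hsum.of_norm.tsum_mul_right]
    exact ⟨(summable_norm_sum_mul_antidiagonal_of_summable_norm hc hsum).of_norm,
      tsum_mul_tsum_eq_tsum_sum_antidiagonal_of_summable_norm hc hsum⟩
  obtain ⟨hs1, hp1⟩ := hprod x
  obtain ⟨hs2, hp2⟩ := hprod (𝔼.ι (η β))
  have ht : ∀ n, 𝔼.E (∑ y ∈ Finset.HasAntidiagonal.antidiagonal n, u y.1 * x * u y.2) =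
      ((n : ℂ) + 1) • 𝔼.E (u (n + 1)) := by
    intro n
    have : ∑ y ∈ Finset.HasAntidiagonal.antidiagonal n, u y.1 * x * u y.2 =
        ∑ y ∈ Finset.HasAntidiagonal.antidiagonal n, u (n + 1) := by
      refine Finset.sum_congr rfl fun y hy => ?_
      have hy := Finset.HasAntidiagonal.mem_antidiagonal.1 hy
      simp only [hu]
      rw [← hy, show y.1 + y.2 + 1 = (y.1 + 1) + y.2 by ring, pow_add, pow_succ]
      simp only [mul_assoc]
    rw [this, Finset.sum_const, Finset.Nat.card_antidiagonal, map_nsmul, ← Nat.cast_smul_eq_nsmul ℂ]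
    push_cast
    rfl
  have hs1' := 𝔼.toCLM.summable hs1
  rw [hR, hp1, hp2, ← toCLM_apply, ← toCLM_apply, 𝔼.toCLM.map_tsum hs1, 𝔼.toCLM.map_tsum hs2,
    hs1'.tsum_eq_zero_add, ← (𝔼.toCLM.summable hs2).tsum_const_smul]
  simp only [toCLM_apply, ht]
  have h1 : 𝔼.E (u (0 + 1)) = 0 := by
    simpa [hu] using h β 1
  rw [h1, smul_zero, zero_add]
  refine tsum_congr fun n => ?_
  rw [map_sum, ← h.E_antidiagonal β n]
  push_cast
  rw [add_assoc, one_add_one_eq_two]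

lemma differentiableAt_resolvent_add_smul {w : D} {z : ℂ} (h : IsUnit (𝔼.ι (w + z • 1) - x)) :
    DifferentiableAt ℂ (fun z : ℂ => 𝔼.resolvent x (w + z • 1)) z := by
  refine DifferentiableAt.inverse ?_ h
  simp only [map_add, map_smul]
  fun_prop

lemma imGE_add_smul_one {δ : ℝ} {w : D} (hw : ImGE δ w) (z : ℂ) : ImGE (δ + z.im) (w + z • 1) := by
  rw [← Algebra.algebraMap_eq_smul_one]
  exact hw.add (imGE_algebraMap z)

/-- The differential equation for the resolvents of an arcsine element. -/
lemma HasArcsineMoments.resolvent_identity (h : 𝔼.HasArcsineMoments η x) (hx : IsSelfAdjoint x)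
    {δ : ℝ} (hδ : 0 < δ) {w : D} (hw : ImGE δ w) :
    𝔼.E (𝔼.resolvent x w * x * 𝔼.resolvent x w) =
      (2 : ℂ) • 𝔼.E (𝔼.resolvent x w * 𝔼.ι (η (Ring.inverse w)) * 𝔼.resolvent x w) := by
  -- Both sides are analytic in z along w + z. For Im z > ‖x‖ the Neumann series converges, and the
  -- identity theorem on this half plane carries the equality down to z = 0.
  set U : Set ℂ := {z | -δ < z.im} with hU
  have hUo : IsOpen U := isOpen_lt continuous_const Complex.continuous_im
  have hpos : ∀ z ∈ U, 0 < δ + z.im := fun z hz => by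
    have : -δ < z.im := hz
    linarith
  have hR : DifferentiableOn ℂ (fun z : ℂ => 𝔼.resolvent x (w + z • 1)) U := fun z hz =>
    (differentiableAt_resolvent_add_smul
      (isUnit_shift (hpos z hz) (imGE_add_smul_one hw z) hx)).differentiableWithinAt
  have hinv : DifferentiableOn ℂ (fun z : ℂ => Ring.inverse (w + z • 1)) U := fun z hz =>
    (DifferentiableAt.inverse (𝕜 := ℂ) (h := fun z : ℂ => w + z • (1 : D)) (by fun_prop)
      ((imGE_add_smul_one hw z).isUnit (hpos z hz))).differentiableWithinAt
  have hι : DifferentiableOn ℂ (fun z : ℂ => 𝔼.ι (η (Ring.inverse (w + z • 1)))) U := by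
    let L : D →L[ℂ] M := ⟨𝔼.ι.toAlgHom.toLinearMap, 𝔼.continuous_ι⟩
    exact (L ∘L η).differentiable.comp_differentiableOn hinv
  have hf : DifferentiableOn ℂ (fun z : ℂ => 𝔼.toCLM
      (𝔼.resolvent x (w + z • 1) * x * 𝔼.resolvent x (w + z • 1))) U :=
    𝔼.toCLM.differentiable.comp_differentiableOn ((hR.mul_const x).mul hR)
  have hg : DifferentiableOn ℂ (fun z : ℂ => (2 : ℂ) • 𝔼.toCLM
      (𝔼.resolvent x (w + z • 1) * 𝔼.ι (η (Ring.inverse (w + z • 1))) *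
        𝔼.resolvent x (w + z • 1))) U :=
    (𝔼.toCLM.differentiable.comp_differentiableOn ((hR.mul hι).mul hR)).const_smul (2 : ℂ)
  have hmem : (0 : ℂ) ∈ U := by simpa [hU] using hδ
  set z₀ : ℂ := (‖x‖ + 1 : ℝ) * Complex.I
  have hz₀ : z₀ ∈ {z : ℂ | ‖x‖ < z.im} := by simp [z₀]
  have hnear : ∀ᶠ z in 𝓝 z₀, ‖x‖ < z.im :=
    (isOpen_lt continuous_const Complex.continuous_im).mem_nhds hz₀
  have hz₀U : z₀ ∈ U := by
    have : ‖x‖ < z₀.im := hz₀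
    change -δ < z₀.im
    linarith [norm_nonneg x]
  have key := (hf.analyticOnNhd hUo).eqOn_of_preconnected_of_eventuallyEq (hg.analyticOnNhd hUo)
    (convex_halfSpace_im_gt (-δ)).isPreconnected hz₀U ?_ hmem
  · simpa using key
  · filter_upwards [hnear] with z hz
    have hzp : 0 < δ + z.im := by linarith [norm_nonneg x]
    have hw' := imGE_add_smul_one hw z
    refine h.resolvent_identity_of_norm_lt (hw'.isUnit hzp) ?_
    calc _ ≤ (δ + z.im)⁻¹ * ‖x‖ := by gcongr; exact hw'.norm_inverse_le hzp
      _ < 1 := by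
        rw [inv_mul_lt_iff₀ hzp]
        linarith

end CondExp

/-! ### Perturbation estimates for Cauchy transforms -/

lemma HasDerivAt.ringInverse {M : Type*} [NormedRing M] [NormedAlgebra ℝ M] [CompleteSpace M]
    {f : ℝ → M} {f' : M} {t : ℝ} (h : HasDerivAt f f' t) (hu : IsUnit (f t)) :
    HasDerivAt (fun s => Ring.inverse (f s)) (-(Ring.inverse (f t) * f' * Ring.inverse (f t))) t := by
  obtain ⟨v, hv⟩ := hu
  have h1 := hasFDerivAt_ringInverse (𝕜 := ℝ) v
  rw [hv] at h1
  have h2 := h1.comp_hasDerivAt t h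
  refine h2.congr_deriv ?_
  rw [← hv, Ring.inverse_unit]
  simp

lemma norm_inverse_sub_inverse_le {M : Type*} [CStarAlgebra M] [PartialOrder M] [StarOrderedRing M]
    {a b : M} {δ : ℝ} (hδ : 0 < δ) (ha : ImGE δ a) (hb : ImGE δ b) :
    ‖Ring.inverse a - Ring.inverse b‖ ≤ δ⁻¹ ^ 2 * ‖a - b‖ := by
  have : Ring.inverse a - Ring.inverse b = Ring.inverse a * (b - a) * Ring.inverse b := by
    rw [mul_sub, sub_mul, Ring.inverse_mul_cancel _ (ha.isUnit hδ), one_mul, mul_assoc,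
      Ring.mul_inverse_cancel _ (hb.isUnit hδ), mul_one]
  rw [this]
  calc _ ≤ ‖Ring.inverse a‖ * ‖b - a‖ * ‖Ring.inverse b‖ :=
        (norm_mul_le _ _).trans (by gcongr; exact norm_mul_le _ _)
    _ ≤ δ⁻¹ * ‖b - a‖ * δ⁻¹ := by
        gcongr
        · exact ha.norm_inverse_le hδ
        · exact hb.norm_inverse_le hδ
    _ = _ := by rw [norm_sub_rev]; ring

lemma ImGE.add_smul_sub {M : Type*} [CStarAlgebra M] [PartialOrder M] [StarOrderedRing M]
    {a b : M} {δ : ℝ} (ha : ImGE δ a) (hb : ImGE δ b) {t : ℝ} (h0 : 0 ≤ t) (h1 : t ≤ 1) :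
    ImGE δ (a + t • (b - a)) := by
  have := (ha.smul (sub_nonneg.2 h1)).add (hb.smul h0)
  rw [← add_mul, sub_add_cancel, one_mul] at this
  convert this using 1
  rw [smul_sub, sub_smul, one_smul]
  abel

namespace CondExp

variable {D M : Type*} [CStarAlgebra D] [PartialOrder D] [StarOrderedRing D]
    [CStarAlgebra M] [PartialOrder M] [StarOrderedRing M] {𝔼 : CondExp D M}
    {η : D →L[ℂ] D} {x : M}

lemma HasArcsineMoments.E_eq_zero (h : 𝔼.HasArcsineMoments η x) : 𝔼.E x = 0 := by
  simpa using h 1 1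

lemma isSelfAdjoint_real_smul (hx : IsSelfAdjoint x) (v : ℝ) : IsSelfAdjoint ((v : ℂ) • x) := by
  rw [Complex.coe_smul]
  exact (IsSelfAdjoint.all v).smul hx

/-- The multiple v x has variance v²η, and one factor v cancels. For v = 0 both sides are zero since
x is centered. -/
lemma HasArcsineMoments.resolvent_identity_smul (h : 𝔼.HasArcsineMoments η x)
    (hx : IsSelfAdjoint x) {δ : ℝ} (hδ : 0 < δ) {w : D} (hw : ImGE δ w) (v : ℝ) :
    𝔼.E (𝔼.resolvent ((v : ℂ) • x) w * x * 𝔼.resolvent ((v : ℂ) • x) w) = (2 * v : ℂ) •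
      𝔼.E (𝔼.resolvent ((v : ℂ) • x) w * 𝔼.ι (η (Ring.inverse w)) *
        𝔼.resolvent ((v : ℂ) • x) w) := by
  rcases eq_or_ne v 0 with rfl | hv
  · rw [Complex.ofReal_zero, zero_smul, mul_zero, zero_smul]
    rw [resolvent, sub_zero, Ring.map_inverse_of_isUnit 𝔼.ι (hw.isUnit hδ), E_bimodule,
      h.E_eq_zero, mul_zero, zero_mul]
  · have hv' : (v : ℂ) ≠ 0 := by exact_mod_cast hv
    have h1 := (h.smul v).resolvent_identity (isSelfAdjoint_real_smul hx v) hδ hw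
    rw [smul_apply, mul_smul_comm, smul_mul_assoc, map_smul, map_smul, mul_smul_comm,
      smul_mul_assoc, map_smul, smul_smul] at h1
    rw [← inv_smul_smul₀ hv' (𝔼.E _), h1, smul_smul]
    congr 1
    field_simp

lemma norm_E_resolvent_mul_le {δ : ℝ} (hδ : 0 < δ) {w : D} (hw : ImGE δ w)
    (hx : IsSelfAdjoint x) (d : D) :
    ‖𝔼.E (𝔼.resolvent x w * 𝔼.ι d * 𝔼.resolvent x w)‖ ≤ δ⁻¹ ^ 2 * ‖d‖ := by
  have hR := norm_resolvent_le (𝔼 := 𝔼) hδ hw hx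
  calc _ ≤ ‖𝔼.resolvent x w * 𝔼.ι d * 𝔼.resolvent x w‖ := 𝔼.norm_E_le _
    _ ≤ δ⁻¹ * ‖d‖ * δ⁻¹ := by
      refine (norm_mul_le _ _).trans ?_
      gcongr
      refine (norm_mul_le _ _).trans ?_
      gcongr
      exact 𝔼.norm_ι_le d
    _ = _ := by ring

/-- One step of the comparison between the Cauchy transforms of multiples of an arcsine element. -/
lemma HasArcsineMoments.norm_cauchy_sub_le (h : 𝔼.HasArcsineMoments η x) (hx : IsSelfAdjoint x)
    {δ : ℝ} (hδ : 0 < δ) {w w' : D} (hw : ImGE δ w) (hw' : ImGE δ w') {u u' : ℝ} (hu : 0 ≤ u)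
    (huu : u < u') :
    ‖𝔼.cauchy ((u' : ℂ) • x) w - 𝔼.cauchy ((u : ℂ) • x) w'‖ ≤ δ⁻¹ ^ 2 *
      (‖w' - w + (u' ^ 2 - u ^ 2) • η (Ring.inverse w)‖ +
        (u' ^ 2 - u ^ 2) * ‖η‖ * δ⁻¹ ^ 2 * ‖w' - w‖) := by
  set t := u' ^ 2 - u ^ 2 with ht_def
  have ht : 0 < t := by nlinarith
  -- The argument moves linearly in v², from w' at v = u to w at v = u'. Both the motion of W and
  -- the scaling of x then contribute a factor 2v to the derivative, and they cancel to leading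
  -- order when w' = w - t η(w⁻¹).
  let θ : ℝ → ℝ := fun v => 1 - (v ^ 2 - u ^ 2) / t
  let W : ℝ → D := fun v => w + θ v • (w' - w)
  have hθ : ∀ v ∈ Set.Icc u u', 0 ≤ θ v ∧ θ v ≤ 1 := by
    intro v hv
    have h1 : 0 ≤ v ^ 2 - u ^ 2 := by nlinarith [hv.1]
    have h2 : v ^ 2 - u ^ 2 ≤ t := by
      have := hv.1; have := hv.2
      simp only [ht_def]; nlinarith
    have h3 : (v ^ 2 - u ^ 2) / t ≤ 1 := (div_le_one ht).2 h2
    have h4 : 0 ≤ (v ^ 2 - u ^ 2) / t := div_nonneg h1 ht.le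
    exact ⟨by simp only [θ]; linarith, by simp only [θ]; linarith⟩
  have hW : ∀ v ∈ Set.Icc u u', ImGE δ (W v) := fun v hv =>
    hw.add_smul_sub hw' (hθ v hv).1 (hθ v hv).2
  let φ : ℝ → D := fun v => 𝔼.cauchy ((v : ℂ) • x) (W v)
  let K : ℝ := δ⁻¹ ^ 2 * (‖η (Ring.inverse w) + t⁻¹ • (w' - w)‖ + ‖η‖ * δ⁻¹ ^ 2 * ‖w' - w‖)
  let R : ℝ → M := fun v => 𝔼.resolvent ((v : ℂ) • x) (W v)
  have hder : ∀ v ∈ Set.Icc u u', HasDerivAt φ ((2 * v : ℂ) • 𝔼.E (R v *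
      𝔼.ι (η (Ring.inverse (W v)) + t⁻¹ • (w' - w)) * R v)) v := by
    intro v hv
    have hθ' : HasDerivAt θ (-(2 * v / t)) v := by
      have h1 : HasDerivAt (fun v : ℝ => v ^ 2) (2 * v) v := by simpa using hasDerivAt_pow 2 v
      exact ((h1.sub_const (u ^ 2)).div_const t).const_sub 1
    have hW' : HasDerivAt W (-(2 * v / t) • (w' - w)) v := (hθ'.smul_const (w' - w)).const_add w
    let L : D →L[ℝ] M :=
      ((⟨𝔼.ι.toAlgHom.toLinearMap, 𝔼.continuous_ι⟩ : D →L[ℂ] M).restrictScalars ℝ)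
    have hLW : HasDerivAt (fun v => 𝔼.ι (W v)) (L (-(2 * v / t) • (w' - w))) v :=
      L.hasFDerivAt.comp_hasDerivAt v hW'
    have hvx : HasDerivAt (fun v : ℝ => (v : ℂ) • x) x v := by
      simpa using (Complex.ofRealCLM.hasDerivAt (x := v)).smul_const x
    have hres := (hLW.sub hvx).ringInverse
      (isUnit_shift hδ (hW v hv) (isSelfAdjoint_real_smul hx v))
    have hφ := (𝔼.toCLM.restrictScalars ℝ).hasFDerivAt.comp_hasDerivAt v hres
    refine hφ.congr_deriv ?_
    change 𝔼.E (-(R v * (L (-(2 * v / t) • (w' - w)) - x) * R v)) = _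
    have hL : L (-(2 * v / t) • (w' - w)) = -((2 * v : ℂ) • 𝔼.ι (t⁻¹ • (w' - w))) := by
      change 𝔼.ι _ = _
      rw [← map_smul, ← map_neg]
      congr 1
      rw [← Complex.coe_smul, ← Complex.coe_smul, smul_smul, ← neg_smul]
      congr 1
      push_cast
      ring
    rw [hL, mul_sub, sub_mul, neg_sub, map_sub, h.resolvent_identity_smul hx hδ (hW v hv) v,
      map_add, mul_add, add_mul, map_add, smul_add, mul_neg, neg_mul, map_neg, sub_neg_eq_add,
      mul_smul_comm, smul_mul_assoc, map_smul]
  have hbound : ∀ v ∈ Set.Icc u u', ‖(2 * v : ℂ) • 𝔼.E (R v *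
      𝔼.ι (η (Ring.inverse (W v)) + t⁻¹ • (w' - w)) * R v)‖ ≤ 2 * v * K := by
    intro v hv
    have hv0 : 0 ≤ v := hu.trans hv.1
    rw [norm_smul, show ‖(2 * v : ℂ)‖ = 2 * v by simp [abs_of_nonneg hv0]]
    gcongr
    refine (norm_E_resolvent_mul_le hδ (hW v hv) (isSelfAdjoint_real_smul hx v) _).trans ?_
    simp only [K]
    gcongr
    have h1 : η (Ring.inverse (W v)) + t⁻¹ • (w' - w) =
        (η (Ring.inverse w) + t⁻¹ • (w' - w)) + η (Ring.inverse (W v) - Ring.inverse w) := by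
      rw [map_sub]; abel
    rw [h1]
    refine (norm_add_le _ _).trans ?_
    gcongr
    refine (η.le_opNorm _).trans ?_
    rw [mul_assoc]
    gcongr
    refine (norm_inverse_sub_inverse_le hδ (hW v hv) hw).trans ?_
    gcongr
    rw [show W v - w = θ v • (w' - w) by simp [W], norm_smul, Real.norm_of_nonneg (hθ v hv).1]
    exact mul_le_of_le_one_left (norm_nonneg _) (hθ v hv).2
  have hB : ∀ v : ℝ, HasDerivAt (fun v : ℝ => (v ^ 2 - u ^ 2) * K) (2 * v * K) v := by
    intro v
    have h1 : HasDerivAt (fun v : ℝ => v ^ 2) (2 * v) v := by simpa using hasDerivAt_pow 2 v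
    exact (h1.sub_const (u ^ 2)).mul_const K
  -- The bound 2vK is the derivative of (v² - u²)K, so the total increment is at most tK.
  have key := image_norm_le_of_norm_deriv_right_le_deriv_boundary
    (f := fun v => φ v - φ u) (a := u) (b := u')
    (fun v hv => ((hder v hv).sub_const (φ u)).continuousAt.continuousWithinAt)
    (fun v hv => ((hder v ⟨hv.1, hv.2.le⟩).sub_const (φ u)).hasDerivWithinAt)
    (by simp) hB (fun v hv => hbound v ⟨hv.1, hv.2.le⟩) (Set.right_mem_Icc.2 huu.le)
  have e1 : φ u' = 𝔼.cauchy ((u' : ℂ) • x) w := by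
    simp only [φ, W, θ]
    rw [← ht_def, div_self ht.ne', sub_self, zero_smul, add_zero]
  have e2 : φ u = 𝔼.cauchy ((u : ℂ) • x) w' := by
    simp [φ, W, θ]
  simp only [e1, e2] at key
  refine key.trans (le_of_eq ?_)
  have e3 : w' - w + t • η (Ring.inverse w) = t • (η (Ring.inverse w) + t⁻¹ • (w' - w)) := by
    rw [smul_add, smul_inv_smul₀ ht.ne', add_comm]
  rw [e3, norm_smul, Real.norm_of_nonneg ht.le, ← ht_def]
  simp only [K]
  ring

/-- The reciprocal Cauchy transform of a small centered element. -/
lemma norm_recip_sub_le {y : M} (hy : IsSelfAdjoint y) (hE : 𝔼.E y = 0) {δ : ℝ} (hδ : 0 < δ)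
    {w : D} (hw : ImGE δ w) {s : ℝ} (hs : ‖𝔼.E (y * y)‖ ≤ s) (hsδ : δ⁻¹ ^ 2 * s ≤ 1 / 2) :
    ‖𝔼.recip y w - (w - 𝔼.covar y (Ring.inverse w))‖ ≤
      √‖𝔼.E (y * 𝔼.ι (Ring.inverse w) * y * y * 𝔼.ι (star (Ring.inverse w)) * y)‖ * (δ⁻¹ * √s) +
        2 * δ⁻¹ ^ 3 * s ^ 2 := by
  set β := Ring.inverse w with hβ
  set ρ := 𝔼.resolvent y w with hρ
  set F := 𝔼.recip y w with hF
  set q := 𝔼.E (y * ρ * y) with hq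
  have hwu := hw.isUnit hδ
  have hwβ : w * β = 1 := Ring.mul_inverse_cancel _ hwu
  have hβw : β * w = 1 := Ring.inverse_mul_cancel _ hwu
  have hβn : ‖β‖ ≤ δ⁻¹ := hw.norm_inverse_le hδ
  have hρn : ‖ρ‖ ≤ δ⁻¹ := norm_resolvent_le hδ hw hy
  have hc : 0 ≤ δ⁻¹ := by positivity
  have hs0 : 0 ≤ s := (norm_nonneg _).trans hs
  have hβwι : 𝔼.ι β * 𝔼.ι w = 1 := by rw [← map_mul, hβw, map_one]
  have hwβι : 𝔼.ι w * 𝔼.ι β = 1 := by rw [← map_mul, hwβ, map_one]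
  have hρ1 : ρ = 𝔼.ι β + 𝔼.ι β * y * ρ := by
    have h1 := mul_resolvent (𝔼 := 𝔼) hδ hw hy
    calc ρ = 𝔼.ι β * 𝔼.ι w * ρ := by rw [hβwι, one_mul]
      _ = 𝔼.ι β * ((𝔼.ι w - y) * ρ) + 𝔼.ι β * y * ρ := by noncomm_ring
      _ = _ := by rw [h1, mul_one]
  have hρ2 : ρ = 𝔼.ι β + ρ * y * 𝔼.ι β := by
    have h1 := resolvent_mul (𝔼 := 𝔼) hδ hw hy
    calc ρ = ρ * (𝔼.ι w * 𝔼.ι β) := by rw [hwβι, mul_one]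
      _ = (ρ * (𝔼.ι w - y)) * 𝔼.ι β + ρ * y * 𝔼.ι β := by noncomm_ring
      _ = _ := by rw [h1, one_mul]
  -- The resolvent is expanded once from each side; the linear term drops out since y is centered.
  have hG : 𝔼.cauchy y w = β + β * q * β := by
    have h1 : ρ = 𝔼.ι β + 𝔼.ι β * y * 𝔼.ι β + 𝔼.ι β * (y * ρ * y) * 𝔼.ι β := by
      conv_lhs => rw [hρ1, hρ2]
      simp only [mul_add, mul_assoc, add_assoc]
    rw [cauchy, ← hρ, h1, map_add, map_add, E_bimodule, E_bimodule, hE, 𝔼.E_ι, mul_zero, zero_mul,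
      add_zero]
  have hFG : F * (β + β * q * β) = 1 := by
    rw [← hG]
    exact Ring.inverse_mul_cancel _ (isUnit_cauchy hδ hw hy)
  have hFβ : F * β = 1 - F * β * q * β := by
    rw [← hFG]; noncomm_ring
  have hFw : F = w - F * β * q := by
    have : F * (β + β * q * β) * w = w := by rw [hFG, one_mul]
    have h2 : F * (β + β * q * β) * w = F + F * β * q := by
      calc _ = F * (β * w) + F * β * q * (β * w) := by noncomm_ring
        _ = _ := by rw [hβw, mul_one, mul_one]
    rw [h2] at this
    exact eq_sub_of_add_eq this
  have hqn : ‖q‖ ≤ δ⁻¹ * s := by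
    have h1 := 𝔼.norm_E_conj_le y ρ
    rw [hy.star_eq] at h1
    exact h1.trans (by gcongr)
  -- By the smallness of s the term ‖Fβqβ‖ is at most half of ‖Fβ‖ and is absorbed.
  have hFβn : ‖F * β‖ ≤ 2 := by
    have h1 : ‖F * β‖ ≤ 1 + ‖F * β‖ * (1 / 2) := by
      calc ‖F * β‖ ≤ ‖(1 : D)‖ + ‖F * β * q * β‖ := by
            conv_lhs => rw [hFβ]
            exact norm_sub_le _ _
        _ ≤ 1 + ‖F * β‖ * (δ⁻¹ * s) * δ⁻¹ := by
            gcongr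
            · rcases subsingleton_or_nontrivial D with h | h
              · simp [Subsingleton.elim (1 : D) 0]
              · exact CStarRing.norm_one.le
            · refine (norm_mul_le _ _).trans ?_
              gcongr
              exact (norm_mul_le _ _).trans (by gcongr)
        _ = 1 + ‖F * β‖ * (δ⁻¹ ^ 2 * s) := by ring
        _ ≤ _ := by gcongr
    linarith
  have hdecomp : F - (w - 𝔼.covar y β) =
      -(q - 𝔼.E (y * 𝔼.ι β * y)) + F * β * q * β * q := by
    rw [covar_apply]
    have : F * β * q * β * q = q - F * β * q := by
      calc F * β * q * β * q = (F * β * q * β) * q := by noncomm_ring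
        _ = (1 - F * β) * q := by
          congr 1
          rw [eq_sub_iff_add_eq, add_comm, ← eq_sub_iff_add_eq]
          exact hFβ
        _ = _ := by noncomm_ring
    rw [this]
    conv_lhs => rw [hFw]
    abel
  have h1 : q - 𝔼.E (y * 𝔼.ι β * y) = 𝔼.E ((y * 𝔼.ι β * y) * (ρ * y)) := by
    rw [hq, ← map_sub]
    congr 1
    conv_lhs => rw [hρ1]
    noncomm_ring
  -- Cauchy-Schwarz for the factors yβy and ρy: the first produces the fourth moment, the second is
  -- at most δ⁻¹√s. This is the only term of leading order.
  have h2 : ‖q - 𝔼.E (y * 𝔼.ι β * y)‖ ≤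
      √‖𝔼.E (y * 𝔼.ι β * y * y * 𝔼.ι (star β) * y)‖ * (δ⁻¹ * √s) := by
    rw [h1]
    refine (𝔼.norm_E_mul_le _ _).trans ?_
    have e1 : y * 𝔼.ι β * y * star (y * 𝔼.ι β * y) = y * 𝔼.ι β * y * y * 𝔼.ι (star β) * y := by
      simp only [star_mul, hy.star_eq, map_star, mul_assoc]
    rw [e1]
    gcongr
    refine Real.sqrt_le_iff.2 ⟨by positivity, ?_⟩
    rw [star_mul, mul_pow, Real.sq_sqrt hs0, mul_assoc, ← mul_assoc (star ρ), ← mul_assoc]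
    refine (𝔼.norm_E_conj_le y (star ρ * ρ)).trans ?_
    rw [CStarRing.norm_star_mul_self, hy.star_eq, ← pow_two]
    gcongr
  rw [hdecomp]
  refine (norm_add_le _ _).trans ?_
  rw [norm_neg]
  refine add_le_add h2 ?_
  calc ‖F * β * q * β * q‖ ≤ 2 * (δ⁻¹ * s) * δ⁻¹ * (δ⁻¹ * s) := by
        refine (norm_mul_le _ _).trans ?_
        gcongr
        refine (norm_mul_le _ _).trans ?_
        gcongr
        refine (norm_mul_le _ _).trans ?_
        gcongr
    _ = _ := by ring

end CondExp

/-! ### Cauchy transforms of infinitely divisible elements -/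

namespace OVProbSpace

open CStarMatrix

variable {B : Type u} [CStarAlgebra B] [PartialOrder B] [StarOrderedRing B]
  {A : Type v} [CStarAlgebra A] [PartialOrder A] [StarOrderedRing A] {P : OVProbSpace B A}
  {k : ℕ}

/-- Fourth moments of amplifications. -/
lemma norm_amp_fourth_moment_le {y : A} (hy : IsSelfAdjoint y) {r : ℝ}
    (h : ∀ b, ‖P.E (y * P.ι b * y * y * P.ι (star b) * y)‖ ≤ r * ‖b‖ ^ 2) (hr : 0 ≤ r)
    (β : CStarMatrix (Fin k) (Fin k) B) :
    ‖(P.amp k).E (diagHom A k y * (P.amp k).ι β * diagHom A k y * diagHom A k y *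
      (P.amp k).ι (star β) * diagHom A k y)‖ ≤ (k * ‖β‖) ^ 2 * r := by
  set Z := diagHom A k y * (P.amp k).ι β * diagHom A k y
  have hZ : diagHom A k y * (P.amp k).ι β * diagHom A k y * diagHom A k y *
      (P.amp k).ι (star β) * diagHom A k y = Z * star Z := by
    simp only [Z, star_mul, (isSelfAdjoint_diagHom hy k).star_eq, map_star, mul_assoc]
  have hpos : 0 ≤ (P.amp k).E (Z * star Z) := by
    exact map_nonneg (P.amp k).E (mul_star_self_nonneg Z)
  rw [hZ]
  refine (norm_le_sum_diag hpos).trans ?_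
  -- Each of the k diagonal entries is a sum of k scalar-size fourth moments, hence k² here and k
  -- after the square root.
  have hentry : ∀ i, ‖(P.amp k).E (Z * star Z) i i‖ ≤ ∑ _j : Fin k, r * ‖β‖ ^ 2 := by
    intro i
    rw [amp_E_apply, CStarMatrix.mul_apply, map_sum]
    refine (norm_sum_le _ _).trans (Finset.sum_le_sum fun j _ => ?_)
    have hZij : Z i j = y * P.ι (β i j) * y := by
      simp only [Z]
      rw [mul_diagHom_apply, diagHom_mul_apply, amp_ι_apply]
    rw [CStarMatrix.star_apply, hZij]
    have : y * P.ι (β i j) * y * star (y * P.ι (β i j) * y) =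
        y * P.ι (β i j) * y * y * P.ι (star (β i j)) * y := by
      simp only [star_mul, hy.star_eq, map_star, mul_assoc]
    rw [this]
    refine (h _).trans ?_
    gcongr
    exact CStarMatrix.norm_entry_le_norm
  refine (Finset.sum_le_sum fun i _ => hentry i).trans (le_of_eq ?_)
  simp
  ring

section Chain

variable {C : Type w} [CStarAlgebra C] [PartialOrder C] [StarOrderedRing C] {Q : OVProbSpace B C}
  {Y : A} {n : ℕ} {y : Fin n → C}

/-- The Cauchy transform of a sum of monotone independent identically distributed elements is
obtained by iterating the reciprocal Cauchy transform. -/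
lemma cauchy_eq_inverse_iterate (hn : 0 < n) (hY : IsSelfAdjoint Y)
    (hy : ∀ i, IsSelfAdjoint (y i))
    (hMI : Q.MonotoneIndependent fun i => Q.bimoduleAlgebra (y i))
    (hid : ∀ i j, Q.SameDistribution (y i) Q (y j))
    (hsum : P.SameDistribution Y Q (∑ i, y i)) {δ : ℝ} (hδ : 0 < δ)
    {b : CStarMatrix (Fin k) (Fin k) B} (hb : ImGE δ b) :
    (∀ j, ImGE δ (((Q.amp k).recip (diagHom C k (y ⟨0, hn⟩)))^[j] b)) ∧
    (P.amp k).cauchy (diagHom A k Y) b =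
      Ring.inverse (((Q.amp k).recip (diagHom C k (y ⟨0, hn⟩)))^[n] b) := by
  set F := (Q.amp k).recip (diagHom C k (y ⟨0, hn⟩))
  have hW : ∀ j, ImGE δ (F^[j] b) := by
    intro j
    induction j with
    | zero => exact hb
    | succ j ih =>
      rw [Function.iterate_succ_apply']
      exact CondExp.imGE_recip hδ ih (isSelfAdjoint_diagHom (hy _) k)
  refine ⟨hW, ?_⟩
  have hsa : ∀ s, IsSelfAdjoint (partialSum y s) := fun s => isSelfAdjoint_sum _ fun i _ => hy i
  -- The summand of highest index is removed each time. As all summands have the same distribution,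
  -- its reciprocal transform is always F.
  have hstep : ∀ j ≤ n, (P.amp k).cauchy (diagHom A k Y) b =
      (Q.amp k).cauchy (diagHom C k (partialSum y (n - j))) (F^[j] b) := by
    intro j
    induction j with
    | zero =>
      intro _
      rw [Nat.sub_zero, partialSum_self]
      exact hsum.cauchy_eq hY (isSelfAdjoint_sum _ fun i _ => hy i) hδ hb
    | succ j ih =>
      intro hj
      rw [ih (by omega)]
      have hlt : n - (j + 1) < n := by omega
      rw [show n - j = n - (j + 1) + 1 by omega, partialSum_succ y hlt, partialSum,
        hMI.cauchy_add hy (fun i hi => by simpa [Fin.lt_def] using hi) hδ (hW j),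
        Function.iterate_succ_apply']
      congr 1
      exact congrArg Ring.inverse ((hid _ _).cauchy_eq (hy _) (hy _) hδ (hW j))
  rw [hstep n le_rfl, Nat.sub_self, partialSum_zero, map_zero, CondExp.cauchy, CondExp.resolvent,
    sub_zero, Ring.map_inverse_of_isUnit _ ((hW n).isUnit hδ), CondExp.E_ι]

/-- The error made when replacing a small summand in the iteration. -/
noncomputable def stepError (k : ℕ) (c s H C : ℝ) (n : ℕ) : ℝ :=
  -- In the application c = δ⁻¹, s = ‖η(1)‖, H is the supremum of the fourth cumulant norms and C =
  -- 3‖η‖²/2.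
  (n : ℝ)⁻¹ * (k * c ^ 2 * √(H + C * (n : ℝ)⁻¹) * √s) + 2 * c ^ 3 * s ^ 2 * (n : ℝ)⁻¹ ^ 2

/-- In `norm_recip_sub_le` the fourth and the second moment are both of order 1/n, so the product of
their square roots is of order 1/n with constant √(H + C/n) √‖η(1)‖. -/
lemma norm_recip_summand_sub_le (η : B →L[ℂ] B) (hn : 0 < n) (hy : ∀ i, IsSelfAdjoint (y i))
    (hMI : Q.MonotoneIndependent fun i => Q.bimoduleAlgebra (y i))
    (hid : ∀ i j, Q.SameDistribution (y i) Q (y j))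
    (hsum : P.SameDistribution Y Q (∑ i, y i)) (hmean : P.E Y = 0)
    (hvar : ∀ b, P.E (Y * P.ι b * Y) = η b)
    {ηk : CStarMatrix (Fin k) (Fin k) B →L[ℂ] CStarMatrix (Fin k) (Fin k) B}
    (hη : ∀ d i j, ηk d i j = η (d i j)) {δ : ℝ} (hδ : 0 < δ)
    {w : CStarMatrix (Fin k) (Fin k) B} (hw : ImGE δ w)
    (hnδ : δ⁻¹ ^ 2 * ((n : ℝ)⁻¹ * ‖η 1‖) ≤ 1 / 2) (i : Fin n) :
    ‖(Q.amp k).recip (diagHom C k (y i)) w - (w - (n : ℂ)⁻¹ • ηk (Ring.inverse w))‖ ≤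
      stepError k δ⁻¹ ‖η 1‖ (sSup (P.fourthCumulantNorms Y)) (3 / 2 * ‖η‖ ^ 2) n := by
  obtain ⟨hm, hv, -⟩ := summand_moments hn hy hMI hid hsum hmean hvar i
  have h4 := norm_summand_fourth_moment_le η hn hy hMI hid hsum hmean hvar i
  set H := sSup (P.fourthCumulantNorms Y)
  have hH : 0 ≤ H := Real.sSup_nonneg fun r hr => by
    obtain ⟨b, b', -, -, rfl⟩ := hr
    exact norm_nonneg _
  have hcov : (Q.amp k).covar (diagHom C k (y i)) (Ring.inverse w) =
      (n : ℂ)⁻¹ • ηk (Ring.inverse w) := by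
    ext a c
    rw [amp_covar_apply, hv, ← hη, CStarMatrix.smul_apply]
  have hE : (Q.amp k).E (diagHom C k (y i)) = 0 := by
    ext a c
    rw [amp_E_apply, diagHom_apply]
    split_ifs
    · exact hm
    · exact map_zero _
  have hs : ‖(Q.amp k).E (diagHom C k (y i) * diagHom C k (y i))‖ ≤ (n : ℝ)⁻¹ * ‖η 1‖ := by
    rw [← map_mul]
    have : (Q.amp k).E (diagHom C k (y i * y i)) = diagHom B k ((n : ℂ)⁻¹ • η 1) := by
      ext a c
      have h1 := hv 1
      rw [map_one, mul_one] at h1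
      rw [amp_E_apply, diagHom_apply, diagHom_apply]
      split_ifs
      · exact h1
      · exact map_zero _
    rw [this]
    refine (norm_diagHom_le _).trans ?_
    rw [norm_smul]
    simp
  have hβ := hw.norm_inverse_le hδ
  have hm4 := norm_amp_fourth_moment_le (k := k) (hy i) h4 (by positivity) (Ring.inverse w)
  have key := CondExp.norm_recip_sub_le (𝔼 := Q.amp k) (isSelfAdjoint_diagHom (hy i) k) hE hδ hw hs
    hnδ
  rw [hcov] at key
  refine key.trans ?_
  rw [stepError]
  have h1 : √‖(Q.amp k).E (diagHom C k (y i) * (Q.amp k).ι (Ring.inverse w) * diagHom C k (y i) *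
      diagHom C k (y i) * (Q.amp k).ι (star (Ring.inverse w)) * diagHom C k (y i))‖ ≤
      (k * δ⁻¹) * (√((n : ℝ)⁻¹) * √(H + 3 / 2 * ‖η‖ ^ 2 * (n : ℝ)⁻¹)) := by
    refine Real.sqrt_le_iff.2 ⟨by positivity, hm4.trans ?_⟩
    rw [mul_pow _ (_ * _), ← Real.sqrt_mul (by positivity), Real.sq_sqrt (by positivity)]
    gcongr
  calc _ ≤ (k * δ⁻¹) * (√((n : ℝ)⁻¹) * √(H + 3 / 2 * ‖η‖ ^ 2 * (n : ℝ)⁻¹)) *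
        (δ⁻¹ * √((n : ℝ)⁻¹ * ‖η 1‖)) + 2 * δ⁻¹ ^ 3 * ((n : ℝ)⁻¹ * ‖η 1‖) ^ 2 := by gcongr
    _ = _ := by
      rw [Real.sqrt_mul (by positivity : (0 : ℝ) ≤ (n : ℝ)⁻¹)]
      have := Real.mul_self_sqrt (by positivity : (0 : ℝ) ≤ (n : ℝ)⁻¹)
      linear_combination (k * δ⁻¹ ^ 2 * √(H + 3 / 2 * ‖η‖ ^ 2 * (n : ℝ)⁻¹) * √‖η 1‖) * this

end Chain

/-- The Cauchy transform of a centered infinitely divisible element as the result of an Euler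
scheme. -/
lemma IsMonotoneDivisible.exists_euler_scheme {Y : A} {n : ℕ} (η : B →L[ℂ] B) (hn : 0 < n)
    (hY : IsSelfAdjoint Y) (hdiv : IsMonotoneDivisible.{u, v, z} P Y n) (hmean : P.E Y = 0)
    (hvar : ∀ b, P.E (Y * P.ι b * Y) = η b)
    {ηk : CStarMatrix (Fin k) (Fin k) B →L[ℂ] CStarMatrix (Fin k) (Fin k) B}
    (hη : ∀ d i j, ηk d i j = η (d i j)) {δ : ℝ} (hδ : 0 < δ)
    {b : CStarMatrix (Fin k) (Fin k) B} (hb : ImGE δ b)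
    (hnδ : δ⁻¹ ^ 2 * ((n : ℝ)⁻¹ * ‖η 1‖) ≤ 1 / 2) :
    ∃ W : ℕ → CStarMatrix (Fin k) (Fin k) B, W 0 = b ∧ (∀ j, ImGE δ (W j)) ∧
      (P.amp k).cauchy (diagHom A k Y) b = Ring.inverse (W n) ∧
      ∀ j, ‖W (j + 1) - (W j - (n : ℂ)⁻¹ • ηk (Ring.inverse (W j)))‖ ≤
        stepError k δ⁻¹ ‖η 1‖ (sSup (P.fourthCumulantNorms Y)) (3 / 2 * ‖η‖ ^ 2) n := by
  obtain ⟨C, _, _, _, Q, y, hy, hMI, hid, hsum⟩ := hdiv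
  obtain ⟨h1, h2⟩ := cauchy_eq_inverse_iterate hn hY hy hMI hid hsum hδ hb
  refine ⟨fun j => ((Q.amp k).recip (diagHom C k (y ⟨0, hn⟩)))^[j] b, rfl, h1, h2, fun j => ?_⟩
  simp only [Function.iterate_succ_apply']
  exact norm_recip_summand_sub_le η hn hy hMI hid hsum hmean hvar hη hδ (h1 j) hnδ _

/-- Over n steps only the Cauchy-Schwarz term survives in the limit; the correction C/n and the
quadratic term disappear. -/
lemma tendsto_stepError (k : ℕ) (c s H C : ℝ) :
    Tendsto (fun n : ℕ => n * stepError k c s H C n) atTop (𝓝 (k * c ^ 2 * √H * √s)) := by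
  have h0 : Tendsto (fun n : ℕ => (n : ℝ)⁻¹) atTop (𝓝 0) := tendsto_inv_atTop_nhds_zero_nat
  have h1 : Tendsto (fun n : ℕ => (k * c ^ 2 * √(H + C * (n : ℝ)⁻¹) * √s) +
      2 * c ^ 3 * s ^ 2 * (n : ℝ)⁻¹) atTop
      (𝓝 ((k * c ^ 2 * √(H + C * 0) * √s) + 2 * c ^ 3 * s ^ 2 * 0)) := by
    refine Tendsto.add ?_ (h0.const_mul _)
    refine Tendsto.mul_const _ (Tendsto.const_mul _ ?_)
    exact (Real.continuous_sqrt.tendsto _).comp ((h0.const_mul C).const_add H)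
  simp only [mul_zero, add_zero] at h1
  refine h1.congr' ?_
  filter_upwards [eventually_gt_atTop 0] with n hn
  have : (n : ℝ) ≠ 0 := by exact_mod_cast hn.ne'
  rw [stepError]
  field_simp

lemma stepError_nonneg (k : ℕ) {c : ℝ} (hc : 0 ≤ c) (s H C : ℝ) (n : ℕ) :
    0 ≤ stepError k c s H C n := by
  unfold stepError
  positivity

end OVProbSpace

/-! ### Comparison of Cauchy transforms -/

namespace CondExp

variable {D M : Type*} [CStarAlgebra D] [PartialOrder D] [StarOrderedRing D]
    [CStarAlgebra M] [PartialOrder M] [StarOrderedRing M] {𝔼 : CondExp D M}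
    {η : D →L[ℂ] D} {x : M}

/-- The distance from the end point of an Euler scheme to the Cauchy transform of an arcsine
element. -/
lemma HasArcsineMoments.norm_cauchy_sub_inverse_le (h : 𝔼.HasArcsineMoments η x)
    (hx : IsSelfAdjoint x) {δ : ℝ} (hδ : 0 < δ) {n : ℕ} (hn : 0 < n) {e : ℝ}
    {W : ℕ → D} (hW : ∀ j, ImGE δ (W j))
    (hstep : ∀ j, ‖W (j + 1) - (W j - (n : ℂ)⁻¹ • η (Ring.inverse (W j)))‖ ≤ e) :
    ‖𝔼.cauchy x (W 0) - Ring.inverse (W n)‖ ≤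
      δ⁻¹ ^ 2 * (n * e + ‖η‖ * δ⁻¹ ^ 2 * (e + (n : ℝ)⁻¹ * (‖η‖ * δ⁻¹))) := by
  have hn0 : (0 : ℝ) < n := by exact_mod_cast hn
  have hreal : ∀ d : D, (n : ℂ)⁻¹ • d = (n : ℝ)⁻¹ • d := fun d => by
    rw [← Complex.coe_smul, Complex.ofReal_inv, Complex.ofReal_natCast]
  simp only [hreal] at hstep
  -- The variance drops by η/n at each step, exactly compensating one Euler step. At j = 0 this is
  -- the arcsine element itself; at j = n nothing is left and the Cauchy transform is the inverse.
  let u : ℕ → ℝ := fun j => √(((n : ℝ) - j) * (n : ℝ)⁻¹)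
  let T : ℕ → D := fun j => 𝔼.cauchy ((u j : ℂ) • x) (W j)
  have hT : ∀ {j}, j < n → dist (T j) (T (j + 1)) ≤
      δ⁻¹ ^ 2 * (e + (n : ℝ)⁻¹ * ‖η‖ * δ⁻¹ ^ 2 * (e + (n : ℝ)⁻¹ * (‖η‖ * δ⁻¹))) := by
    intro j hj
    have hj' : (j : ℝ) + 1 ≤ n := by exact_mod_cast hj
    have h1 : (0 : ℝ) ≤ ((n : ℝ) - (j + 1 : ℕ)) * (n : ℝ)⁻¹ := by
      push_cast
      exact mul_nonneg (by linarith) (by positivity)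
    have h2 : (0 : ℝ) ≤ ((n : ℝ) - j) * (n : ℝ)⁻¹ := mul_nonneg (by linarith) (by positivity)
    have hlt : u (j + 1) < u j := by
      refine Real.sqrt_lt_sqrt h1 ?_
      gcongr
      exact lt_add_one j
    have hsq : u j ^ 2 - u (j + 1) ^ 2 = (n : ℝ)⁻¹ := by
      simp only [u]
      rw [Real.sq_sqrt h1, Real.sq_sqrt h2]
      push_cast
      ring
    have key := h.norm_cauchy_sub_le hx hδ (hW j) (hW (j + 1)) (Real.sqrt_nonneg _) hlt
    rw [hsq] at key
    rw [dist_eq_norm]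
    refine key.trans ?_
    have h3 : W (j + 1) - W j + (n : ℝ)⁻¹ • η (Ring.inverse (W j)) =
        W (j + 1) - (W j - (n : ℝ)⁻¹ • η (Ring.inverse (W j))) := by abel
    have h4 : ‖W (j + 1) - W j‖ ≤ e + (n : ℝ)⁻¹ * (‖η‖ * δ⁻¹) := by
      have : W (j + 1) - W j = (W (j + 1) - (W j - (n : ℝ)⁻¹ • η (Ring.inverse (W j)))) -
          (n : ℝ)⁻¹ • η (Ring.inverse (W j)) := by abel
      rw [this]
      refine (norm_sub_le _ _).trans (add_le_add (hstep j) ?_)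
      rw [norm_smul, Real.norm_of_nonneg (by positivity)]
      gcongr
      exact (η.le_opNorm _).trans (by gcongr; exact (hW j).norm_inverse_le hδ)
    rw [h3]
    gcongr
    exact hstep j
  have key := dist_le_range_sum_of_dist_le (f := T) n hT
  rw [Finset.sum_const, Finset.card_range, nsmul_eq_mul, dist_eq_norm] at key
  have e1 : T 0 = 𝔼.cauchy x (W 0) := by
    simp only [T, u, Nat.cast_zero, sub_zero]
    rw [mul_inv_cancel₀ hn0.ne', Real.sqrt_one, Complex.ofReal_one, one_smul]
  have e2 : T n = Ring.inverse (W n) := by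
    simp only [T, u, sub_self, zero_mul, Real.sqrt_zero, Complex.ofReal_zero, zero_smul]
    rw [cauchy, resolvent, sub_zero, Ring.map_inverse_of_isUnit _ ((hW n).isUnit hδ), E_ι]
  rw [e1, e2] at key
  refine key.trans (le_of_eq ?_)
  field_simp

end CondExp

namespace OVProbSpace

open CStarMatrix

variable {B : Type u} [CStarAlgebra B] [PartialOrder B] [StarOrderedRing B]
  {A : Type v} [CStarAlgebra A] [PartialOrder A] [StarOrderedRing A] {P : OVProbSpace B A}
  {A' : Type w} [CStarAlgebra A'] [PartialOrder A'] [StarOrderedRing A'] {Q : OVProbSpace B A'}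
  {k : ℕ}

/-- The left side does not involve n. The accumulated local errors supply δ⁻² k √H √‖η(1)‖ in the
limit, the comparison step another δ⁻², and every term containing the norm of the amplified variance
tends to zero. -/
lemma norm_cauchy_sub_cauchy_le {Y : A} {X : A'} (η : B →L[ℂ] B) (hY : IsSelfAdjoint Y)
    (hdiv : ∀ n : ℕ, 0 < n → IsMonotoneDivisible.{u, v, z} P Y n) (hmean : P.E Y = 0)
    (hvar : ∀ b, P.E (Y * P.ι b * Y) = η b) (hX : Q.IsArcsine η X) {δ : ℝ} (hδ : 0 < δ)
    {b : CStarMatrix (Fin k) (Fin k) B} (hb : ImGE δ b) :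
    ‖(P.amp k).cauchy (diagHom A k Y) b - (Q.amp k).cauchy (diagHom A' k X) b‖ ≤
      k * δ⁻¹ ^ 4 * √‖η 1‖ * √(sSup (P.fourthCumulantNorms Y)) := by
  set ηk := (P.amp k).covar (diagHom A k Y)
  have hη : ∀ d i j, ηk d i j = η (d i j) := fun d i j => (amp_covar_apply d i j).trans (hvar _)
  have harc := hX.hasArcsineMoments hη
  set e : ℕ → ℝ := stepError k δ⁻¹ ‖η 1‖ (sSup (P.fourthCumulantNorms Y)) (3 / 2 * ‖η‖ ^ 2) with he
  have hlim : Tendsto (fun n : ℕ => (n : ℝ) * e n) atTop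
    (𝓝 (k * δ⁻¹ ^ 2 * √(sSup (P.fourthCumulantNorms Y)) * √‖η 1‖)) := tendsto_stepError _ _ _ _ _
  have h0 : Tendsto (fun n : ℕ => (n : ℝ)⁻¹) atTop (𝓝 0) := tendsto_inv_atTop_nhds_zero_nat
  have hlim0 : Tendsto e atTop (𝓝 0) := by
    have := h0.mul hlim
    rw [zero_mul] at this
    refine this.congr' ?_
    filter_upwards [eventually_gt_atTop 0] with n hn
    have : (n : ℝ) ≠ 0 := by exact_mod_cast hn.ne'
    field_simp
  have hbound := (hlim.add ((hlim0.add (h0.mul_const (‖ηk‖ * δ⁻¹))).const_mul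
    (‖ηk‖ * δ⁻¹ ^ 2))).const_mul (δ⁻¹ ^ 2)
  rw [zero_mul, add_zero, mul_zero, add_zero] at hbound
  have hsmall : ∀ᶠ n : ℕ in atTop, δ⁻¹ ^ 2 * ((n : ℝ)⁻¹ * ‖η 1‖) ≤ 1 / 2 := by
    have := (h0.mul_const ‖η 1‖).const_mul (δ⁻¹ ^ 2)
    rw [zero_mul, mul_zero] at this
    exact this.eventually_le_const (by norm_num)
  refine (ge_of_tendsto hbound ?_).trans (le_of_eq (by ring))
  filter_upwards [hsmall, eventually_gt_atTop 0] with n hn hn0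
  obtain ⟨W, hW0, hW, hWn, hstep⟩ := (hdiv n hn0).exists_euler_scheme η hn0 hY hmean hvar hη hδ hb hn
  rw [hWn, norm_sub_rev, ← hW0]
  exact harc.norm_cauchy_sub_inverse_le (isSelfAdjoint_diagHom hX.isSelfAdjoint k) hδ hn0
    hW hstep

end OVProbSpace

/-- The optimal δ is ‖(Im b)⁻¹‖⁻¹; it is positive only in a nontrivial algebra, so zero algebras,
such as matrices of size 0, are treated apart. -/
lemma exists_imGE_of_mem_upperHalfPlane {D : Type*} [CStarAlgebra D] [PartialOrder D]
    [StarOrderedRing D] {b : D} (hb : b ∈ upperHalfPlane D) (hD : Nontrivial D) :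
    0 < ‖Ring.inverse (imaginaryPart b : D)‖ ∧ ImGE ‖Ring.inverse (imaginaryPart b : D)‖⁻¹ b := by
  have hb' : IsStrictlyPositive (imaginaryPart b : D) := hb
  have hpos : 0 < ‖Ring.inverse (imaginaryPart b : D)‖ := by
    rw [norm_pos_iff]
    intro h0
    have := Ring.mul_inverse_cancel _ hb'.isUnit
    rw [h0, mul_zero] at this
    exact zero_ne_one this
  exact ⟨hpos, hb'.algebraMap_inv_le hpos le_rfl⟩

namespace OVProbSpace

open CStarMatrix

variable {B : Type u} [CStarAlgebra B] [PartialOrder B] [StarOrderedRing B]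
  {A : Type v} [CStarAlgebra A] [PartialOrder A] [StarOrderedRing A] {P : OVProbSpace B A}
  {A' : Type w} [CStarAlgebra A'] [PartialOrder A'] [StarOrderedRing A'] {Q : OVProbSpace B A'}
  {k : ℕ}

lemma isUnit_matrixShift {x : A} (hx : IsSelfAdjoint x) {b : CStarMatrix (Fin k) (Fin k) B}
    (hb : b ∈ upperHalfPlane (CStarMatrix (Fin k) (Fin k) B)) : IsUnit (P.matrixShift x b) := by
  rw [matrixShift_eq]
  rcases subsingleton_or_nontrivial (CStarMatrix (Fin k) (Fin k) B) with h | h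
  · have h1 : (1 : CStarMatrix (Fin k) (Fin k) A) = 0 := by
      rw [← map_one (P.amp k).ι, ← map_zero (P.amp k).ι, Subsingleton.elim (1 : CStarMatrix _ _ B) 0]
    have := subsingleton_of_zero_eq_one h1.symm
    exact isUnit_of_subsingleton _
  · obtain ⟨hpos, hb'⟩ := exists_imGE_of_mem_upperHalfPlane hb h
    exact CondExp.isUnit_shift (inv_pos.2 hpos) hb' (isSelfAdjoint_diagHom hx k)

/-- Berry-Esseen type estimate for infinitely divisible elements. -/
lemma norm_cauchyTransform_sub_le {Y : A} {X : A'} (η : B →L[ℂ] B) (hY : IsSelfAdjoint Y)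
    (hdiv : ∀ n : ℕ, 0 < n → IsMonotoneDivisible.{u, v, z} P Y n) (hmean : P.E Y = 0)
    (hvar : ∀ b, P.E (Y * P.ι b * Y) = η b) (hX : Q.IsArcsine η X)
    {b : CStarMatrix (Fin k) (Fin k) B}
    (hb : b ∈ upperHalfPlane (CStarMatrix (Fin k) (Fin k) B)) :
    ‖P.cauchyTransform Y b - Q.cauchyTransform X b‖ ≤
      k * ‖Ring.inverse (imaginaryPart b : CStarMatrix (Fin k) (Fin k) B)‖ ^ 4 * √‖η 1‖ *
        √(sSup (P.fourthCumulantNorms Y)) := by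
  rcases subsingleton_or_nontrivial (CStarMatrix (Fin k) (Fin k) B) with h | h
  · rw [Subsingleton.elim (P.cauchyTransform Y b) (Q.cauchyTransform X b), sub_self, norm_zero]
    positivity
  · obtain ⟨hpos, hb'⟩ := exists_imGE_of_mem_upperHalfPlane hb h
    have := norm_cauchy_sub_cauchy_le η hY hdiv hmean hvar hX (inv_pos.2 hpos) hb'
    rwa [inv_inv] at this

end OVProbSpace

/-! ### The flow of the reciprocal Cauchy transform -/

section Flow

variable {D : Type*} [NormedRing D] [NormedAlgebra ℂ D] (η : D →L[ℂ] D) (β : D)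

/-- Replacing the weights 1/(q + 1) by 1 turns the recursion into that of the Catalan numbers. -/
lemma norm_arcsineTerm_le_catalan (p : ℕ) :
    ‖arcsineTerm η β p‖ ≤ catalan p * (‖η‖ ^ p * ‖β‖ ^ (2 * p + 1)) := by
  induction p using Nat.strong_induction_on with
  | _ p ih =>
    cases p with
    | zero => simp
    | succ p =>
      rw [arcsineTerm_succ, catalan_succ']
      push_cast
      rw [Finset.sum_mul]
      refine (norm_sum_le _ _).trans (Finset.sum_le_sum fun x hx => ?_)
      have hx := Finset.HasAntidiagonal.mem_antidiagonal.1 hx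
      have h1 := ih x.1 (by omega)
      have h2 := ih x.2 (by omega)
      have h3 : ‖(1 / ((x.1 : ℂ) + 1))‖ ≤ 1 := by
        rw [norm_div, norm_one, show ((x.1 : ℂ) + 1) = ((x.1 + 1 : ℕ) : ℂ) by push_cast; rfl,
          Complex.norm_natCast]
        refine div_le_one_of_le₀ ?_ (by positivity)
        exact_mod_cast Nat.succ_pos x.1
      have h4 : ‖β * η (arcsineTerm η β x.1) * arcsineTerm η β x.2‖ ≤
          ‖β‖ * (‖η‖ * (catalan x.1 * (‖η‖ ^ x.1 * ‖β‖ ^ (2 * x.1 + 1)))) *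
            (catalan x.2 * (‖η‖ ^ x.2 * ‖β‖ ^ (2 * x.2 + 1))) := by
        refine (norm_mul_le _ _).trans ?_
        gcongr
        refine (norm_mul_le _ _).trans ?_
        gcongr
        exact (η.le_opNorm _).trans (by gcongr)
      rw [norm_smul]
      refine (mul_le_mul h3 h4 (norm_nonneg _) zero_le_one).trans (le_of_eq ?_)
      rw [← hx]
      ring

lemma norm_arcsineTerm_le (p : ℕ) :
    ‖arcsineTerm η β p‖ ≤ ‖β‖ * (4 * ‖η‖ * ‖β‖ ^ 2) ^ p := by
  refine (norm_arcsineTerm_le_catalan η β p).trans ?_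
  have h1 : (catalan p : ℝ) ≤ 4 ^ p := by
    have : catalan p ≤ 4 ^ p := by
      rw [catalan_eq_centralBinom_div, Nat.centralBinom]
      refine (Nat.div_le_self _ _).trans ((Nat.choose_le_two_pow _ _).trans ?_)
      rw [pow_mul]
      norm_num
    exact_mod_cast this
  calc _ ≤ 4 ^ p * (‖η‖ ^ p * ‖β‖ ^ (2 * p + 1)) := by gcongr
    _ = _ := by rw [mul_pow, mul_pow, ← pow_mul, pow_succ]; ring

lemma arcsineTerm_smul_right (z : ℂ) (p : ℕ) :
    arcsineTerm η (z • β) p = z ^ (2 * p + 1) • arcsineTerm η β p := by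
  induction p using Nat.strong_induction_on with
  | _ p ih =>
    cases p with
    | zero => simp
    | succ p =>
      rw [arcsineTerm_succ, arcsineTerm_succ, Finset.smul_sum]
      refine Finset.sum_congr rfl fun x hx => ?_
      have hx := Finset.HasAntidiagonal.mem_antidiagonal.1 hx
      rw [ih _ (by omega), ih _ (by omega), map_smul]
      simp only [mul_smul_comm, smul_mul_assoc, smul_smul]
      congr 1
      rw [← hx]
      ring

/-- First-order Taylor estimate for the coefficient of `arcsineDrift`; on [0, 1] the derivative vᵖ
varies by at most p h. -/
lemma norm_pow_sub_sub_le {s h : ℝ} (hs : 0 ≤ s) (hh : 0 ≤ h) (hsh : s + h ≤ 1) (p : ℕ) :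
    ‖(((s + h : ℝ) : ℂ) ^ (p + 1) / ((p : ℂ) + 1) - (s : ℂ) ^ (p + 1) / ((p : ℂ) + 1)) -
      (h : ℂ) * (s : ℂ) ^ p‖ ≤ p * h ^ 2 := by
  have hd : ∀ v ∈ Set.Icc s (s + h), HasDerivWithinAt
      (fun v : ℝ => v ^ (p + 1) / ((p : ℝ) + 1) - v * s ^ p) (v ^ p - s ^ p)
      (Set.Icc s (s + h)) v := by
    intro v _
    have h1 : HasDerivAt (fun v : ℝ => v ^ (p + 1)) (((p + 1 : ℕ) : ℝ) * v ^ p) v := by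
      simpa using hasDerivAt_pow (p + 1) v
    refine (((h1.div_const ((p : ℝ) + 1)).sub ((hasDerivAt_id v).mul_const
      (s ^ p))).congr_deriv ?_).hasDerivWithinAt
    have : ((p : ℝ) + 1) ≠ 0 := by positivity
    push_cast
    field_simp
  have hb : ∀ v ∈ Set.Icc s (s + h), ‖v ^ p - s ^ p‖ ≤ p * h := by
    intro v hv
    have hv0 : 0 ≤ v := hs.trans hv.1
    have h1 := abs_pow_sub_pow_le v s p
    have h2 : max |v| |s| ^ (p - 1) ≤ 1 := by
      refine pow_le_one₀ (by positivity) (max_le ?_ ?_)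
      · rw [abs_of_nonneg hv0]; linarith [hv.2]
      · rw [abs_of_nonneg hs]; linarith
    have h3 : |v - s| ≤ h := by rw [abs_of_nonneg (by linarith [hv.1])]; linarith [hv.2]
    rw [Real.norm_eq_abs]
    refine h1.trans ?_
    calc |v - s| * p * max |v| |s| ^ (p - 1) ≤ h * p * 1 := by gcongr
      _ = _ := by ring
  have key := (convex_Icc s (s + h)).norm_image_sub_le_of_norm_hasDerivWithin_le hd hb
    (Set.left_mem_Icc.2 (by linarith)) (Set.right_mem_Icc.2 (by linarith))
  rw [add_sub_cancel_left, Real.norm_of_nonneg hh] at key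
  have hcast : ((((s + h : ℝ) : ℂ) ^ (p + 1) / ((p : ℂ) + 1) - (s : ℂ) ^ (p + 1) / ((p : ℂ) + 1)) -
      (h : ℂ) * (s : ℂ) ^ p) = (((s + h) ^ (p + 1) / ((p : ℝ) + 1) - (s + h) * s ^ p -
        (s ^ (p + 1) / ((p : ℝ) + 1) - s * s ^ p) : ℝ) : ℂ) := by
    push_cast
    ring
  rw [hcast, Complex.norm_real]
  exact key.trans (le_of_eq (by ring))

/-- The formal Cauchy transform of `√t` times an arcsine element. -/
noncomputable def arcsineFlow (t : ℝ) : D := ∑' p, (t : ℂ) ^ p • arcsineTerm η β p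

/-- The difference between the argument and the reciprocal Cauchy transform. -/
noncomputable def arcsineDrift (t : ℝ) : D :=
  ∑' p : ℕ, ((t : ℂ) ^ (p + 1) / ((p : ℂ) + 1)) • η (arcsineTerm η β p)

variable {η β}

lemma norm_smul_arcsineTerm_le (hβ : 4 * ‖η‖ * ‖β‖ ^ 2 ≤ 1 / 2) {c : ℂ} {C : ℝ} (hc : ‖c‖ ≤ C)
    (p : ℕ) : ‖c • arcsineTerm η β p‖ ≤ C * ‖β‖ * (1 / 2) ^ p := by
  rw [norm_smul, mul_assoc]
  have := norm_nonneg c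
  gcongr
  · linarith
  · exact (norm_arcsineTerm_le η β p).trans (by gcongr)

lemma norm_ofReal_pow_le {t : ℝ} (h0 : 0 ≤ t) (h1 : t ≤ 1) (p : ℕ) : ‖(t : ℂ) ^ p‖ ≤ 1 := by
  rw [norm_pow, Complex.norm_real, Real.norm_of_nonneg h0]
  exact pow_le_one₀ h0 h1

lemma hasSum_half_bound (C : ℝ) : HasSum (fun p : ℕ => C * (1 / 2) ^ p) (C * 2) :=
  hasSum_geometric_two.mul_left C

lemma summable_arcsineFlow (hβ : 4 * ‖η‖ * ‖β‖ ^ 2 ≤ 1 / 2) {t : ℝ} (h0 : 0 ≤ t) (h1 : t ≤ 1) :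
    Summable fun p => ‖(t : ℂ) ^ p • arcsineTerm η β p‖ :=
  .of_nonneg_of_le (fun _ => norm_nonneg _)
    (fun p => norm_smul_arcsineTerm_le hβ (norm_ofReal_pow_le h0 h1 p) p)
    (hasSum_half_bound (1 * ‖β‖)).summable

lemma norm_arcsineFlow_le (hβ : 4 * ‖η‖ * ‖β‖ ^ 2 ≤ 1 / 2) {t : ℝ} (h0 : 0 ≤ t) (h1 : t ≤ 1) :
    ‖arcsineFlow η β t‖ ≤ 2 * ‖β‖ := by
  refine (tsum_of_norm_bounded (hasSum_half_bound (1 * ‖β‖))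
    (fun p => norm_smul_arcsineTerm_le hβ (norm_ofReal_pow_le h0 h1 p) p)).trans (le_of_eq ?_)
  ring

lemma norm_drift_coeff_le {t : ℝ} (h0 : 0 ≤ t) (h1 : t ≤ 1) (p : ℕ) :
    ‖(t : ℂ) ^ (p + 1) / ((p : ℂ) + 1)‖ ≤ 1 := by
  rw [norm_div, show ((p : ℂ) + 1) = ((p + 1 : ℕ) : ℂ) by push_cast; rfl, Complex.norm_natCast]
  refine div_le_one_of_le₀ ((norm_ofReal_pow_le h0 h1 _).trans ?_) (by positivity)
  exact_mod_cast Nat.succ_pos p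

lemma summable_arcsineDrift (hβ : 4 * ‖η‖ * ‖β‖ ^ 2 ≤ 1 / 2) {t : ℝ} (h0 : 0 ≤ t) (h1 : t ≤ 1) :
    Summable fun p : ℕ => ‖((t : ℂ) ^ (p + 1) / ((p : ℂ) + 1)) • η (arcsineTerm η β p)‖ := by
  refine .of_nonneg_of_le (fun _ => norm_nonneg _) (fun p => ?_)
    (hasSum_half_bound (‖η‖ * (1 * ‖β‖))).summable
  rw [← map_smul, mul_assoc]
  refine (η.le_opNorm _).trans ?_
  gcongr
  exact norm_smul_arcsineTerm_le hβ (norm_drift_coeff_le h0 h1 p) p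

variable [CompleteSpace D]

/-- The recursion for `arcsineTerm`, summed over all degrees: its weight 1/(q + 1) is the
coefficient in the drift. -/
lemma arcsineFlow_eq (hβ : 4 * ‖η‖ * ‖β‖ ^ 2 ≤ 1 / 2) {t : ℝ} (h0 : 0 ≤ t) (h1 : t ≤ 1) :
    arcsineFlow η β t = β + β * arcsineDrift η β t * arcsineFlow η β t := by
  have hs := summable_arcsineFlow hβ h0 h1
  have hd := summable_arcsineDrift hβ h0 h1
  rw [mul_assoc]
  conv_lhs => rw [arcsineFlow, hs.of_norm.tsum_eq_zero_add]
  rw [pow_zero, one_smul, arcsineTerm_zero]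
  congr 1
  rw [arcsineDrift, arcsineFlow, tsum_mul_tsum_eq_tsum_sum_antidiagonal_of_summable_norm hd hs,
    ← (summable_norm_sum_mul_antidiagonal_of_summable_norm hd hs).of_norm.tsum_mul_left]
  refine tsum_congr fun p => ?_
  rw [arcsineTerm_succ, Finset.mul_sum, Finset.smul_sum]
  refine Finset.sum_congr rfl fun x hx => ?_
  have hx := Finset.HasAntidiagonal.mem_antidiagonal.1 hx
  simp only [mul_smul_comm, smul_mul_assoc, smul_smul, mul_assoc]
  congr 1
  rw [← hx]
  ring

lemma sub_arcsineDrift_mul (hβ : 4 * ‖η‖ * ‖β‖ ^ 2 ≤ 1 / 2) {w : D} (hw : w * β = 1) {t : ℝ}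
    (h0 : 0 ≤ t) (h1 : t ≤ 1) : (w - arcsineDrift η β t) * arcsineFlow η β t = 1 := by
  have : w * arcsineFlow η β t = 1 + arcsineDrift η β t * arcsineFlow η β t := by
    conv_lhs => rw [arcsineFlow_eq hβ h0 h1]
    rw [mul_add, ← mul_assoc, ← mul_assoc, hw, one_mul]
  rw [sub_mul, this, add_sub_cancel_right]

/-- Termwise the drift has derivative η(flow). As the flow is inverse to w - drift, the latter
solves F' = -η(F⁻¹), and this is the local error of an Euler step. -/
lemma norm_arcsineDrift_sub_le (hβ : 4 * ‖η‖ * ‖β‖ ^ 2 ≤ 1 / 2) {t h : ℝ} (h0 : 0 ≤ t)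
    (hh : 0 ≤ h) (h1 : t + h ≤ 1) :
    ‖arcsineDrift η β (t + h) - arcsineDrift η β t - (h : ℂ) • η (arcsineFlow η β t)‖ ≤
      2 * ‖η‖ * ‖β‖ * h ^ 2 := by
  have hs := (summable_arcsineFlow hβ h0 (by linarith : t ≤ 1)).of_norm
  have hd1 := (summable_arcsineDrift hβ (by linarith : 0 ≤ t + h) h1).of_norm
  have hd2 := (summable_arcsineDrift hβ h0 (by linarith : t ≤ 1)).of_norm
  rw [arcsineFlow, η.map_tsum hs, ← (η.summable hs).tsum_const_smul, arcsineDrift, arcsineDrift,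
    ← hd1.tsum_sub hd2, ← (hd1.sub hd2).tsum_sub ((η.summable hs).const_smul _)]
  have hsum : HasSum (fun p : ℕ => ‖η‖ * ‖β‖ * h ^ 2 * (p * (1 / 2) ^ p)) (‖η‖ * ‖β‖ * h ^ 2 * 2) := by
    have := (hasSum_coe_mul_geometric_of_norm_lt_one (r := (1 / 2 : ℝ)) (by norm_num)).mul_left
      (‖η‖ * ‖β‖ * h ^ 2)
    norm_num at this
    simpa using this
  refine (tsum_of_norm_bounded hsum fun p => ?_).trans (le_of_eq (by ring))
  rw [← map_smul, ← map_smul, ← map_smul, ← map_sub, ← map_sub, smul_smul, ← sub_smul,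
    ← sub_smul]
  refine (η.le_opNorm _).trans ?_
  have := norm_smul_arcsineTerm_le hβ (norm_pow_sub_sub_le h0 hh h1 p) p
  calc _ ≤ ‖η‖ * (p * h ^ 2 * ‖β‖ * (1 / 2) ^ p) := by gcongr
    _ = _ := by ring

end Flow

/-! ### Gronwall estimate and convergence of the Euler scheme -/

section Gronwall

lemma le_of_discrete_gronwall {d : ℕ → ℝ} {L ε : ℝ} (hL : 0 ≤ L) (hε : 0 ≤ ε) (h0 : d 0 ≤ 0)
    {n : ℕ} (h : ∀ j < n, d (j + 1) ≤ (1 + L) * d j + ε) :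
    d n ≤ n * ε * (1 + L) ^ n := by
  have : ∀ j ≤ n, d j ≤ j * ε * (1 + L) ^ j := by
    intro j
    induction j with
    | zero => intro _; simpa using h0
    | succ j ih =>
      intro hj
      have h1 : 1 ≤ (1 + L) ^ (j + 1) := one_le_pow₀ (by linarith)
      calc d (j + 1) ≤ (1 + L) * d j + ε := h j (by omega)
        _ ≤ (1 + L) * (j * ε * (1 + L) ^ j) + ε * (1 + L) ^ (j + 1) := by
          gcongr
          · exact ih (by omega)
          · exact le_mul_of_one_le_right hε h1
        _ = _ := by push_cast; ring
  exact this n le_rfl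

variable {D : Type*} [CStarAlgebra D] [PartialOrder D] [StarOrderedRing D] {η : D →L[ℂ] D}
  {β w : D}

/-- Convergence of the Euler scheme. -/
lemma norm_inverse_sub_arcsineFlow_le (hβ : 4 * ‖η‖ * ‖β‖ ^ 2 ≤ 1 / 2) (hwβ : w * β = 1) {δ : ℝ}
    (hδ : 0 < δ) {n : ℕ} (hn : 0 < n) {e : ℝ} (he : 0 ≤ e) {W : ℕ → D} (hW0 : W 0 = w)
    (hW : ∀ j, ImGE δ (W j))
    (hstep : ∀ j, ‖W (j + 1) - (W j - (n : ℂ)⁻¹ • η (Ring.inverse (W j)))‖ ≤ e) :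
    ‖Ring.inverse (W n) - arcsineFlow η β 1‖ ≤ δ⁻¹ * (2 * ‖β‖) *
      ((n * e + 2 * ‖η‖ * ‖β‖ * (n : ℝ)⁻¹) * Real.exp (‖η‖ * δ⁻¹ * (2 * ‖β‖))) := by
  have hn0 : (0 : ℝ) < n := by exact_mod_cast hn
  set h : ℝ := (n : ℝ)⁻¹ with hh
  have hh0 : 0 ≤ h := by positivity
  let F : ℕ → D := fun j => w - arcsineDrift η β (j * h)
  have ht : ∀ j ≤ n, (0 : ℝ) ≤ j * h ∧ (j : ℝ) * h ≤ 1 := by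
    intro j hj
    refine ⟨by positivity, ?_⟩
    rw [hh, ← div_eq_mul_inv]
    exact div_le_one_of_le₀ (by exact_mod_cast hj) hn0.le
  -- Along both curves the inverses are bounded, so inversion is Lipschitz here; this is the
  -- Lipschitz condition of the Gronwall argument.
  have hinv : ∀ j ≤ n, ‖Ring.inverse (W j) - arcsineFlow η β (j * h)‖ ≤
      δ⁻¹ * (2 * ‖β‖) * ‖W j - F j‖ := by
    intro j hj
    obtain ⟨ht0, ht1⟩ := ht j hj
    have h1 : Ring.inverse (W j) - arcsineFlow η β (j * h) =
        Ring.inverse (W j) * (F j - W j) * arcsineFlow η β (j * h) := by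
      rw [mul_assoc, sub_mul, sub_arcsineDrift_mul hβ hwβ ht0 ht1, mul_sub, mul_one, ← mul_assoc,
        Ring.inverse_mul_cancel _ ((hW j).isUnit hδ), one_mul]
    rw [h1]
    calc _ ≤ ‖Ring.inverse (W j)‖ * ‖F j - W j‖ * ‖arcsineFlow η β (j * h)‖ :=
          (norm_mul_le _ _).trans (by gcongr; exact norm_mul_le _ _)
      _ ≤ δ⁻¹ * ‖F j - W j‖ * (2 * ‖β‖) := by
          gcongr
          · exact (hW j).norm_inverse_le hδ
          · exact norm_arcsineFlow_le hβ ht0 ht1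
      _ = _ := by rw [norm_sub_rev]; ring
  have hdrift0 : arcsineDrift η β 0 = 0 := by simp [arcsineDrift]
  have hrec : ∀ j < n, ‖W (j + 1) - F (j + 1)‖ ≤
      (1 + h * (‖η‖ * δ⁻¹ * (2 * ‖β‖))) * ‖W j - F j‖ + (e + 2 * ‖η‖ * ‖β‖ * h ^ 2) := by
    intro j hj
    have h1 := hinv j hj.le
    obtain ⟨ht0, ht1⟩ := ht j hj.le
    have h2 := (ht (j + 1) hj).2
    have hcast : ((j + 1 : ℕ) : ℝ) * h = j * h + h := by push_cast; ring
    rw [hcast] at h2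
    have h3 := norm_arcsineDrift_sub_le hβ ht0 hh0 h2
    have hc : (n : ℂ)⁻¹ = ((h : ℝ) : ℂ) := by rw [hh]; push_cast; rfl
    have hdec : W (j + 1) - F (j + 1) =
        (W j - F j) - (h : ℂ) • η (Ring.inverse (W j) - arcsineFlow η β (j * h)) +
        ((W (j + 1) - (W j - (n : ℂ)⁻¹ • η (Ring.inverse (W j)))) +
        (arcsineDrift η β (j * h + h) - arcsineDrift η β (j * h) -
          (h : ℂ) • η (arcsineFlow η β (j * h)))) := by
      simp only [F, hcast, map_sub, smul_sub, hc]
      abel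
    rw [hdec]
    refine (norm_add_le _ _).trans (add_le_add ((norm_sub_le _ _).trans ?_)
      ((norm_add_le _ _).trans (add_le_add (hstep j) h3)))
    rw [add_mul, one_mul, norm_smul, Complex.norm_real, Real.norm_of_nonneg hh0, mul_assoc h]
    gcongr
    refine (η.le_opNorm _).trans ?_
    rw [mul_assoc, mul_assoc]
    gcongr
    rwa [← mul_assoc]
  have hfin := le_of_discrete_gronwall (d := fun j => ‖W j - F j‖) (by positivity) (by positivity)
    (by simp [F, hW0, hdrift0]) hrec
  have hexp : (1 + h * (‖η‖ * δ⁻¹ * (2 * ‖β‖))) ^ n ≤ Real.exp (‖η‖ * δ⁻¹ * (2 * ‖β‖)) := by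
    have : (1 + h * (‖η‖ * δ⁻¹ * (2 * ‖β‖))) ≤ Real.exp (h * (‖η‖ * δ⁻¹ * (2 * ‖β‖))) := by
      rw [add_comm]
      exact Real.add_one_le_exp _
    refine (pow_le_pow_left₀ (by positivity) this n).trans (le_of_eq ?_)
    rw [← Real.exp_nat_mul, ← mul_assoc, hh, mul_inv_cancel₀ hn0.ne', one_mul]
  have hlast := hinv n le_rfl
  rw [show (n : ℝ) * h = 1 from mul_inv_cancel₀ hn0.ne'] at hlast
  refine hlast.trans ?_
  gcongr
  refine hfin.trans ?_
  have he' : (n : ℝ) * (e + 2 * ‖η‖ * ‖β‖ * h ^ 2) = n * e + 2 * ‖η‖ * ‖β‖ * h := by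
    rw [hh]; field_simp
  rw [he']
  gcongr

end Gronwall

/-! ### Convergence of moments -/

/-- The coefficients of power series with uniform geometric bounds converge if the power series
converge near the origin. -/
lemma tendsto_coeff_of_tendsto_tsum {V : Type*} [NormedAddCommGroup V] [NormedSpace ℂ V]
    [CompleteSpace V] {d : ℕ → ℕ → V} {C r z₀ : ℝ} (hr : 0 < r) (hd : ∀ N n, ‖d N n‖ ≤ C * r ^ n)
    (hz₀ : 0 < z₀)
    (h : ∀ z : ℝ, 0 < z → z < z₀ → Tendsto (fun N => ∑' n, (z : ℂ) ^ n • d N n) atTop (𝓝 0))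
    (n : ℕ) : Tendsto (fun N => d N n) atTop (𝓝 0) := by
  have hC : 0 ≤ C := by simpa using (norm_nonneg _).trans (hd 0 0)
  induction n using Nat.strong_induction_on with
  | _ n ih =>
    have hsmall : ∀ᶠ z : ℝ in 𝓝[>] 0, z < z₀ ∧ z * r ≤ 1 / 2 := by
      have h1 : Tendsto (fun z : ℝ => z * r) (𝓝[>] 0) (𝓝 0) := by
        have : Tendsto (fun z : ℝ => z * r) (𝓝 0) (𝓝 (0 * r)) := (continuous_mul_const r).tendsto 0
        rw [zero_mul] at this
        exact this.mono_left nhdsWithin_le_nhds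
      exact (eventually_nhdsWithin_of_eventually_nhds (eventually_lt_nhds hz₀)).and
        (h1.eventually_le_const (by norm_num))
    -- The n-th term is isolated and divided by zⁿ. The tail is O(z) uniformly in N, so z is chosen
    -- small first and N large afterwards; the lower coefficients vanish by induction.
    have key : ∀ z : ℝ, 0 < z → z < z₀ → z * r ≤ 1 / 2 → ∀ N, ‖d N n‖ ≤
        (z ^ n)⁻¹ * (‖∑' m, (z : ℂ) ^ m • d N m‖ + ∑ m ∈ Finset.range n, z ^ m * ‖d N m‖) +
          2 * C * r ^ (n + 1) * z := by
      intro z hz hz1 hz2 N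
      have hterm : ∀ m, ‖(z : ℂ) ^ m • d N m‖ ≤ C * (z * r) ^ m := by
        intro m
        rw [norm_smul, norm_pow, Complex.norm_real, Real.norm_of_nonneg hz.le, mul_pow]
        calc z ^ m * ‖d N m‖ ≤ z ^ m * (C * r ^ m) := by gcongr; exact hd N m
          _ = _ := by ring
      have hsum : Summable fun m => (z : ℂ) ^ m • d N m :=
        .of_norm_bounded ((summable_geometric_of_lt_one (by positivity) (by linarith)).mul_left C)
          hterm
      have htail : ‖∑' m, (z : ℂ) ^ (m + (n + 1)) • d N (m + (n + 1))‖ ≤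
          C * (z * r) ^ (n + 1) * 2 := by
        refine tsum_of_norm_bounded (hasSum_half_bound (C * (z * r) ^ (n + 1))) fun m =>
          (hterm _).trans ?_
        rw [pow_add, mul_comm ((z * r) ^ m), ← mul_assoc]
        gcongr
      have hsplit := hsum.sum_add_tsum_nat_add (n + 1)
      rw [Finset.sum_range_succ] at hsplit
      have hdn : (z : ℂ) ^ n • d N n = ∑' m, (z : ℂ) ^ m • d N m -
          ∑ m ∈ Finset.range n, (z : ℂ) ^ m • d N m -
          ∑' m, (z : ℂ) ^ (m + (n + 1)) • d N (m + (n + 1)) := by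
        rw [← hsplit]; abel
      have hnorm : z ^ n * ‖d N n‖ ≤ (‖∑' m, (z : ℂ) ^ m • d N m‖ +
          ∑ m ∈ Finset.range n, z ^ m * ‖d N m‖) + C * (z * r) ^ (n + 1) * 2 := by
        have h1 : ‖(z : ℂ) ^ n • d N n‖ = z ^ n * ‖d N n‖ := by
          rw [norm_smul, norm_pow, Complex.norm_real, Real.norm_of_nonneg hz.le]
        rw [← h1, hdn]
        refine (norm_sub_le _ _).trans (add_le_add ((norm_sub_le _ _).trans ?_) htail)
        gcongr
        refine (norm_sum_le _ _).trans (le_of_eq (Finset.sum_congr rfl fun m _ => ?_))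
        rw [norm_smul, norm_pow, Complex.norm_real, Real.norm_of_nonneg hz.le]
      have hzn : 0 < z ^ n := by positivity
      rw [← mul_le_mul_iff_right₀ hzn]
      refine hnorm.trans (le_of_eq ?_)
      rw [mul_add, mul_inv_cancel_left₀ hzn.ne']
      ring
    rw [Metric.tendsto_atTop']
    intro ε hε
    have hzlim : ∀ᶠ z : ℝ in 𝓝[>] 0, 2 * C * r ^ (n + 1) * z < ε / 2 := by
      have : Tendsto (fun z : ℝ => 2 * C * r ^ (n + 1) * z) (𝓝 0) (𝓝 (2 * C * r ^ (n + 1) * 0)) :=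
        (continuous_const_mul _).tendsto 0
      rw [mul_zero] at this
      exact (this.mono_left nhdsWithin_le_nhds).eventually_lt_const (by linarith)
    obtain ⟨z, ⟨⟨hz1, hz2⟩, hz3⟩, hz⟩ :=
      ((hsmall.and hzlim).and self_mem_nhdsWithin).exists
    have hz : 0 < z := hz
    have hlim : Tendsto (fun N => (z ^ n)⁻¹ * (‖∑' m, (z : ℂ) ^ m • d N m‖ +
        ∑ m ∈ Finset.range n, z ^ m * ‖d N m‖)) atTop (𝓝 0) := by
      have h1 : Tendsto (fun N => (z ^ n)⁻¹ * (‖∑' m, (z : ℂ) ^ m • d N m‖ +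
        ∑ m ∈ Finset.range n, z ^ m * ‖d N m‖)) atTop
          (𝓝 ((z ^ n)⁻¹ * (‖(0 : V)‖ + ∑ m ∈ Finset.range n, z ^ m * ‖(0 : V)‖))) := by
        refine Tendsto.const_mul _ ((h z hz hz1).norm.add (tendsto_finsetSum _ fun m hm => ?_))
        exact (ih m (Finset.mem_range.1 hm)).norm.const_mul _
      simpa using h1
    obtain ⟨N₀, hN₀⟩ := eventually_atTop.1 (hlim.eventually_lt_const (by linarith : (0 : ℝ) < ε / 2))
    refine ⟨N₀, fun N hN => ?_⟩
    rw [dist_zero_right]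
    have := key z hz hz1 hz2 N
    have := hN₀ N hN.le
    linarith

namespace CondExp

variable {D M : Type*} [CStarAlgebra D] [PartialOrder D] [StarOrderedRing D]
    [CStarAlgebra M] [PartialOrder M] [StarOrderedRing M] {𝔼 : CondExp D M}
    {η : D →L[ℂ] D}

/-- The coefficients of the expansion of the Cauchy transform of an arcsine element. -/
noncomputable def arcsineCoeff {D : Type*} [NormedRing D] [NormedAlgebra ℂ D] (η : D →L[ℂ] D)
    (β : D) (n : ℕ) : D :=
  if Even n then arcsineTerm η β (n / 2) else 0

lemma norm_arcsineCoeff_le (β : D) (n : ℕ) :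
    ‖arcsineCoeff η β n‖ ≤ ‖β‖ * (1 + 4 * ‖η‖ * ‖β‖ ^ 2) ^ n := by
  rw [arcsineCoeff]
  split_ifs
  · refine (norm_arcsineTerm_le η β _).trans ?_
    gcongr
    calc (4 * ‖η‖ * ‖β‖ ^ 2) ^ (n / 2) ≤ (1 + 4 * ‖η‖ * ‖β‖ ^ 2) ^ (n / 2) := by
          gcongr; linarith
      _ ≤ _ := pow_le_pow_right₀ (by linarith [show 0 ≤ 4 * ‖η‖ * ‖β‖ ^ 2 by positivity])
        (Nat.div_le_self _ _)
  · rw [norm_zero]; positivity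

lemma hasSum_arcsineCoeff {β : D} {z : ℝ} (hz : 4 * ‖η‖ * ‖(z : ℂ) • β‖ ^ 2 ≤ 1 / 2) :
    HasSum (fun n => (z : ℂ) ^ (n + 1) • arcsineCoeff η β n) (arcsineFlow η ((z : ℂ) • β) 1) := by
  have h1 : HasSum (fun p => (z : ℂ) ^ (2 * p + 1) • arcsineCoeff η β (2 * p))
      (arcsineFlow η ((z : ℂ) • β) 1) := by
    have := (summable_arcsineFlow hz zero_le_one le_rfl).of_norm.hasSum
    have heq : (fun p => (z : ℂ) ^ (2 * p + 1) • arcsineCoeff η β (2 * p)) =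
        fun p => ((1 : ℝ) : ℂ) ^ p • arcsineTerm η ((z : ℂ) • β) p := by
      funext p
      rw [arcsineTerm_smul_right]
      simp [arcsineCoeff]
    rw [heq]
    exact this
  have h2 : HasSum (fun p => (z : ℂ) ^ (2 * p + 1 + 1) • arcsineCoeff η β (2 * p + 1)) 0 := by
    have : ∀ p, arcsineCoeff η β (2 * p + 1) = 0 := fun p => if_neg (by simp)
    simp only [this, smul_zero]
    exact hasSum_zero
  simpa using h1.even_add_odd (f := fun n => (z : ℂ) ^ (n + 1) • arcsineCoeff η β n) h2

/-- Neumann series at w/z, whose inverse is zβ: the moments are the coefficients of a power series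
in z. -/
lemma hasSum_cauchy {Y : M} {β w : D} (hwβ : w * β = 1) (hβw : β * w = 1) {z : ℝ} (hz : 0 < z)
    (hlt : z * ‖β‖ * ‖Y‖ < 1) :
    HasSum (fun n => (z : ℂ) ^ (n + 1) • 𝔼.E ((𝔼.ι β * Y) ^ n * 𝔼.ι β))
      (𝔼.cauchy Y ((z : ℂ)⁻¹ • w)) := by
  have hz' : (z : ℂ) ≠ 0 := by exact_mod_cast hz.ne'
  have h1 : 𝔼.ι ((z : ℂ)⁻¹ • w) * 𝔼.ι ((z : ℂ) • β) = 1 := by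
    rw [← map_mul, smul_mul_smul_comm, inv_mul_cancel₀ hz', hwβ, one_smul, map_one]
  have h2 : 𝔼.ι ((z : ℂ) • β) * 𝔼.ι ((z : ℂ)⁻¹ • w) = 1 := by
    rw [← map_mul, smul_mul_smul_comm, mul_inv_cancel₀ hz', hβw, one_smul, map_one]
  have hinv := Ring.inverse_eq_of_mul_eq_one h1 h2
  have hu : IsUnit (𝔼.ι ((z : ℂ)⁻¹ • w)) := ⟨⟨_, _, h1, h2⟩, rfl⟩
  have hsmall : ‖Ring.inverse (𝔼.ι ((z : ℂ)⁻¹ • w)) * Y‖ < 1 := by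
    rw [hinv]
    refine lt_of_le_of_lt ((norm_mul_le _ _).trans ?_) hlt
    gcongr
    refine (𝔼.norm_ι_le _).trans (le_of_eq ?_)
    rw [norm_smul, Complex.norm_real, Real.norm_of_nonneg hz.le]
  have hs := (summable_norm_neumann hsmall).of_norm.hasSum
  rw [tsum_neumann hu hsmall, hinv] at hs
  have := 𝔼.toCLM.hasSum hs
  have heq : (fun n => (z : ℂ) ^ (n + 1) • 𝔼.E ((𝔼.ι β * Y) ^ n * 𝔼.ι β)) =
      fun n => 𝔼.toCLM ((𝔼.ι ((z : ℂ) • β) * Y) ^ n * 𝔼.ι ((z : ℂ) • β)) := by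
    funext n
    simp only [toCLM_apply, map_smul, smul_mul_assoc, smul_pow, mul_smul_comm, smul_smul]
    rw [← pow_succ']
  rw [heq]
  exact this

/-- Convergence of Cauchy transforms implies convergence of moments. -/
lemma tendsto_moment {Y : ℕ → M} {R : ℝ} (hY : ∀ N, ‖Y N‖ ≤ R) {β w : D} (hwβ : w * β = 1)
    (hβw : β * w = 1) {z₀ : ℝ} (hz₀ : 0 < z₀)
    (h : ∀ z : ℝ, 0 < z → z < z₀ → Tendsto (fun N => 𝔼.cauchy (Y N) ((z : ℂ)⁻¹ • w)) atTop
      (𝓝 (arcsineFlow η ((z : ℂ) • β) 1))) (n : ℕ) :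
    Tendsto (fun N => 𝔼.E ((𝔼.ι β * Y N) ^ n * 𝔼.ι β)) atTop (𝓝 (arcsineCoeff η β n)) := by
  have hR : 0 ≤ R := (norm_nonneg _).trans (hY 0)
  set ρ : ℝ := ‖β‖ * R + (1 + 4 * ‖η‖ * ‖β‖ ^ 2) with hρ
  have hρ1 : 1 ≤ ρ := by
    have : 0 ≤ ‖β‖ * R := by positivity
    have : 0 ≤ 4 * ‖η‖ * ‖β‖ ^ 2 := by positivity
    linarith
  set d : ℕ → ℕ → D := fun N n => 𝔼.E ((𝔼.ι β * Y N) ^ n * 𝔼.ι β) - arcsineCoeff η β n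
  have hd : ∀ N n, ‖d N n‖ ≤ 2 * ‖β‖ * ρ ^ n := by
    intro N n
    have h1 : ‖𝔼.E ((𝔼.ι β * Y N) ^ n * 𝔼.ι β)‖ ≤ ‖β‖ * ρ ^ n := by
      refine (𝔼.norm_E_le _).trans ((norm_mul_le _ _).trans ?_)
      rw [mul_comm]
      gcongr
      · exact 𝔼.norm_ι_le β
      · have hb : ‖𝔼.ι β * Y N‖ ≤ ρ := by
          have : ‖𝔼.ι β * Y N‖ ≤ ‖β‖ * R :=
            (norm_mul_le _ _).trans (mul_le_mul (𝔼.norm_ι_le β) (hY N) (norm_nonneg _)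
              (norm_nonneg _))
          have : 0 ≤ 4 * ‖η‖ * ‖β‖ ^ 2 := by positivity
          linarith
        rcases n.eq_zero_or_pos with rfl | hn
        · rcases subsingleton_or_nontrivial M with hM | hM
          · simp [Subsingleton.elim (_ : M) 0]
          · simp
        · exact (norm_pow_le' _ hn).trans (by gcongr)
    have h2 : ‖arcsineCoeff η β n‖ ≤ ‖β‖ * ρ ^ n := by
      refine (norm_arcsineCoeff_le β n).trans ?_
      gcongr
      rw [hρ]
      exact le_add_of_nonneg_left (by positivity)
    exact (norm_sub_le _ _).trans (by linarith)
  have hlim : Tendsto (fun N => d N n) atTop (𝓝 0) := by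
    -- The number ρ dominates both ‖β‖R and 4‖η‖‖β‖², so below this threshold the Neumann series and
    -- the arcsine series both converge.
    have hz₁ : 0 < min z₀ (4 * ρ * (1 + ‖β‖))⁻¹ := lt_min hz₀ (by positivity)
    refine tendsto_coeff_of_tendsto_tsum (by linarith) hd hz₁ (fun z hz hlt => ?_) n
    have hz' : (z : ℂ) ≠ 0 := by exact_mod_cast hz.ne'
    have hz1 : z * (4 * ρ * (1 + ‖β‖)) < 1 := by
      rw [← lt_div_iff₀ (by positivity), one_div]
      exact hlt.trans_le (min_le_right _ _)
    have hR1 : z * ‖β‖ * R < 1 := by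
      have : ‖β‖ * R ≤ ρ := by
        have : 0 ≤ 4 * ‖η‖ * ‖β‖ ^ 2 := by positivity
        linarith
      nlinarith [norm_nonneg β, mul_nonneg hz.le (norm_nonneg β),
        mul_nonneg (mul_nonneg hz.le (norm_nonneg β)) (by linarith : 0 ≤ ρ)]
    have hη1 : 4 * ‖η‖ * ‖(z : ℂ) • β‖ ^ 2 ≤ 1 / 2 := by
      rw [norm_smul, Complex.norm_real, Real.norm_of_nonneg hz.le, mul_pow]
      have h1 : 4 * ‖η‖ * ‖β‖ ^ 2 ≤ ρ := by
        have : 0 ≤ ‖β‖ * R := by positivity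
        linarith
      have h2 : z * ρ ≤ 1 / 4 := by
        nlinarith [mul_nonneg (mul_nonneg hz.le (norm_nonneg β)) (by linarith : 0 ≤ ρ)]
      have h3 : z ≤ 1 := by nlinarith
      calc 4 * ‖η‖ * (z ^ 2 * ‖β‖ ^ 2) = z * (z * (4 * ‖η‖ * ‖β‖ ^ 2)) := by ring
        _ ≤ 1 * (z * ρ) := by gcongr
        _ ≤ 1 / 2 := by linarith
    have hkey : ∀ N, ∑' n, (z : ℂ) ^ n • d N n =
        (z : ℂ)⁻¹ • (𝔼.cauchy (Y N) ((z : ℂ)⁻¹ • w) - arcsineFlow η ((z : ℂ) • β) 1) := by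
      intro N
      have hc := hasSum_cauchy (𝔼 := 𝔼) hwβ hβw hz (Y := Y N) (lt_of_le_of_lt (by gcongr; exact hY N) hR1)
      have := ((hc.sub (hasSum_arcsineCoeff hη1)).const_smul (z : ℂ)⁻¹).tsum_eq
      rw [← this]
      refine tsum_congr fun n => ?_
      rw [← smul_sub, smul_smul, pow_succ', inv_mul_cancel_left₀ hz']
    simp only [hkey]
    have := ((h z hz (hlt.trans_le (min_le_left _ _))).sub_const
      (arcsineFlow η ((z : ℂ) • β) 1)).const_smul (z : ℂ)⁻¹
    simpa using this
  simpa [d] using hlim.add_const (arcsineCoeff η β n)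

end CondExp

/-! ### Limits of moments -/

section HalfPlane

variable {M : Type*} [CStarAlgebra M] [PartialOrder M] [StarOrderedRing M]

lemma ImGE.exists_neg_inverse {δ : ℝ} (hδ : 0 < δ) {v : M} (h : ImGE δ v) :
    ∃ δ' : ℝ, 0 < δ' ∧ ImGE δ' (-Ring.inverse v) := by
  have hu := h.isUnit hδ
  set ρ := Ring.inverse v
  have hρu : IsUnit ρ := isUnit_ringInverse.2 hu
  have hr : 0 < (‖Ring.inverse (star ρ * ρ)‖ + 1)⁻¹ := by positivity
  have hr' := ((hρu.star.mul hρu).isStrictlyPositive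
    (star_mul_self_nonneg ρ)).algebraMap_inv_le (inv_pos.1 hr) (le_add_of_nonneg_right zero_le_one)
  refine ⟨δ * (‖Ring.inverse (star ρ * ρ)‖ + 1)⁻¹, mul_pos hδ hr, ?_⟩
  unfold ImGE
  rw [map_neg, AddSubgroup.coe_neg, imaginaryPart_inverse hu, neg_neg]
  refine le_trans ?_ (algebraMap_le_conj h ρ)
  rw [Algebra.algebraMap_eq_smul_one, mul_smul, ← Algebra.algebraMap_eq_smul_one]
  exact smul_le_smul_of_nonneg_left hr' hδ.le

lemma imGE_neg_norm (a : M) : ImGE (-‖a‖) a := by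
  unfold ImGE
  have h := (imaginaryPart a).2.neg_algebraMap_norm_le_self
  rw [map_neg]
  refine le_trans (neg_le_neg (algebraMap_mono M (norm_imaginaryPart_le a))) h

lemma ImGE.complex_smul {δ : ℝ} {a : M} (h : ImGE δ a) {t : ℝ} (ht : 0 ≤ t) :
    ImGE (t * δ) ((t : ℂ) • a) := by
  rw [Complex.coe_smul]
  exact h.smul ht

/-- Every element is, up to a scalar, the inverse of an element of the upper half plane. -/
lemma exists_imGE_mul_eq_one (U : M) : ∃ (c : ℂ) (w : M) (δ : ℝ), 0 < δ ∧ ImGE δ w ∧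
    w * (U + c • 1) = 1 ∧ (U + c • 1) * w = 1 := by
  set l : ℝ := ‖U‖ + 1 with hl
  -- With l = ‖U‖ + 1 this has imaginary part at least 1, so -v⁻¹ lies in the upper half plane and
  -- is the inverse of U - l i.
  set v : M := algebraMap ℂ M (l * Complex.I) + -U with hv
  have h1 : ImGE 1 v := by
    have := (imGE_algebraMap (M := M) (l * Complex.I)).add (imGE_neg_norm (-U))
    refine this.mono ?_
    simp [hl]
  have hu := h1.isUnit one_pos
  obtain ⟨δ, hδ, h⟩ := h1.exists_neg_inverse one_pos
  have hβ : U + (-(l * Complex.I)) • (1 : M) = -v := by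
    rw [hv, Algebra.algebraMap_eq_smul_one, neg_smul]
    abel
  refine ⟨-(l * Complex.I), -Ring.inverse v, δ, hδ, h, ?_, ?_⟩
  · rw [hβ, neg_mul_neg, Ring.inverse_mul_cancel _ hu]
  · rw [hβ, neg_mul_neg, Ring.mul_inverse_cancel _ hu]

end HalfPlane

namespace OVProbSpace

open CStarMatrix

variable {B : Type u} [CStarAlgebra B] [PartialOrder B] [StarOrderedRing B]
  {A : Type v} [CStarAlgebra A] [PartialOrder A] [StarOrderedRing A] {P : OVProbSpace B A}
  {k : ℕ}

/-- The comparison is with the formal series, since the existence of an arcsine element is yet to be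
derived from it. The exponential constant is harmless: it does not depend on the cumulant. -/
lemma norm_cauchy_sub_arcsineFlow_le {Y : A} (η : B →L[ℂ] B) (hY : IsSelfAdjoint Y)
    (hdiv : ∀ n : ℕ, 0 < n → IsMonotoneDivisible.{u, v, z} P Y n) (hmean : P.E Y = 0)
    (hvar : ∀ b, P.E (Y * P.ι b * Y) = η b)
    {ηk : CStarMatrix (Fin k) (Fin k) B →L[ℂ] CStarMatrix (Fin k) (Fin k) B}
    (hη : ∀ d i j, ηk d i j = η (d i j)) {δ : ℝ} (hδ : 0 < δ)
    {β w : CStarMatrix (Fin k) (Fin k) B} (hβ : 4 * ‖ηk‖ * ‖β‖ ^ 2 ≤ 1 / 2) (hwβ : w * β = 1)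
    (hw : ImGE δ w) :
    ‖(P.amp k).cauchy (diagHom A k Y) w - arcsineFlow ηk β 1‖ ≤ δ⁻¹ * (2 * ‖β‖) *
      ((k * δ⁻¹ ^ 2 * √(sSup (P.fourthCumulantNorms Y)) * √‖η 1‖) *
        Real.exp (‖ηk‖ * δ⁻¹ * (2 * ‖β‖))) := by
  set e : ℕ → ℝ := stepError k δ⁻¹ ‖η 1‖ (sSup (P.fourthCumulantNorms Y)) (3 / 2 * ‖η‖ ^ 2) with he
  have hlim : Tendsto (fun n : ℕ => (n : ℝ) * e n) atTop
    (𝓝 (k * δ⁻¹ ^ 2 * √(sSup (P.fourthCumulantNorms Y)) * √‖η 1‖)) := tendsto_stepError _ _ _ _ _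
  have h0 : Tendsto (fun n : ℕ => (n : ℝ)⁻¹) atTop (𝓝 0) := tendsto_inv_atTop_nhds_zero_nat
  have hbound := ((hlim.add (h0.const_mul (2 * ‖ηk‖ * ‖β‖))).mul_const
    (Real.exp (‖ηk‖ * δ⁻¹ * (2 * ‖β‖)))).const_mul (δ⁻¹ * (2 * ‖β‖))
  rw [mul_zero, add_zero] at hbound
  have hsmall : ∀ᶠ n : ℕ in atTop, δ⁻¹ ^ 2 * ((n : ℝ)⁻¹ * ‖η 1‖) ≤ 1 / 2 := by
    have := (h0.mul_const ‖η 1‖).const_mul (δ⁻¹ ^ 2)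
    rw [zero_mul, mul_zero] at this
    exact this.eventually_le_const (by norm_num)
  refine ge_of_tendsto hbound ?_
  filter_upwards [hsmall, eventually_gt_atTop 0] with n hn hn0
  obtain ⟨W, hW0, hW, hWn, hstep⟩ := (hdiv n hn0).exists_euler_scheme η hn0 hY hmean hvar hη hδ hw hn
  rw [hWn]
  exact norm_inverse_sub_arcsineFlow_le hβ hwβ hδ hn0 (stepError_nonneg _ (by positivity) _ _ _ _)
    hW0 hW hstep

/-- The moments of a bounded sequence of infinitely divisible elements whose fourth cumulants vanish
in the limit converge to those of an arcsine element. -/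
lemma tendsto_E_wordProd {Y : ℕ → A} (η : B →L[ℂ] B) (hY : ∀ N, IsSelfAdjoint (Y N))
    (hdiv : ∀ N, ∀ n : ℕ, 0 < n → IsMonotoneDivisible.{u, v, z} P (Y N) n)
    (hmean : ∀ N, P.E (Y N) = 0) (hvar : ∀ N b, P.E (Y N * P.ι b * Y N) = η b) {R : ℝ}
    (hR : ∀ N, ‖Y N‖ ≤ R)
    (hlim : Tendsto (fun N => sSup (P.fourthCumulantNorms (Y N))) atTop (𝓝 0)) (l : List B) :
    Tendsto (fun N => P.E (P.wordProd (Y N) l)) atTop (𝓝 (arcsineMoment η l)) := by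
  rcases l.eq_nil_or_concat with rfl | ⟨l', p, hl⟩
  · simp [wordProd]
  obtain ⟨n, hn⟩ : ∃ n, l.length = n + 1 := ⟨l'.length, by simp [hl]⟩
  -- With the letters of the word on the superdiagonal, the corner entry of (βY)ⁿβ is the word
  -- itself. The multiple of 1 added to make β the inverse of a point of the half plane is diagonal,
  -- and no path of n + 1 steps from the first to the last vertex can use it.
  let U : CStarMatrix (Fin (n + 2)) (Fin (n + 2)) B :=
    ofMatrix fun i j => if (j : ℕ) = i + 1 then l.getD i 0 else 0
  obtain ⟨c, w, δ, hδ, hw, hwβ, hβw⟩ := exists_imGE_mul_eq_one U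
  set β := U + c • 1 with hβ
  set ηk := (P.amp (n + 2)).covar (diagHom A (n + 2) (Y 0))
  have hη : ∀ d i j, ηk d i j = η (d i j) := fun d i j =>
    (amp_covar_apply d i j).trans (hvar 0 _)
  have hz₀ : 0 < min 1 (8 * ‖ηk‖ * ‖β‖ ^ 2 + 1)⁻¹ := lt_min one_pos (by positivity)
  have key := CondExp.tendsto_moment (𝔼 := P.amp (n + 2)) (η := ηk)
    (Y := fun N => diagHom A (n + 2) (Y N)) (R := R)
    (fun N => (norm_diagHom_le _).trans (hR N)) hwβ hβw hz₀ (fun z hz hlt => ?_) n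
  · have hentry : Tendsto (fun N => (P.amp (n + 2)).E (((P.amp (n + 2)).ι β *
        diagHom A (n + 2) (Y N)) ^ n * (P.amp (n + 2)).ι β) 0 (Fin.last (n + 1))) atTop
        (𝓝 (CondExp.arcsineCoeff ηk β n 0 (Fin.last (n + 1)))) :=
      ((continuous_entry 0 (Fin.last (n + 1))).tendsto _).comp key
    have hsup : ∀ i j : Fin (n + 2), (j : ℕ) = i + 1 → β i j = l.getD i 0 := by
      intro i j hij
      have hne : i ≠ j := fun h => by rw [h] at hij; omega
      rw [hβ, CStarMatrix.add_apply, CStarMatrix.smul_apply, CStarMatrix.one_apply, if_neg hne,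
        smul_zero, add_zero]
      exact if_pos hij
    have hzero : ∀ i j : Fin (n + 2), (i : ℕ) + 1 < j → β i j = 0 := by
      intro i j hij
      have hne : i ≠ j := fun h => by rw [h] at hij; omega
      rw [hβ, CStarMatrix.add_apply, CStarMatrix.smul_apply, CStarMatrix.one_apply, if_neg hne,
        smul_zero, add_zero]
      exact if_neg (by omega)
    have hcorner : ∀ g : List B → B, (∀ l, 0 ∈ l → g l = 0) →
        pathSum (fun i j => β i j) n g 0 (Fin.last (n + 1)) = g l := by
      intro g hg
      rw [(pathSum_corner (fun i j => β i j) (fun i => l.getD i 0) hsup hzero n g hg 0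
        (Fin.last (n + 1))).2 (by simp)]
      congr 1
      refine List.ext_getElem (by simp [hn]) fun i h1 h2 => ?_
      simp [List.getElem?_eq_getElem h2]
    have h1 : CondExp.arcsineCoeff ηk β n 0 (Fin.last (n + 1)) = arcsineMoment η l := by
      rw [← hcorner (arcsineMoment η) (fun l => arcsineMoment_eq_zero η)]
      exact (pathSum_arcsineMoment η ηk hη (fun _ _ => rfl) n _ _).symm
    rw [h1] at hentry
    refine hentry.congr fun N => ?_
    rw [← hcorner (fun l => P.E (P.wordProd (Y N) l)) fun l hl => by
      rw [wordProd_eq_zero _ hl, map_zero]]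
    exact P.amp_E_pow_apply (Y N) β n _ _
  · have hz' : (z : ℂ) ≠ 0 := by exact_mod_cast hz.ne'
    have hz1 : z ≤ 1 := (hlt.trans_le (min_le_left _ _)).le
    have hz2 : z * (8 * ‖ηk‖ * ‖β‖ ^ 2 + 1) ≤ 1 := by
      rw [← le_div_iff₀ (by positivity), one_div]
      exact (hlt.trans_le (min_le_right _ _)).le
    have hsmall : 4 * ‖ηk‖ * ‖(z : ℂ) • β‖ ^ 2 ≤ 1 / 2 := by
      rw [norm_smul, Complex.norm_real, Real.norm_of_nonneg hz.le, mul_pow]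
      have : 0 ≤ z * (‖ηk‖ * ‖β‖ ^ 2) := by positivity
      nlinarith
    have hinv : (z : ℂ)⁻¹ • w * (z : ℂ) • β = 1 := by
      rw [smul_mul_smul_comm, inv_mul_cancel₀ hz', hwβ, one_smul]
    have hz'' : 0 < z⁻¹ := inv_pos.2 hz
    have hImz : ImGE (z⁻¹ * δ) ((z : ℂ)⁻¹ • w) := by
      rw [← Complex.ofReal_inv]
      exact hw.complex_smul hz''.le
    rw [tendsto_iff_norm_sub_tendsto_zero]
    have hb : Tendsto (fun N => (z⁻¹ * δ)⁻¹ * (2 * ‖(z : ℂ) • β‖) *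
        ((((n + 2 : ℕ) : ℝ) * (z⁻¹ * δ)⁻¹ ^ 2 * √(sSup (P.fourthCumulantNorms (Y N))) * √‖η 1‖) *
        Real.exp (‖ηk‖ * (z⁻¹ * δ)⁻¹ * (2 * ‖(z : ℂ) • β‖)))) atTop (𝓝 0) := by
      have h1 : Tendsto (fun N => √(sSup (P.fourthCumulantNorms (Y N)))) atTop (𝓝 0) := by
        have := (Real.continuous_sqrt.tendsto 0).comp hlim
        rwa [Real.sqrt_zero] at this
      have := ((((h1.const_mul (((n + 2 : ℕ) : ℝ) * (z⁻¹ * δ)⁻¹ ^ 2)).mul_const √‖η 1‖).mul_const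
        (Real.exp (‖ηk‖ * (z⁻¹ * δ)⁻¹ * (2 * ‖(z : ℂ) • β‖))))).const_mul
          ((z⁻¹ * δ)⁻¹ * (2 * ‖(z : ℂ) • β‖))
      simpa using this
    exact squeeze_zero (fun _ => norm_nonneg _) (fun N => norm_cauchy_sub_arcsineFlow_le η (hY N)
      (hdiv N) (hmean N) (hvar N) hη (mul_pos hz'' hδ) hsmall hinv hImz) hb

end OVProbSpace

/-! ### Existence of arcsine elements -/

namespace OVProbSpace

open CStarMatrix BoundedContinuousFunction

variable {B : Type u} [CStarAlgebra B] [PartialOrder B] [StarOrderedRing B]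
  {A : Type v} [CStarAlgebra A] [PartialOrder A] [StarOrderedRing A] {P : OVProbSpace B A}

section Limit

variable {C : Type w} [CStarAlgebra C] [PartialOrder C] [StarOrderedRing C]

/-- Pointwise limits of expectations along a sequence of homomorphisms. -/
noncomputable def ofTendsto (P : OVProbSpace B A) (ev : ℕ → C →⋆ₐ[ℂ] A) (j : B →⋆ₐ[ℂ] C)
    (hj : ∀ N b, ev N (j b) = P.ι b) (L : C → B)
    (hL : ∀ c, Tendsto (fun N => P.E (ev N c)) atTop (𝓝 (L c))) : OVProbSpace B C where
  ι := j
  E :=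
    { toFun := L
      map_add' := fun c d => tendsto_nhds_unique (hL _) (by
        simpa only [map_add] using (hL c).add (hL d))
      map_smul' := fun r c => tendsto_nhds_unique (hL _) (by
        simpa only [map_smul, RingHom.id_apply] using (hL c).const_smul r)
      map_cstarMatrix_nonneg' := by
        intro k M hM
        -- Matrices converge entrywise and the positive cone is closed, so complete positivity
        -- survives the limit.
        have hlim : Tendsto (fun N => (P.amp k).E (mapHom k (ev N) M)) atTop (𝓝 (M.map L)) :=
          tendsto_pi_nhds.2 fun i => tendsto_pi_nhds.2 fun j => hL (M i j)
        refine CStarAlgebra.isClosed_nonneg.mem_of_tendsto hlim (Eventually.of_forall fun N => ?_)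
        exact map_nonneg (P.amp k).E (map_nonneg (mapHom k (ev N)) hM) }
  E_ι b := tendsto_nhds_unique (hL _) (by simp [hj, P.E_ι])
  E_bimodule b₁ c b₂ := tendsto_nhds_unique (hL _) (by
    simp only [map_mul, hj, P.E_bimodule]
    exact ((hL c).const_mul b₁).mul_const b₂)

lemma moment_eq_of_tendsto {Q : OVProbSpace B C} {ev : ℕ → C →⋆ₐ[ℂ] A}
    (hj : ∀ N b, ev N (Q.ι b) = P.ι b)
    (hL : ∀ c, Tendsto (fun N => P.E (ev N c)) atTop (𝓝 (Q.E c))) (x : C) (l : List B) :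
    Tendsto (fun N => P.moment (ev N x) l) atTop (𝓝 (Q.moment x l)) := by
  refine (hL _).congr fun N => ?_
  rw [moment, map_list_prod]
  simp [word, hj, Function.comp_def]

end Limit

/-- The maps are uniformly bounded in N, so an ε/3 argument applies. -/
lemma isClosed_setOf_tendsto_E {C : Type*} [CStarAlgebra C] (P : OVProbSpace B A)
    (ev : ℕ → C →⋆ₐ[ℂ] A) :
    IsClosed {c : C | ∃ L, Tendsto (fun N => P.E (ev N c)) atTop (𝓝 L)} := by
  obtain ⟨K, hK⟩ := PositiveLinearMap.exists_norm_apply_le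
    (PositiveLinearMap.mk₀ (P.E : A →ₗ[ℂ] B) fun _ h => map_nonneg P.E h)
  have hK' : ∀ N c, ‖P.E (ev N c)‖ ≤ K * ‖c‖ := fun N c =>
    (hK _).trans (by gcongr; exact NonUnitalStarAlgHom.norm_apply_le (ev N) c)
  refine isClosed_of_closure_subset fun c hc => ?_
  refine cauchySeq_tendsto_of_complete (Metric.cauchySeq_iff'.2 fun ε hε => ?_)
  obtain ⟨d, ⟨L, hd⟩, hcd⟩ := Metric.mem_closure_iff.1 hc (ε / (3 * (K + 1))) (by positivity)
  obtain ⟨N₀, hN₀⟩ := Metric.cauchySeq_iff'.1 hd.cauchySeq (ε / 3) (by positivity)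
  have hclose : ∀ N, dist (P.E (ev N c)) (P.E (ev N d)) < ε / 3 := by
    intro N
    rw [dist_eq_norm, ← map_sub, ← map_sub]
    refine (hK' N _).trans_lt ?_
    rw [← dist_eq_norm]
    have hK1 : (0 : ℝ) < K + 1 := by positivity
    calc (K : ℝ) * dist c d ≤ (K + 1) * dist c d := by gcongr; linarith
      _ < (K + 1) * (ε / (3 * (K + 1))) := by gcongr
      _ = ε / 3 := by field_simp
  refine ⟨N₀, fun n hn => ?_⟩
  have h1 := hclose n
  have h2 := hN₀ n hn
  have h3 := hclose N₀
  rw [dist_comm] at h3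
  have := dist_triangle4 (P.E (ev n c)) (P.E (ev n d)) (P.E (ev N₀ d)) (P.E (ev N₀ c))
  linarith

/-- Evaluation of bounded sequences. -/
noncomputable def evalHom (A : Type*) [CStarAlgebra A] (N : ℕ) : (ℕ →ᵇ A) →⋆ₐ[ℂ] A where
  toFun f := f N
  map_one' := rfl
  map_mul' _ _ := rfl
  map_zero' := rfl
  map_add' _ _ := rfl
  commutes' _ := rfl
  map_star' _ := rfl

/-- Constant sequences. -/
noncomputable def constHom (A : Type*) [CStarAlgebra A] : A →⋆ₐ[ℂ] (ℕ →ᵇ A) where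
  toFun a := const ℕ a
  map_one' := rfl
  map_mul' _ _ := rfl
  map_zero' := rfl
  map_add' _ _ := rfl
  commutes' _ := rfl
  map_star' _ := rfl

/-- A bounded sequence with the moments of an arcsine element in the limit gives rise to an arcsine
element. -/
lemma exists_isArcsine {Y : ℕ → A} (η : B →L[ℂ] B) (hY : ∀ N, IsSelfAdjoint (Y N)) {R : ℝ}
    (hR : ∀ N, ‖Y N‖ ≤ R) (hvar : ∀ N b, P.E (Y N * P.ι b * Y N) = η b)
    (h : ∀ l, Tendsto (fun N => P.E (P.wordProd (Y N) l)) atTop (𝓝 (arcsineMoment η l))) :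
    ∃ (A' : Type v) (_ : CStarAlgebra A') (_ : PartialOrder A') (_ : StarOrderedRing A')
      (Q : OVProbSpace B A') (X : A'), Q.IsArcsine η X := by
  -- The arcsine element is the sequence itself, in the C⋆-algebra generated by it and the constant
  -- sequences from B. The expectations converge on words, hence on this algebra, and their limit is
  -- the new conditional expectation.
  let y : ℕ →ᵇ A := ofNormedAddCommGroupDiscrete Y R hR
  let j : B →⋆ₐ[ℂ] (ℕ →ᵇ A) := (constHom A).comp P.ι
  let S := wordAlg j (fun _ : Unit => y)
  have : IsClosed (S : Set (ℕ →ᵇ A)) := isClosed_wordAlg j _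
  have hy : IsSelfAdjoint y := by
    ext N
    exact hY N
  have hconv : ∀ c ∈ S, ∃ L, Tendsto (fun N => P.E (evalHom A N c)) atTop (𝓝 L) := by
    intro c hc
    refine closure_minimal ?_ (isClosed_setOf_tendsto_E P (evalHom A))
      (wordAlg_subset_closure_span j _ (fun _ => hy) hc)
    intro a ha
    induction ha using Submodule.span_induction with
    | mem a ha =>
      obtain ⟨b, l, rfl⟩ := ha
      refine ⟨_, (h (b :: l.map Prod.snd)).congr fun N => ?_⟩
      congr 1
      rw [indexedWord, map_mul, map_list_prod, wordProd, List.map_map, List.map_map]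
      congr 2
    | zero => exact ⟨0, by simp⟩
    | add a b _ _ ha hb =>
      obtain ⟨L, hL⟩ := ha
      obtain ⟨L', hL'⟩ := hb
      exact ⟨L + L', by simpa only [map_add] using hL.add hL'⟩
    | smul r a _ ha =>
      obtain ⟨L, hL⟩ := ha
      exact ⟨r • L, by simpa only [map_smul] using hL.const_smul r⟩
  choose L hL using fun c : S => hconv c c.2
  let := CStarAlgebra.spectralOrder S
  have := CStarAlgebra.spectralOrderedRing S
  let Q : OVProbSpace B S := P.ofTendsto (fun N => (evalHom A N).comp S.subtype)
    (j.codRestrict S (ι_mem_wordAlg j _)) (fun _ _ => rfl) L hL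
  let X : S := ⟨y, mem_wordAlg j _ ()⟩
  have hmom := moment_eq_of_tendsto (Q := Q) (P := P)
    (ev := fun N => (evalHom A N).comp S.subtype) (fun _ _ => rfl) hL X
  have hvar' : ∀ b, Q.E (X * Q.ι b * X) = η b := by
    intro b
    rw [← moment_singleton]
    refine tendsto_nhds_unique (hmom [b]) (tendsto_const_nhds.congr fun N => ?_)
    rw [moment_singleton]
    exact (hvar N b).symm
  refine ⟨S, inferInstance, inferInstance, inferInstance, Q, X, Subtype.ext hy, hvar', fun l => ?_⟩
  rw [Q.sum_NC₂_word η hvar' l rfl]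
  refine tendsto_nhds_unique (hmom l) ((h _).congr fun N => ?_)
  rw [E_wordProd, one_mul, mul_one]
  rfl

end OVProbSpace

/-! ### Convergence in distribution with respect to a state -/

section FunctionalCalculus

variable {A : Type v} [CStarAlgebra A] {A' : Type w} [CStarAlgebra A']

lemma norm_cfc_sub_aeval_le {Y : A} (hY : IsSelfAdjoint Y) {R : ℝ} (hR : ‖Y‖ ≤ R) {f : ℝ → ℝ}
    (hf : Continuous f) {p : Polynomial ℝ} {ε : ℝ}
    (hp : ∀ x ∈ Set.Icc (-R) R, |p.eval x - f x| < ε) (hε : 0 ≤ ε) :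
    ‖cfc f Y - Polynomial.aeval Y p‖ ≤ ε := by
  rw [← cfc_polynomial p Y, ← cfc_sub f _ Y hf.continuousOn p.continuous.continuousOn]
  refine norm_cfc_le hε fun x hx => ?_
  rcases subsingleton_or_nontrivial A with h | h
  · rw [spectrum.of_subsingleton] at hx
    exact absurd hx (Set.notMem_empty x)
  · have hxR : |x| ≤ R := (spectrum.norm_le_norm_of_mem hx).trans hR
    rw [norm_sub_rev]
    exact (hp x (abs_le.1 hxR)).le

/-- All spectra lie in one compact interval, where f is uniformly approximated by a polynomial; the
functionals are bounded, so the error is uniform in N. -/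
lemma tendsto_cfc_of_tendsto_pow {Y : ℕ → A} {X : A'} (hY : ∀ N, IsSelfAdjoint (Y N))
    (hX : IsSelfAdjoint X) {R : ℝ} (hR : ∀ N, ‖Y N‖ ≤ R) (φ : A →L[ℂ] ℂ) (ψ : A' →L[ℂ] ℂ)
    (h : ∀ m : ℕ, Tendsto (fun N => φ (Y N ^ m)) atTop (𝓝 (ψ (X ^ m)))) {f : ℝ → ℝ}
    (hf : Continuous f) : Tendsto (fun N => φ (cfc f (Y N))) atTop (𝓝 (ψ (cfc f X))) := by
  have hpoly : ∀ p : Polynomial ℝ, Tendsto (fun N => φ (Polynomial.aeval (Y N) p)) atTop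
      (𝓝 (ψ (Polynomial.aeval X p))) := by
    intro p
    simp only [Polynomial.aeval_eq_sum_range, map_sum, ← Complex.coe_smul, map_smul]
    exact tendsto_finsetSum _ fun m _ => (h m).const_smul _
  set R' := max R ‖X‖
  rw [Metric.tendsto_atTop]
  intro ε hε
  set δ := ε / (3 * (‖φ‖ + ‖ψ‖ + 1)) with hδ
  have hδ0 : 0 < δ := by positivity
  obtain ⟨p, hp⟩ := exists_polynomial_near_of_continuousOn (-R') R' f hf.continuousOn δ hδ0
  obtain ⟨N₀, hN₀⟩ := Metric.tendsto_atTop.1 (hpoly p) (ε / 3) (by positivity)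
  have hsmall : (‖φ‖ + ‖ψ‖ + 1) * δ = ε / 3 := by rw [hδ]; field_simp
  refine ⟨N₀, fun N hN => ?_⟩
  have h1 : dist (φ (cfc f (Y N))) (φ (Polynomial.aeval (Y N) p)) ≤ ‖φ‖ * δ := by
    rw [dist_eq_norm, ← map_sub]
    exact (φ.le_opNorm _).trans (by
      gcongr; exact norm_cfc_sub_aeval_le (hY N) ((hR N).trans (le_max_left _ _)) hf hp hδ0.le)
  have h2 : dist (ψ (Polynomial.aeval X p)) (ψ (cfc f X)) ≤ ‖ψ‖ * δ := by
    rw [dist_comm, dist_eq_norm, ← map_sub]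
    exact (ψ.le_opNorm _).trans (by
      gcongr; exact norm_cfc_sub_aeval_le hX (le_max_right _ _) hf hp hδ0.le)
  have h3 := hN₀ N hN
  have := dist_triangle4 (φ (cfc f (Y N))) (φ (Polynomial.aeval (Y N) p))
    (ψ (Polynomial.aeval X p)) (ψ (cfc f X))
  nlinarith

end FunctionalCalculus

namespace OVProbSpace

variable {B : Type u} [CStarAlgebra B] [PartialOrder B] [StarOrderedRing B]
  {A : Type v} [CStarAlgebra A] [PartialOrder A] [StarOrderedRing A] {P : OVProbSpace B A}
  {A' : Type w} [CStarAlgebra A'] [PartialOrder A'] [StarOrderedRing A'] {Q : OVProbSpace B A'}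

lemma E_pow_succ (x : A) (m : ℕ) : P.E (x ^ (m + 1)) = P.moment x (List.replicate m 1) := by
  simp [moment, word, pow_succ]

lemma E_one : P.E 1 = 1 := by simpa using P.E_ι 1

/-- Convergence in distribution over `B` implies convergence in distribution with respect to
states which factor through the expectation. -/
lemma ConvergesInDistribution.tendsto_cfc {Y : ℕ → A} {X : A'}
    (h : P.ConvergesInDistribution Y Q X) (hY : ∀ N, IsSelfAdjoint (Y N)) (hX : IsSelfAdjoint X)
    {R : ℝ} (hR : ∀ N, ‖Y N‖ ≤ R) (φ : A →ₚ[ℂ] ℂ) (hφ : ∀ a, φ (P.ι (P.E a)) = φ a) {f : ℝ → ℝ}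
    (hf : Continuous f) :
    Tendsto (fun N => φ (cfc f (Y N))) atTop (𝓝 (φ (P.ι (Q.E (cfc f X))))) := by
  obtain ⟨K, hK⟩ := PositiveLinearMap.exists_norm_apply_le φ
  let Φ : A →L[ℂ] ℂ := LinearMap.mkContinuous φ.toLinearMap K hK
  have hι : Continuous P.ι := AddMonoidHomClass.continuous_of_bound P.ι 1 fun d => by
    simpa using NonUnitalStarAlgHom.norm_apply_le P.ι d
  let Ψ : A' →L[ℂ] ℂ :=
    ⟨Φ.toLinearMap ∘ₗ P.ι.toAlgHom.toLinearMap ∘ₗ Q.E.toLinearMap,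
      Φ.continuous.comp (hι.comp Q.continuous_E)⟩
  refine tendsto_cfc_of_tendsto_pow hY hX hR Φ Ψ (fun m => ?_) hf
  have key : Tendsto (fun N => P.E (Y N ^ m)) atTop (𝓝 (Q.E (X ^ m))) := by
    cases m with
    | zero => simp [E_one]
    | succ m => simpa only [E_pow_succ] using h (List.replicate m 1)
  refine (((Φ.continuous.comp hι).tendsto _).comp key).congr fun N => ?_
  exact hφ _

/-- The variance of an element is a continuous linear map. -/
lemma exists_clm_eq_of_variance {Y : A} {η : B → B} (h : ∀ b, P.E (Y * P.ι b * Y) = η b) :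
    ∃ η' : B →L[ℂ] B, ⇑η' = η := by
  have hι : Continuous P.ι := AddMonoidHomClass.continuous_of_bound P.ι 1 fun d => by
    simpa using NonUnitalStarAlgHom.norm_apply_le P.ι d
  refine ⟨⟨⟨⟨η, fun b c => ?_⟩, fun r b => ?_⟩, ?_⟩, rfl⟩
  · simp only [← h, map_add, mul_add, add_mul]
  · simp only [← h, map_smul, mul_smul_comm, smul_mul_assoc, RingHom.id_apply]
  · change Continuous η
    rw [← funext h]
    exact P.continuous_E.comp ((continuous_const.mul hι).mul continuous_const)

lemma IsArcsine.moment_eq_arcsineMoment {η : B →L[ℂ] B} {X : A} (h : P.IsArcsine η X)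
    (l : List B) : P.moment X l = arcsineMoment η (1 :: (l ++ [1])) := by
  have key := h.E_wordProd (1 :: (l ++ [1]))
  rwa [OVProbSpace.E_wordProd, one_mul, mul_one] at key

end OVProbSpace

theorem theorem4p5 {B : Type u} [CStarAlgebra B] [PartialOrder B] [StarOrderedRing B]
    {A : Type v} [CStarAlgebra A] [PartialOrder A] [StarOrderedRing A]
    (P : OVProbSpace B A) (η : B → B) :
    (∀ Y : A, IsSelfAdjoint Y →
      (∀ n : ℕ, 0 < n → OVProbSpace.IsMonotoneDivisible.{u, v, z} P Y n) →
      P.E Y = 0 → (∀ b, P.E (Y * P.ι b * Y) = η b) →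
      BddAbove (P.fourthCumulantNorms Y) ∧
      ∀ (A' : Type w) [CStarAlgebra A'] [PartialOrder A'] [StarOrderedRing A']
        (Q : OVProbSpace B A') (X : A'), Q.IsArcsine η X →
        ∀ (k : ℕ) (𝔟 : CStarMatrix (Fin k) (Fin k) B), 𝔟 ∈ upperHalfPlane _ →
          IsUnit (P.matrixShift Y 𝔟) ∧ IsUnit (Q.matrixShift X 𝔟) ∧
          ‖P.cauchyTransform Y 𝔟 - Q.cauchyTransform X 𝔟‖ ≤
            k * ‖Ring.inverse (imaginaryPart 𝔟 : CStarMatrix (Fin k) (Fin k) B)‖ ^ 4 *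
              √‖η 1‖ * √(sSup (P.fourthCumulantNorms Y))) ∧
    (∀ Y : ℕ → A, (∀ N, IsSelfAdjoint (Y N)) →
      (∀ N, ∀ n : ℕ, 0 < n → OVProbSpace.IsMonotoneDivisible.{u, v, z} P (Y N) n) →
      (∀ N, P.E (Y N) = 0) → (∀ N b, P.E (Y N * P.ι b * Y N) = η b) →
      (∃ R : ℝ, ∀ N, ‖Y N‖ ≤ R) →
      Tendsto (fun N => sSup (P.fourthCumulantNorms (Y N))) atTop (𝓝 0) →
      (∃ (A' : Type v) (_ : CStarAlgebra A') (_ : PartialOrder A') (_ : StarOrderedRing A')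
        (Q : OVProbSpace B A') (X : A'), Q.IsArcsine η X) ∧
      ∀ (A' : Type w) [CStarAlgebra A'] [PartialOrder A'] [StarOrderedRing A']
        (Q : OVProbSpace B A') (X : A'), Q.IsArcsine η X →
        P.ConvergesInDistribution Y Q X ∧
        ∀ φ : A →ₚ[ℂ] ℂ, φ 1 = 1 → (∀ a, φ (P.ι (P.E a)) = φ a) →
          ∀ f : ℝ → ℝ, Continuous f →
            Tendsto (fun N => φ (cfc f (Y N))) atTop (𝓝 (φ (P.ι (Q.E (cfc f X)))))) := by
  refine ⟨fun Y hY hdiv hmean hvar => ?_, fun Y hY hdiv hmean hvar ⟨R, hR⟩ hlim => ?_⟩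
  -- The bare function η is linear and continuous because it is a variance; all estimates use its
  -- operator norm.
  · obtain ⟨η, rfl⟩ := OVProbSpace.exists_clm_eq_of_variance hvar
    exact ⟨OVProbSpace.bddAbove_fourthCumulantNorms η hmean hvar, fun A' _ _ _ Q X hX k b hb =>
      ⟨OVProbSpace.isUnit_matrixShift hY hb, OVProbSpace.isUnit_matrixShift hX.isSelfAdjoint hb,
        OVProbSpace.norm_cauchyTransform_sub_le η hY hdiv hmean hvar hX hb⟩⟩
  · obtain ⟨η, rfl⟩ := OVProbSpace.exists_clm_eq_of_variance (hvar 0)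
    have hmom := OVProbSpace.tendsto_E_wordProd η hY hdiv hmean hvar hR hlim
    refine ⟨OVProbSpace.exists_isArcsine η hY hR hvar hmom, fun A' _ _ _ Q X hX => ?_⟩
    have hconv : P.ConvergesInDistribution Y Q X := by
      intro l
      rw [hX.moment_eq_arcsineMoment]
      refine (hmom _).congr fun N => ?_
      rw [OVProbSpace.E_wordProd, one_mul, mul_one]
    exact ⟨hconv, fun φ _ hφ f hf => hconv.tendsto_cfc hY hX.isSelfAdjoint hR φ hφ hf⟩
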